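/- A knot is a subset $K\subset\mathbb{R}^3$ homeomorphic to a circle, considered up to ambient isotopy; it is trivial if it is ambient isotopic to a round circle. Write $\sigma_1,\dots,\sigma_{n-1}$ for the standard generators of the $n$-strand braid group. An $n$-braid word represents $K$ if its closure is ambient isotopic to $K$, and its length is the number of letters $\sigma_i^{\pm1}$ in it, that is, the number of crossings. Let $br(K)$ be the braid index of $K$, the least number of strands of a braid representing $K$ ($\infty$ if no braid represents $K$). For integers $n\ge br(K)$ let $b_n(K)$ be the minimum length of an $n$-braid word representing $K$, and put $b_n'(K)=b_n(K)-n\in\mathbb{Z}$. The trefoil is the closure of the $2$-braid $\sigma_1^{3}$ or of its mirror image $\sigma_1^{-3}$, and the figure-eight knot is the closure of the $3$-braid $\sigma_1\sigma_2^{-1}\sigma_1\sigma_2^{-1}$. Theorem. Let $K$ be a nontrivial knot. Then $b_n'(K)=1$ for some $n\ge br(K)$ if and only if $K$ is the trefoil (of either handedness) or the figure-eight knot. Hence, if $K$ is neither the trefoil nor the figure-eight knot, then $b_n'(K)\ge 3$ for all $n\ge br(K)$. -/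

import Mathlib

namespace KnotBraid

/-- Three-dimensional space with coordinates `(x, y, z)`. -/
abbrev Space : Type := ℝ × ℝ × ℝ

/-- A knot: a subset of three-space that is an embedded circle. -/
def IsKnot (K : Set Space) : Prop :=
  ∃ f : Circle → Space, Topology.IsEmbedding f ∧ Set.range f = K

/-- `K` and `K'` are ambient isotopic: a continuous family of self-homeomorphisms of
three-space starts at the identity and ends at one that carries `K` onto `K'`. -/
def AmbientIsotopic (K K' : Set Space) : Prop :=
  ∃ H : unitInterval → (Space ≃ₜ Space),
    Continuous (fun p : unitInterval × Space => H p.1 p.2) ∧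
    (∀ p, H 0 p = p) ∧ H 1 '' K = K'

/-- A flat round circle, in the plane `y = 0`. -/
def roundCircle : Set Space := {p | p.1 ^ 2 + p.2.2 ^ 2 = 1 ∧ p.2.1 = 0}

/-- The trivial knot. -/
def IsTrivial (K : Set Space) : Prop := AmbientIsotopic K roundCircle

/-- A braid word on `n` strands. The strand positions are `0, …, n - 1`; the letter
`(i, true)` is the Artin generator exchanging the strands in positions `i` and `i + 1`,
and `(i, false)` is its inverse. The length of the list is the number of crossings. -/
abbrev BraidWord (n : ℕ) : Type := List (Fin (n - 1) × Bool)

/-- A crossing drawn over `[x, x + 1]` between the positions `i` and `i + 1`. The strand from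
position `i + 1` to position `i` is straight, at height `0`; the strand from position `i` to
position `i + 1` passes over it (height `1`) for a generator and under it (height `-1`) for
the inverse of a generator. -/
def crossing (x : ℝ) (i : ℕ) (positive : Bool) : Set Space :=
  segment ℝ ((x, (i : ℝ), 0) : Space)
      (x + 1 / 2, (i : ℝ) + 1 / 2, if positive then 1 else -1) ∪
    segment ℝ ((x + 1 / 2, (i : ℝ) + 1 / 2, if positive then 1 else -1) : Space)
      (x + 1, (i : ℝ) + 1, 0) ∪
    segment ℝ ((x, (i : ℝ) + 1, 0) : Space) (x + 1, (i : ℝ), 0)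

/-- The elementary `n`-braid of one letter, drawn over `[x, x + 1]`: the crossing, and the
remaining strands running straight. -/
def elementaryBraid (n : ℕ) (x : ℝ) (g : Fin (n - 1) × Bool) : Set Space :=
  crossing x (g.1 : ℕ) g.2 ∪
    ⋃ j : {j : Fin n // (j : ℕ) ≠ (g.1 : ℕ) ∧ (j : ℕ) ≠ (g.1 : ℕ) + 1},
      segment ℝ ((x, ((j : Fin n) : ℝ), 0) : Space) (x + 1, ((j : Fin n) : ℝ), 0)

/-- The arc in the plane `y = j` that joins the end `(l, j, 0)` of a braid drawn over `[0, l]`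
to its beginning `(0, j, 0)`, passing below the braid at height `-2`. -/
def closingArc (l j : ℕ) : Set Space :=
  segment ℝ (((l : ℝ), (j : ℝ), 0) : Space) ((l : ℝ) + 1, (j : ℝ), 0) ∪
    segment ℝ (((l : ℝ) + 1, (j : ℝ), 0) : Space) ((l : ℝ) + 1, (j : ℝ), -2) ∪
    segment ℝ (((l : ℝ) + 1, (j : ℝ), -2) : Space) (0, (j : ℝ), -2) ∪
    segment ℝ ((0, (j : ℝ), -2) : Space) (0, (j : ℝ), 0)

/-- The closed braid of a braid word on `n` strands: the letters are drawn one after the other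
over `[0, 1], [1, 2], …`, and the ends are joined by the parallel closing arcs. -/
def closedBraid {n : ℕ} (w : BraidWord n) : Set Space :=
  (⋃ k : Fin w.length, elementaryBraid n ((k : ℕ) : ℝ) (w.get k)) ∪
    ⋃ j : Fin n, closingArc w.length (j : ℕ)

/-- The braid word `w` represents `K`. -/
def Represents {n : ℕ} (w : BraidWord n) (K : Set Space) : Prop :=
  AmbientIsotopic (closedBraid w) K

/-- The braid index: the least number of strands of a braid representing `K`
(it is `⊤` for a set that no braid represents). -/
noncomputable def braidIndex (K : Set Space) : ℕ∞ :=
  ⨅ n ∈ {n : ℕ | ∃ w : BraidWord n, Represents w K}, (n : ℕ∞)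

/-- `b_n(K)`: the minimum length of an `n`-braid representing `K`, meant for
`braidIndex K ≤ n`. -/
noncomputable def minLength (n : ℕ) (K : Set Space) : ℕ :=
  sInf {l : ℕ | ∃ w : BraidWord n, w.length = l ∧ Represents w K}

/-- `b_n'(K) = b_n(K) - n`, as an integer. -/
noncomputable def reducedLength (n : ℕ) (K : Set Space) : ℤ := (minLength n K : ℤ) - (n : ℤ)

/-- The 2-braid `σ₁³` (for `true`) or `σ₁⁻³` (for `false`). -/
def trefoilWord (e : Bool) : BraidWord 2 := [(0, e), (0, e), (0, e)]

/-- The 3-braid `σ₁ σ₂⁻¹ σ₁ σ₂⁻¹`. -/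
def figureEightWord : BraidWord 3 := [(0, true), (1, false), (0, true), (1, false)]

/-- `K` is a trefoil, of either handedness. -/
def IsTrefoil (K : Set Space) : Prop := ∃ e : Bool, AmbientIsotopic K (closedBraid (trefoilWord e))

/-- `K` is the figure-eight knot. -/
def IsFigureEight (K : Set Space) : Prop := AmbientIsotopic K (closedBraid figureEightWord)

end KnotBraid

/-!
Alexander's trick makes every homeomorphism of a normed space that moves the points a bounded
distance isotopic to the identity. So a vertex of a polygon can be pushed across a bounded convex
cell that the rest of the set avoids, and the braid relations, conjugation by a generator and
destabilization come down to sequences of such pushes between polygons with vertices in `(ℤ/4)³`,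
whose admissibility is a computation with integers.

If the closure of a word on `n` strands is connected, its permutation is an `n`-cycle. Hence every
generator occurs, and the length is at least `n - 1` and has the parity of `n - 1`. A word of length
`n - 1` uses every generator once and destabilizes to the trivial knot. In a word of length `n + 1`,
the first or the last generator occurs once, and the word destabilizes, possibly after a half turn;
or `n = 2`; or `n = 3` and both generators occur twice. For `n ≥ 4` the first generator could
otherwise only occur twice and the second once, and then some strand would close up on its own.
-/

namespace KnotBraid

open Topology

/-! ### Isotopies with bounded support -/

section Isotopy

variable {K K' K'' : Set Space}

theorem AmbientIsotopic.refl (K : Set Space) : AmbientIsotopic K K :=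
  ⟨fun _ => Homeomorph.refl _, continuous_snd, fun _ => rfl, Set.image_id K⟩

theorem AmbientIsotopic.symm (h : AmbientIsotopic K K') : AmbientIsotopic K' K := by
  obtain ⟨H, hH, hH₀, rfl⟩ := h
  refine ⟨fun t => (H 1).symm.trans (H (unitInterval.symm t)), ?_, fun p => by simp, ?_⟩
  · exact hH.comp 
      (f := fun p : unitInterval × Space => (unitInterval.symm p.1, (H 1).symm p.2)) (by fun_prop)
  · simp [Set.image_image, hH₀]

theorem AmbientIsotopic.trans (h : AmbientIsotopic K K') (h' : AmbientIsotopic K' K'') :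
    AmbientIsotopic K K'' := by
  obtain ⟨H, hH, hH₀, rfl⟩ := h
  obtain ⟨G, hG, hG₀, rfl⟩ := h'
  refine ⟨fun t => (H t).trans (G t), ?_, fun p => by simp [hH₀, hG₀],
    Set.image_comp (G 1) (H 1) K⟩
  exact hG.comp (f := fun p : unitInterval × Space => (p.1, H p.1 p.2)) (by fun_prop)

theorem AmbientIsotopic.image (Φ : Space ≃ₜ Space) (h : AmbientIsotopic K K') :
    AmbientIsotopic (Φ '' K) (Φ '' K') := by
  obtain ⟨H, hH, hH₀, rfl⟩ := h
  refine ⟨fun t => (Φ.symm.trans (H t)).trans Φ, ?_, fun p => by simp [hH₀], ?_⟩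
  · exact Φ.continuous.comp (hH.comp
      (f := fun p : unitInterval × Space => (p.1, Φ.symm p.2)) (by fun_prop))
  · simp [Set.image_image]

theorem AmbientIsotopic.of_image (Φ : Space ≃ₜ Space)
    (h : AmbientIsotopic (Φ '' K) (Φ '' K')) : AmbientIsotopic K K' := by
  simpa [Set.image_image] using h.image Φ.symm

end Isotopy

section Alexander

variable {E : Type*} [NormedAddCommGroup E] [NormedSpace ℝ E] {F : E ≃ₜ E} {C : ℝ}

/-- Alexander's isotopy from the identity, at time `0`, to `F`, at time `1`: conjugation of `F`
by the homothety of ratio `t`. -/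
noncomputable def alexanderIsotopy (F : E ≃ₜ E) (t : ℝ) : E ≃ₜ E :=
  open Classical in
  if ht : t = 0 then Homeomorph.refl E
  else ((Homeomorph.smulOfNeZero t ht).symm.trans F).trans (Homeomorph.smulOfNeZero t ht)

theorem alexanderIsotopy_zero (p : E) : alexanderIsotopy F 0 p = p := by
  simp [alexanderIsotopy]

theorem alexanderIsotopy_of_ne_zero {t : ℝ} (ht : t ≠ 0) (p : E) :
    alexanderIsotopy F t p = t • F (t⁻¹ • p) := by
  rw [alexanderIsotopy, dif_neg ht]
  rfl

theorem norm_alexanderIsotopy_sub_le (hF : ∀ p, ‖F p - p‖ ≤ C) (t : ℝ) (p : E) :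
    ‖alexanderIsotopy F t p - p‖ ≤ |t| * C := by
  rcases eq_or_ne t 0 with rfl | ht
  · simp [alexanderIsotopy_zero]
  · calc ‖alexanderIsotopy F t p - p‖ = ‖t • (F (t⁻¹ • p) - t⁻¹ • p)‖ := by
          rw [alexanderIsotopy_of_ne_zero ht, smul_sub, smul_inv_smul₀ ht]
      _ = |t| * ‖F (t⁻¹ • p) - t⁻¹ • p‖ := by rw [norm_smul, Real.norm_eq_abs]
      _ ≤ |t| * C := by gcongr; exact hF _

theorem continuousAt_alexanderIsotopy_zero (hF : ∀ p, ‖F p - p‖ ≤ C) (p : E) :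
    ContinuousAt (fun q : ℝ × E => alexanderIsotopy F q.1 q.2) (0, p) := by
  have hbound (q : ℝ × E) : ‖alexanderIsotopy F q.1 q.2 - p‖ ≤ |q.1| * C + ‖q.2 - p‖ :=
    (norm_sub_le_norm_sub_add_norm_sub _ q.2 _).trans
      (add_le_add_left (norm_alexanderIsotopy_sub_le hF _ _) _)
  have hlim : Filter.Tendsto (fun q : ℝ × E => |q.1| * C + ‖q.2 - p‖) (𝓝 (0, p)) (𝓝 0) := by
    have : Continuous fun q : ℝ × E => |q.1| * C + ‖q.2 - p‖ := by fun_prop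
    simpa using this.tendsto (0, p)
  rw [ContinuousAt, alexanderIsotopy_zero, tendsto_iff_norm_sub_tendsto_zero]
  exact squeeze_zero (fun _ => norm_nonneg _) hbound hlim

theorem continuous_alexanderIsotopy (hF : ∀ p, ‖F p - p‖ ≤ C) :
    Continuous fun q : ℝ × E => alexanderIsotopy F q.1 q.2 := by
  refine continuous_iff_continuousAt.2 fun ⟨t, p⟩ => ?_
  rcases eq_or_ne t 0 with rfl | ht
  · exact continuousAt_alexanderIsotopy_zero hF p
  · have hcont : ContinuousAt (fun q : ℝ × E => q.1 • F (q.1⁻¹ • q.2)) (t, p) :=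
      continuousAt_fst.smul (F.continuous.continuousAt.comp
        ((continuousAt_fst.inv₀ ht).smul continuousAt_snd))
    refine hcont.congr ?_
    filter_upwards [continuousAt_fst.eventually_ne (x := (t, p)) ht] with q hq
    exact (alexanderIsotopy_of_ne_zero hq q.2).symm

theorem ambientIsotopic_image_of_bounded {F : Space ≃ₜ Space} (hF : ∀ p, ‖F p - p‖ ≤ C)
    (K : Set Space) : AmbientIsotopic K (F '' K) := by
  refine ⟨fun t => alexanderIsotopy F t, ?_, alexanderIsotopy_zero, ?_⟩
  · exact (continuous_alexanderIsotopy hF).comp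
      (f := fun p : unitInterval × Space => ((p.1 : ℝ), p.2)) (by fun_prop)
  · refine Set.image_congr fun p _ => ?_
    simp only [Set.Icc.coe_one]
    rw [alexanderIsotopy_of_ne_zero one_ne_zero, inv_one, one_smul, one_smul]

end Alexander

section Push

theorem preimage_add_left_mem_nhds_zero {E : Type*} [TopologicalSpace E] [AddMonoid E]
    [ContinuousAdd E] {U : Set E} {m : E} (ho : IsOpen U) (hm : m ∈ U) :
    (fun q => m + q) ⁻¹' U ∈ 𝓝 (0 : E) :=
  (ho.preimage (by fun_prop)).mem_nhds (by simpa using hm)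

variable {E : Type*} [NormedAddCommGroup E] [NormedSpace ℝ E] {U : Set E} {m c u p : E}

/-- The gauge of `U` seen from its point `m`: the ratio of the distance from `m` to `p` and the
distance from `m` to the frontier of `U` in the direction of `p`. -/
noncomputable def gaugeFrom (U : Set E) (m p : E) : ℝ :=
  gauge ((fun q => m + q) ⁻¹' U) (p - m)

theorem continuous_gaugeFrom (ho : IsOpen U) (hc : Convex ℝ U) (hm : m ∈ U) :
    Continuous (gaugeFrom U m) :=
  (continuous_gauge (hc.translate_preimage_right m)
    (preimage_add_left_mem_nhds_zero ho hm)).comp (by fun_prop)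

theorem gaugeFrom_lt_one_iff (ho : IsOpen U) (hc : Convex ℝ U) (hm : m ∈ U) :
    gaugeFrom U m p < 1 ↔ p ∈ U := by
  rw [gaugeFrom, gauge_lt_one_iff_mem_interior (hc.translate_preimage_right m)
    (preimage_add_left_mem_nhds_zero ho hm), (ho.preimage (by fun_prop)).interior_eq,
    Set.mem_preimage, add_sub_cancel]

theorem gaugeFrom_le_one_iff (ho : IsOpen U) (hc : Convex ℝ U) (hm : m ∈ U) :
    gaugeFrom U m p ≤ 1 ↔ p ∈ closure U := by
  rw [gaugeFrom, gauge_le_one_iff_mem_closure (hc.translate_preimage_right m)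
    (preimage_add_left_mem_nhds_zero ho hm),
    ← show _ = closure ((fun q => m + q) ⁻¹' U) from (Homeomorph.addLeft m).preimage_closure U,
    Set.mem_preimage, Homeomorph.coe_addLeft]
  simp only [add_sub_cancel]

theorem gaugeFrom_eq_one_iff (ho : IsOpen U) (hc : Convex ℝ U) (hm : m ∈ U) :
    gaugeFrom U m p = 1 ↔ p ∈ closure U \ U := by
  rw [Set.mem_sdiff, ← gaugeFrom_le_one_iff ho hc hm, ← gaugeFrom_lt_one_iff ho hc hm, not_lt,
    le_antisymm_iff]

theorem gaugeFrom_nonneg (m p : E) : 0 ≤ gaugeFrom U m p := gauge_nonneg _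

theorem gaugeFrom_add_smul_sub (m u : E) {s : ℝ} (hs : 0 ≤ s) :
    gaugeFrom U m (m + s • (u - m)) = s * gaugeFrom U m u := by
  rw [gaugeFrom, add_sub_cancel_left, gauge_smul_of_nonneg hs, smul_eq_mul, gaugeFrom]

theorem gaugeFrom_eq_zero_iff (ho : IsOpen U) (hb : Bornology.IsBounded U) (hm : m ∈ U) :
    gaugeFrom U m p = 0 ↔ p = m := by
  have hb' : Bornology.IsBounded ((fun q => m + q) ⁻¹' U) :=
    (isometry_add_left m).antilipschitz.isBounded_preimage hb
  rw [gaugeFrom, gauge_eq_zero (absorbent_nhds_zero (preimage_add_left_mem_nhds_zero ho hm))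
    ((NormedSpace.isVonNBounded_iff ℝ).2 hb'), sub_eq_zero]

/-- The map that moves `m` to `c`, is affine on every ray from `m` to the frontier of `U`, and
fixes the complement of `U`. -/
noncomputable def push (U : Set E) (m c p : E) : E :=
  p + max 0 (1 - gaugeFrom U m p) • (c - m)

theorem continuous_push (ho : IsOpen U) (hc : Convex ℝ U) (hm : m ∈ U) (c : E) :
    Continuous (push U m c) := by
  have := continuous_gaugeFrom ho hc hm
  unfold push
  fun_prop

theorem push_of_notMem (ho : IsOpen U) (hc : Convex ℝ U) (hm : m ∈ U) (c : E) (hp : p ∉ U) :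
    push U m c p = p := by
  have h : 1 ≤ gaugeFrom U m p := not_lt.1 ((gaugeFrom_lt_one_iff ho hc hm).not.2 hp)
  rw [push, max_eq_left (sub_nonpos.2 h), zero_smul, add_zero]

theorem push_self (ho : IsOpen U) (hb : Bornology.IsBounded U) (hm : m ∈ U) (c : E) :
    push U m c m = c := by
  rw [push, (gaugeFrom_eq_zero_iff ho hb hm).2 rfl]
  simp

theorem push_add_smul_sub (ho : IsOpen U) (hc : Convex ℝ U) (hm : m ∈ U) (c : E)
    (hu : u ∈ closure U \ U) {s : ℝ} (hs : s ∈ Set.Icc (0 : ℝ) 1) :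
    push U m c (m + s • (u - m)) = c + s • (u - c) := by
  rw [push, gaugeFrom_add_smul_sub m u hs.1, (gaugeFrom_eq_one_iff ho hc hm).2 hu, mul_one,
    max_eq_right (sub_nonneg.2 hs.2)]
  module

theorem exists_eq_add_smul_sub_of_mem (ho : IsOpen U) (hc : Convex ℝ U)
    (hb : Bornology.IsBounded U) (hm : m ∈ U) (hp : p ∈ U) (hpm : p ≠ m) :
    ∃ u ∈ closure U \ U, ∃ s ∈ Set.Icc (0 : ℝ) 1, p = m + s • (u - m) := by
  set g := gaugeFrom U m p with hg
  have hg0 : 0 < g := (gaugeFrom_nonneg m p).lt_of_ne'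
    ((gaugeFrom_eq_zero_iff ho hb hm).not.2 hpm)
  refine ⟨m + g⁻¹ • (p - m), (gaugeFrom_eq_one_iff ho hc hm).1 ?_, g,
    ⟨hg0.le, ((gaugeFrom_lt_one_iff ho hc hm).2 hp).le⟩, ?_⟩
  · rw [gaugeFrom_add_smul_sub m p (inv_nonneg.2 hg0.le), ← hg, inv_mul_cancel₀ hg0.ne']
  · rw [add_sub_cancel_left, smul_inv_smul₀ hg0.ne', add_sub_cancel]

theorem push_push (ho : IsOpen U) (hc : Convex ℝ U) (hb : Bornology.IsBounded U)
    (hm : m ∈ U) (hcU : c ∈ U) (p : E) : push U c m (push U m c p) = p := by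
  by_cases hp : p ∈ U
  · rcases eq_or_ne p m with rfl | hpm
    · rw [push_self ho hb hm, push_self ho hb hcU]
    · obtain ⟨u, hu, s, hs, rfl⟩ := exists_eq_add_smul_sub_of_mem ho hc hb hm hp hpm
      rw [push_add_smul_sub ho hc hm c hu hs, push_add_smul_sub ho hc hcU m hu hs]
  · rw [push_of_notMem ho hc hm c hp, push_of_notMem ho hc hcU m hp]

/-- `push U m c` as a homeomorphism; its inverse is `push U c m`. -/
noncomputable def pushHomeomorph (ho : IsOpen U) (hc : Convex ℝ U) (hb : Bornology.IsBounded U)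
    (hm : m ∈ U) (hcU : c ∈ U) : E ≃ₜ E where
  toFun := push U m c
  invFun := push U c m
  left_inv := push_push ho hc hb hm hcU
  right_inv := push_push ho hc hb hcU hm
  continuous_toFun := continuous_push ho hc hm c
  continuous_invFun := continuous_push ho hc hcU m

theorem norm_push_sub_le (m c p : E) : ‖push U m c p - p‖ ≤ ‖c - m‖ := by
  have h : max 0 (1 - gaugeFrom U m p) ≤ 1 :=
    max_le zero_le_one (sub_le_self 1 (gaugeFrom_nonneg m p))
  rw [push, add_sub_cancel_left, norm_smul, Real.norm_of_nonneg (le_max_left _ _)]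
  exact mul_le_of_le_one_left (norm_nonneg _) h

theorem push_image_of_disjoint (ho : IsOpen U) (hc : Convex ℝ U) (hm : m ∈ U) (c : E) {R : Set E}
    (hR : Disjoint R U) : push U m c '' R = R :=
  (Set.image_congr fun _ hp => push_of_notMem ho hc hm c (hR.notMem_of_mem_left hp)).trans
    (Set.image_id' R)

theorem push_image_segment (ho : IsOpen U) (hc : Convex ℝ U) (hm : m ∈ U) (c : E)
    (hu : u ∈ closure U \ U) : push U m c '' segment ℝ m u = segment ℝ c u := by
  rw [segment_eq_image', segment_eq_image', Set.image_image]
  exact Set.image_congr fun _ hs => push_add_smul_sub ho hc hm c hu hs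

theorem ambientIsotopic_push {U R : Set Space} {a b m c : Space} (ho : IsOpen U)
    (hc : Convex ℝ U) (hb : Bornology.IsBounded U) (hm : m ∈ U) (hcU : c ∈ U)
    (ha : a ∈ closure U \ U) (hb' : b ∈ closure U \ U) (hR : Disjoint R U) :
    AmbientIsotopic (segment ℝ a m ∪ (segment ℝ m b ∪ R))
      (segment ℝ a c ∪ (segment ℝ c b ∪ R)) := by
  have himage : push U m c '' (segment ℝ a m ∪ (segment ℝ m b ∪ R)) =
      segment ℝ a c ∪ (segment ℝ c b ∪ R) := by
    rw [Set.image_union, Set.image_union, push_image_of_disjoint ho hc hm c hR,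
      segment_symm ℝ a m, segment_symm ℝ a c, push_image_segment ho hc hm c ha,
      push_image_segment ho hc hm c hb']
  rw [← himage]
  exact ambientIsotopic_image_of_bounded (F := pushHomeomorph ho hc hb hm hcU)
    (norm_push_sub_le m c) _

end Push

/-! ### Moves of lattice polygons -/

theorem segment_union_segment {E : Type*} [AddCommGroup E] [Module ℝ E] {a b c : E}
    (hc : c ∈ segment ℝ a b) : segment ℝ a c ∪ segment ℝ c b = segment ℝ a b := by
  apply Set.Subset.antisymm
  · exact Set.union_subset ((convex_segment a b).segment_subset (left_mem_segment ℝ a b) hc)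
      ((convex_segment a b).segment_subset hc (right_mem_segment ℝ a b))
  · have hline : c ∈ Set.range (AffineMap.lineMap a b : ℝ → E) := by
      rw [segment_eq_image_lineMap] at hc
      exact Set.image_subset_range _ _ hc
    rw [← insert_endpoints_openSegment, Set.insert_subset_iff, Set.insert_subset_iff]
    refine ⟨Or.inl (left_mem_segment ℝ a c), Or.inr (right_mem_segment ℝ c b),
      (openSegment_subset_union a b hline).trans (Set.insert_subset_iff.2
        ⟨Or.inl (right_mem_segment ℝ a c), Set.union_subset_union ?_ ?_⟩)⟩ <;>
    exact openSegment_subset_segment ℝ _ _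

/-- `P` can be carried to `Q` in the presence of any set that avoids `B`. -/
def IsotopicIn (B P Q : Set Space) : Prop :=
  ∀ R : Set Space, Disjoint R B → AmbientIsotopic (P ∪ R) (Q ∪ R)

theorem IsotopicIn.refl (B P : Set Space) : IsotopicIn B P P := fun _ _ => AmbientIsotopic.refl _

theorem IsotopicIn.trans {B P Q S : Set Space} (h : IsotopicIn B P Q) (h' : IsotopicIn B Q S) :
    IsotopicIn B P S := fun R hR => (h R hR).trans (h' R hR)

/-- A point of the lattice `(ℤ/4)³`, scaled by `4` so that its coordinates are integers. -/
abbrev LatticePoint : Type := ℤ × ℤ × ℤ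

/-- The point of space that a lattice point stands for. -/
noncomputable def LatticePoint.toSpace (p : LatticePoint) : Space :=
  ((p.1 : ℝ) / 4, (p.2.1 : ℝ) / 4, (p.2.2 : ℝ) / 4)

/-- The integral affine function `α x + β y + γ z + δ` of the scaled coordinates, encoded as
`(α, β, γ, δ)`. -/
abbrev AffineForm : Type := ℤ × ℤ × ℤ × ℤ

/-- The value of an affine form at a lattice point. -/
def AffineForm.eval (f : AffineForm) (p : LatticePoint) : ℤ :=
  f.1 * p.1 + f.2.1 * p.2.1 + f.2.2.1 * p.2.2 + f.2.2.2

/-- The value of an affine form at a point of space. -/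
def AffineForm.evalAt (f : AffineForm) (p : Space) : ℝ :=
  f.1 * (4 * p.1) + f.2.1 * (4 * p.2.1) + f.2.2.1 * (4 * p.2.2) + f.2.2.2

theorem AffineForm.evalAt_toSpace (f : AffineForm) (p : LatticePoint) :
    f.evalAt p.toSpace = f.eval p := by
  simp only [evalAt, eval, LatticePoint.toSpace]
  push_cast
  ring

theorem AffineForm.continuous_evalAt (f : AffineForm) : Continuous f.evalAt := by
  unfold AffineForm.evalAt
  fun_prop

theorem AffineForm.evalAt_combo (f : AffineForm) (p q : Space) {s t : ℝ} (h : s + t = 1) :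
    f.evalAt (s • p + t • q) = s • f.evalAt p + t • f.evalAt q := by
  simp only [evalAt, Prod.fst_add, Prod.snd_add, Prod.smul_fst, Prod.smul_snd, smul_eq_mul]
  linear_combination (-(f.2.2.2 : ℝ)) * h

/-- The open convex polyhedral cell in which all the forms of a list are positive. -/
def cell (fs : List AffineForm) : Set Space := {p | ∀ f ∈ fs, 0 < AffineForm.evalAt f p}

theorem isOpen_cell (fs : List AffineForm) : IsOpen (cell fs) := by
  have h : cell fs = ⋂ f ∈ {f | f ∈ fs}, {p | 0 < AffineForm.evalAt f p} := by
    ext p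
    simp [cell]
  rw [h]
  exact (List.finite_toSet fs).isOpen_biInter fun f _ =>
    isOpen_lt continuous_const f.continuous_evalAt

theorem convex_cell (fs : List AffineForm) : Convex ℝ (cell fs) := by
  intro p hp q hq s t hs ht hst f hf
  rw [f.evalAt_combo p q hst]
  exact convex_Ioi (0 : ℝ) (Set.mem_Ioi.2 (hp f hf)) (Set.mem_Ioi.2 (hq f hf)) hs ht hst

theorem toSpace_mem_cell_iff {fs : List AffineForm} {p : LatticePoint} :
    p.toSpace ∈ cell fs ↔ ∀ f ∈ fs, 0 < f.eval p := by
  simp only [cell, Set.mem_ofPred_eq, AffineForm.evalAt_toSpace, Int.cast_pos]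

theorem openSegment_subset_cell {fs : List AffineForm} {a m : LatticePoint}
    (ha : ∀ f ∈ fs, 0 ≤ f.eval a) (hm : ∀ f ∈ fs, 0 < f.eval m) :
    openSegment ℝ a.toSpace m.toSpace ⊆ cell fs := by
  rintro _ ⟨s, t, hs, ht, hst, rfl⟩ f hf
  have ha' : (0 : ℝ) ≤ f.eval a := Int.cast_nonneg (ha f hf)
  have hm' : (0 : ℝ) < f.eval m := Int.cast_pos.2 (hm f hf)
  rw [f.evalAt_combo _ _ hst, f.evalAt_toSpace, f.evalAt_toSpace, smul_eq_mul, smul_eq_mul]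
  positivity

theorem disjoint_segment_cell {fs : List AffineForm} {f : AffineForm} (hf : f ∈ fs)
    {p q : LatticePoint} (hp : f.eval p ≤ 0) (hq : f.eval q ≤ 0) :
    Disjoint (segment ℝ p.toSpace q.toSpace) (cell fs) := by
  refine Set.disjoint_left.2 ?_
  rintro _ ⟨s, t, hs, ht, hst, rfl⟩ h
  have hpos := h f hf
  rw [f.evalAt_combo _ _ hst, f.evalAt_toSpace, f.evalAt_toSpace] at hpos
  exact hpos.not_ge (Set.mem_Iic.1 (convex_Iic (0 : ℝ) (Set.mem_Iic.2 (Int.cast_nonpos.2 hp))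
    (Set.mem_Iic.2 (Int.cast_nonpos.2 hq)) hs ht hst))

/-- A polygonal set with vertices in the lattice, as the list of its edges. -/
abbrev EdgeList : Type := List (LatticePoint × LatticePoint)

/-- The union of the segments of a list. -/
def polygon (L : EdgeList) : Set Space :=
  {p | ∃ s ∈ L, p ∈ segment ℝ s.1.toSpace s.2.toSpace}

theorem polygon_nil : polygon [] = ∅ := by simp [polygon]

theorem polygon_cons (s : LatticePoint × LatticePoint) (L : EdgeList) :
    polygon (s :: L) = segment ℝ s.1.toSpace s.2.toSpace ∪ polygon L := by
  ext p
  simp [polygon]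

theorem polygon_mono {L L' : EdgeList} (h : L ⊆ L') :
    polygon L ⊆ polygon L' := fun _ ⟨s, hs, hp⟩ => ⟨s, h hs, hp⟩

theorem polygon_erase {s : LatticePoint × LatticePoint}
    {L : EdgeList} (h : s ∈ L) :
    polygon L = segment ℝ s.1.toSpace s.2.toSpace ∪ polygon (L.erase s) := by
  rw [← polygon_cons]
  have hperm := List.perm_cons_erase h
  exact (polygon_mono hperm.subset).antisymm (polygon_mono hperm.symm.subset)

/-- `c` divides the segment from `a` to `b` in the ratio `k' : k`. -/
abbrev Divides (a c b : LatticePoint) (k k' : ℕ) : Prop :=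
  0 < k ∧ 0 < k' ∧ k * (c.1 - a.1) = k' * (b.1 - c.1) ∧
    k * (c.2.1 - a.2.1) = k' * (b.2.1 - c.2.1) ∧ k * (c.2.2 - a.2.2) = k' * (b.2.2 - c.2.2)

theorem Divides.segment_eq {a c b : LatticePoint} {k k' : ℕ} (h : Divides a c b k k') :
    segment ℝ a.toSpace b.toSpace
      = segment ℝ a.toSpace c.toSpace ∪ segment ℝ c.toSpace b.toSpace := by
  obtain ⟨hk, hk', hx, hy, hz⟩ := h
  replace hk : (0 : ℝ) < k := Nat.cast_pos.2 hk
  replace hk' : (0 : ℝ) < k' := Nat.cast_pos.2 hk'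
  replace hx : (k : ℝ) * (c.1 - a.1) = k' * (b.1 - c.1) := by exact_mod_cast hx
  replace hy : (k : ℝ) * (c.2.1 - a.2.1) = k' * (b.2.1 - c.2.1) := by exact_mod_cast hy
  replace hz : (k : ℝ) * (c.2.2 - a.2.2) = k' * (b.2.2 - c.2.2) := by exact_mod_cast hz
  refine (segment_union_segment ⟨k / (k + k'), k' / (k + k'), by positivity, by positivity,
    by field_simp, ?_⟩).symm
  refine Prod.ext ?_ (Prod.ext ?_ ?_) <;>
  · simp only [LatticePoint.toSpace, Prod.fst_add, Prod.snd_add, Prod.smul_fst, Prod.smul_snd,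
      smul_eq_mul]
    field_simp
    linarith

/-- The vertex `m` between the edges `a m` and `m b` can be moved to `c` inside the cell of `fs`:
both lie in the cell, `a` and `b` lie on its frontier, and the rest of the polygon avoids it. -/
abbrev CanPush (fs : List AffineForm) (a m b c : LatticePoint)
    (rest : EdgeList) : Prop :=
  (∀ f ∈ fs, 0 ≤ f.eval a ∧ 0 ≤ f.eval b ∧ 0 < f.eval m ∧ 0 < f.eval c) ∧
    (∃ f ∈ fs, f.eval a = 0) ∧ (∃ f ∈ fs, f.eval b = 0) ∧
    ∀ s ∈ rest, ∃ f ∈ fs, f.eval s.1 ≤ 0 ∧ f.eval s.2 ≤ 0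

theorem mem_closure_diff_of_eval_eq_zero {fs : List AffineForm} {a m : LatticePoint} {ρ : ℝ}
    (ha : ∀ f ∈ fs, 0 ≤ f.eval a) (ha₀ : ∃ f ∈ fs, f.eval a = 0) (hm : ∀ f ∈ fs, 0 < f.eval m)
    (haρ : a.toSpace ∈ Metric.ball 0 ρ) (hmρ : m.toSpace ∈ Metric.ball 0 ρ) :
    a.toSpace ∈ closure (cell fs ∩ Metric.ball 0 ρ) \ (cell fs ∩ Metric.ball 0 ρ) := by
  have hsegment : openSegment ℝ a.toSpace m.toSpace ⊆ cell fs ∩ Metric.ball 0 ρ :=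
    Set.subset_inter (openSegment_subset_cell ha hm)
      ((convex_ball (0 : Space) ρ).openSegment_subset haρ hmρ)
  refine ⟨closure_mono hsegment ?_, fun h => ?_⟩
  · rw [closure_openSegment]
    exact left_mem_segment ℝ _ _
  · obtain ⟨f, hf, hfa⟩ := ha₀
    exact (toSpace_mem_cell_iff.1 h.1 f hf).ne' hfa

theorem CanPush.ambientIsotopic {fs : List AffineForm} {a m b c : LatticePoint}
    {rest : EdgeList} (h : CanPush fs a m b c rest) {R : Set Space}
    (hR : Disjoint R (cell fs)) :
    AmbientIsotopic (segment ℝ a.toSpace m.toSpace ∪ (segment ℝ m.toSpace b.toSpace ∪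
        (polygon rest ∪ R)))
      (segment ℝ a.toSpace c.toSpace ∪ (segment ℝ c.toSpace b.toSpace ∪ (polygon rest ∪ R))) := by
  obtain ⟨hsign, ha₀, hb₀, hrest⟩ := h
  -- The cell is made bounded by a ball containing the four points.
  obtain ⟨ρ, hρ⟩ : ∃ ρ, ({a.toSpace, m.toSpace, b.toSpace, c.toSpace} : Set Space) ⊆
      Metric.ball 0 ρ := (Set.toFinite _).isBounded.subset_ball 0
  simp only [Set.insert_subset_iff, Set.singleton_subset_iff] at hρ
  obtain ⟨haρ, hmρ, hbρ, hcρ⟩ := hρ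
  have hm : ∀ f ∈ fs, 0 < f.eval m := fun f hf => (hsign f hf).2.2.1
  have hrest' : Disjoint (polygon rest) (cell fs) := by
    refine Set.disjoint_left.2 fun p ⟨s, hs, hp⟩ => ?_
    obtain ⟨f, hf, hs₁, hs₂⟩ := hrest s hs
    exact Set.disjoint_left.1 (disjoint_segment_cell hf hs₁ hs₂) hp
  exact ambientIsotopic_push ((isOpen_cell fs).inter Metric.isOpen_ball)
    ((convex_cell fs).inter (convex_ball _ _)) (Metric.isBounded_ball.subset Set.inter_subset_right)
    ⟨toSpace_mem_cell_iff.2 hm, hmρ⟩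
    ⟨toSpace_mem_cell_iff.2 fun f hf => (hsign f hf).2.2.2, hcρ⟩
    (mem_closure_diff_of_eval_eq_zero (fun f hf => (hsign f hf).1) ha₀ hm haρ hmρ)
    (mem_closure_diff_of_eval_eq_zero (fun f hf => (hsign f hf).2.1) hb₀ hm hbρ hmρ)
    ((hrest'.union_left hR).mono_right Set.inter_subset_left)

/-- A move of a polygonal set: `vertex` carries two edges `a m`, `m b` to `a c`, `c b`, inside
the cell of the forms of a zone, given by its index, and of some further forms; `split` and `merge`
subdivide an edge and undo a subdivision. -/
inductive PolygonMove
  | vertex (a m b c : LatticePoint) (zone : ℕ) (forms : List AffineForm)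
  | split (a c b : LatticePoint) (k k' : ℕ)
  | merge (a c b : LatticePoint) (k k' : ℕ)

/-- The polygon after a move, if the move is admissible in the zones `Z`. -/
def PolygonMove.step (Z : List (List AffineForm)) :
    PolygonMove → EdgeList → Option EdgeList
  | .vertex a m b c i fs, L =>
    match Z[i]? with
    | none => none
    | some z =>
      if (a, m) ∈ L ∧ (m, b) ∈ L.erase (a, m) ∧
          CanPush (z ++ fs) a m b c ((L.erase (a, m)).erase (m, b)) then
        some ((a, c) :: (c, b) :: (L.erase (a, m)).erase (m, b))
      else none
  | .split a c b k k', L =>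
    if (a, b) ∈ L ∧ Divides a c b k k' then some ((a, c) :: (c, b) :: L.erase (a, b)) else none
  | .merge a c b k k', L =>
    if (a, c) ∈ L ∧ (c, b) ∈ L.erase (a, c) ∧ Divides a c b k k' then
      some ((a, b) :: (L.erase (a, c)).erase (c, b))
    else none

/-- Whether a sequence of admissible moves carries the polygon `L` to `L'`; this is evaluated by
the kernel on the explicit sequences below. -/
def carries (Z : List (List AffineForm)) :
    List PolygonMove → EdgeList → EdgeList → Bool
  | [], L, L' => decide (L ⊆ L' ∧ L' ⊆ L)
  | m :: ms, L, L' =>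
    match m.step Z L with
    | none => false
    | some L₁ => carries Z ms L₁ L'

/-- The union of the cells of the zones. -/
def region (Z : List (List AffineForm)) : Set Space := {p | ∃ z ∈ Z, p ∈ cell z}

theorem PolygonMove.isotopicIn {Z : List (List AffineForm)} (m : PolygonMove)
    {L L' : EdgeList} (h : m.step Z L = some L') :
    IsotopicIn (region Z) (polygon L) (polygon L') := by
  intro R hR
  cases m with
  | vertex a m b c i fs =>
    simp only [step] at h
    split at h
    · contradiction
    · next z hz =>
      split_ifs at h with hstep
      obtain ⟨ham, hmb, hpush⟩ := hstep
      obtain rfl := Option.some.inj h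
      have hcell : cell (z ++ fs) ⊆ region Z := fun p hp =>
        ⟨z, List.mem_of_getElem? hz, fun f hf => hp f (List.mem_append_left _ hf)⟩
      simp only [polygon_erase ham, polygon_erase hmb, polygon_cons, Set.union_assoc]
      exact hpush.ambientIsotopic (hR.mono_right hcell)
  | split a c b k k' =>
    simp only [step] at h
    split_ifs at h with hstep
    obtain ⟨hab, hdiv⟩ := hstep
    obtain rfl := Option.some.inj h
    rw [polygon_erase hab, polygon_cons, polygon_cons, ← Set.union_assoc (segment ℝ _ _),
      hdiv.segment_eq]
    exact AmbientIsotopic.refl _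
  | merge a c b k k' =>
    simp only [step] at h
    split_ifs at h with hstep
    obtain ⟨hac, hcb, hdiv⟩ := hstep
    obtain rfl := Option.some.inj h
    rw [polygon_erase hac, polygon_erase hcb, polygon_cons, ← Set.union_assoc (segment ℝ _ _),
      hdiv.segment_eq]
    exact AmbientIsotopic.refl _

theorem isotopicIn_of_carries {Z : List (List AffineForm)} {ms : List PolygonMove}
    {L L' : EdgeList} (h : carries Z ms L L') :
    IsotopicIn (region Z) (polygon L) (polygon L') := by
  induction ms generalizing L with
  | nil =>
    obtain ⟨h₁, h₂⟩ := of_decide_eq_true h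
    rw [(polygon_mono h₁).antisymm (polygon_mono h₂)]
    exact IsotopicIn.refl _ _
  | cons m ms ih =>
    simp only [carries] at h
    split at h
    · contradiction
    · next L₁ hL => exact (m.isotopicIn hL).trans (ih h)

/-! ### Closures of words -/

/-- Translation by `v`. -/
noncomputable def translation (v : Space) : Space ≃ₜ Space := Homeomorph.addLeft v

@[simp] theorem translation_apply (v p : Space) : translation v p = v + p := rfl

theorem ambientIsotopic_translation (v : Space) (K : Set Space) :
    AmbientIsotopic K (translation v '' K) :=
  ambientIsotopic_image_of_bounded (C := ‖v‖) (fun p => by simp) K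

theorem translation_image_segment (v a b : Space) :
    translation v '' segment ℝ a b = segment ℝ (v + a) (v + b) :=
  segment_translate_image ℝ v a b

theorem mem_segment_parallel {x x' : ℝ} (h : x ≤ x') (y : ℝ × ℝ) (p : Space) :
    p ∈ segment ℝ ((x, y) : Space) (x', y) ↔ x ≤ p.1 ∧ p.1 ≤ x' ∧ p.2 = y := by
  rw [← Prod.image_mk_segment_left, segment_eq_Icc h]
  constructor
  · rintro ⟨t, ht, rfl⟩
    exact ⟨ht.1, ht.2, rfl⟩
  · rintro ⟨h₁, h₂, rfl⟩
    exact ⟨p.1, ⟨h₁, h₂⟩, rfl⟩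

/-- A reparametrization of the line, applied to the first coordinate of space. -/
noncomputable def reparametrize (φ : ℝ ≃o ℝ) : Space ≃ₜ Space :=
  φ.toHomeomorph.prodCongr (Homeomorph.refl (ℝ × ℝ))

@[simp] theorem reparametrize_apply (φ : ℝ ≃o ℝ) (p : Space) :
    reparametrize φ p = (φ p.1, p.2) := rfl

theorem ambientIsotopic_reparametrize {φ : ℝ ≃o ℝ} {C : ℝ} (hφ : ∀ x, |φ x - x| ≤ C)
    (K : Set Space) : AmbientIsotopic K (reparametrize φ '' K) := by
  refine ambientIsotopic_image_of_bounded (C := C) (fun p => ?_) K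
  have h : reparametrize φ p - p = (φ p.1 - p.1, 0) := Prod.ext rfl (sub_self p.2)
  rw [h, Prod.norm_def, norm_zero, max_eq_left (norm_nonneg _), Real.norm_eq_abs]
  exact hφ p.1

theorem reparametrize_image_segment_parallel (φ : ℝ ≃o ℝ) {x x' : ℝ} (h : x ≤ x') (y : ℝ × ℝ) :
    reparametrize φ '' segment ℝ ((x, y) : Space) (x', y)
      = segment ℝ ((φ x, y) : Space) (φ x', y) := by
  rw [← Prod.image_mk_segment_left, ← Prod.image_mk_segment_left, segment_eq_Icc h,
    segment_eq_Icc (φ.monotone h), ← φ.image_Icc, Set.image_image, Set.image_image]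
  rfl

theorem reparametrize_image_eq_self {φ : ℝ ≃o ℝ} {S : Set Space} (hS : ∀ q ∈ S, φ q.1 = q.1) :
    reparametrize φ '' S = S :=
  Set.EqOn.image_eq_self fun q hq => Prod.ext (hS q hq) rfl

theorem reparametrize_image_eq_translation {φ : ℝ ≃o ℝ} {c : ℝ} {S : Set Space}
    (hS : ∀ q ∈ S, φ q.1 = q.1 + c) :
    reparametrize φ '' S = translation (c, 0, 0) '' S :=
  Set.image_congr fun q hq => Prod.ext ((hS q hq).trans (add_comm _ _)) (zero_add q.2).symm

/-- The function that is the identity up to `p`, stretches `[p, p + w]` linearly to `[p, p + w']`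
and is a translation from `p + w` on. -/
noncomputable def stretchFun (p w w' x : ℝ) : ℝ :=
  min x p + w' / w * max 0 (min (x - p) w) + max 0 (x - p - w)

section Stretch

variable {p w w' x : ℝ} (hw : 0 < w) (hw' : 0 < w')

include hw in
theorem stretchFun_of_le (hx : x ≤ p) : stretchFun p w w' x = x := by
  rw [stretchFun, min_eq_left hx, max_eq_left ((min_le_left _ _).trans (by linarith)),
    max_eq_left (by linarith)]
  ring

theorem stretchFun_of_mem (hx : x ∈ Set.Icc p (p + w)) :
    stretchFun p w w' x = p + w' / w * (x - p) := by
  rw [stretchFun, min_eq_right hx.1, min_eq_left (by linarith [hx.2]),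
    max_eq_right (by linarith [hx.1]), max_eq_left (by linarith [hx.2])]
  ring

include hw in
theorem stretchFun_of_ge (hx : p + w ≤ x) : stretchFun p w w' x = x + (w' - w) := by
  rw [stretchFun, min_eq_right (by linarith), min_eq_right (by linarith), max_eq_right hw.le,
    max_eq_right (by linarith)]
  field_simp
  ring

include hw hw'

theorem monotone_stretchFun : Monotone (stretchFun p w w') := fun x y h => by
  unfold stretchFun
  gcongr

theorem stretchFun_mem (hx : x ∈ Set.Icc p (p + w)) :
    stretchFun p w w' x ∈ Set.Icc p (p + w') := by
  refine ⟨(stretchFun_of_le hw le_rfl).symm.trans_le (monotone_stretchFun hw hw' hx.1),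
    (monotone_stretchFun hw hw' hx.2).trans_eq ?_⟩
  rw [stretchFun_of_ge hw le_rfl]
  ring

theorem stretchFun_stretchFun (x : ℝ) : stretchFun p w' w (stretchFun p w w' x) = x := by
  rcases le_total x p with h | h
  · rw [stretchFun_of_le hw h, stretchFun_of_le hw' h]
  rcases le_total x (p + w) with h' | h'
  · rw [stretchFun_of_mem (stretchFun_mem hw hw' ⟨h, h'⟩), stretchFun_of_mem ⟨h, h'⟩]
    field_simp
    ring
  · rw [stretchFun_of_ge hw h', stretchFun_of_ge hw' (by linarith)]
    ring

variable (p) in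
/-- `stretchFun` as an order automorphism of the line. -/
noncomputable def stretch : ℝ ≃o ℝ :=
  Equiv.toOrderIso ⟨stretchFun p w w', stretchFun p w' w, stretchFun_stretchFun hw hw',
    stretchFun_stretchFun hw' hw⟩ (monotone_stretchFun hw hw') (monotone_stretchFun hw' hw)

theorem stretch_of_le (hx : x ≤ p) : stretch p hw hw' x = x := stretchFun_of_le hw hx

theorem stretch_of_ge (hx : p + w ≤ x) : stretch p hw hw' x = x + (w' - w) :=
  stretchFun_of_ge hw hx

theorem stretch_of_mem (hx : x ∈ Set.Icc p (p + w)) :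
    stretch p hw hw' x = p + w' / w * (x - p) := stretchFun_of_mem hx

theorem abs_stretch_sub_le (x : ℝ) : |stretch p hw hw' x - x| ≤ w + w' := by
  rcases le_total x p with h | h
  · rw [stretch_of_le hw hw' h, sub_self, abs_zero]
    positivity
  rcases le_total x (p + w) with h' | h'
  · have hmem : stretch p hw hw' x ∈ Set.Icc p (p + w') := stretchFun_mem hw hw' ⟨h, h'⟩
    exact abs_sub_le_iff.2 ⟨by linarith [hmem.2], by linarith [hmem.1]⟩
  · rw [stretch_of_ge hw hw' h', add_sub_cancel_left]
    exact abs_sub_le_iff.2 ⟨by linarith, by linarith⟩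

theorem ambientIsotopic_stretch (K : Set Space) :
    AmbientIsotopic K (reparametrize (stretch p hw hw') '' K) :=
  ambientIsotopic_reparametrize (abs_stretch_sub_le hw hw') K

theorem stretch_image_of_ge {S : Set Space} (hS : ∀ q ∈ S, p + w ≤ q.1) :
    reparametrize (stretch p hw hw') '' S = translation (w' - w, 0, 0) '' S :=
  reparametrize_image_eq_translation fun q hq => stretch_of_ge hw hw' (hS q hq)

theorem stretch_image_segment_of_mem {u v : Space} (hu : u.1 ∈ Set.Icc p (p + w))
    (hv : v.1 ∈ Set.Icc p (p + w)) :
    reparametrize (stretch p hw hw') '' segment ℝ u v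
      = segment ℝ (p + w' / w * (u.1 - p), u.2) (p + w' / w * (v.1 - p), v.2) := by
  have hmap (q : Space) : (AffineMap.homothety p (w' / w)).prodMap (AffineMap.id ℝ (ℝ × ℝ)) q
      = (p + w' / w * (q.1 - p), q.2) := by
    simp [AffineMap.homothety_apply, add_comm p]
  have hsegment : segment ℝ u v ⊆ Prod.fst ⁻¹' Set.Icc p (p + w) :=
    ((convex_Icc p (p + w)).linear_preimage (LinearMap.fst ℝ ℝ (ℝ × ℝ))).segment_subset hu hv
  rw [← hmap, ← hmap, ← image_segment]
  refine Set.image_congr fun q hq => ?_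
  rw [hmap, reparametrize_apply, stretch_of_mem hw hw' (hsegment hq)]

end Stretch

/-- The straight strands over `[x, x']` at the positions in `J`. -/
def strandsOn (J : Set ℕ) (x x' : ℝ) : Set Space :=
  ⋃ j ∈ J, segment ℝ ((x, (j : ℝ), 0) : Space) (x', (j : ℝ), 0)

/-- The closing arcs between `x = b` and `x = a` at the positions in `J`. -/
def arcsOn (J : Set ℕ) (a b : ℝ) : Set Space :=
  ⋃ j ∈ J, (segment ℝ ((b, (j : ℝ), 0) : Space) (b, (j : ℝ), -2) ∪
    segment ℝ ((b, (j : ℝ), -2) : Space) (a, (j : ℝ), -2) ∪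
    segment ℝ ((a, (j : ℝ), -2) : Space) (a, (j : ℝ), 0))

/-- The positions of `n` strands that a crossing between `i` and `i + 1` leaves alone. -/
def others (n i : ℕ) : Set ℕ := {j | j < n ∧ j ≠ i ∧ j ≠ i + 1}

/-- A braid word whose letters carry natural number indices, so that the number of strands may
vary while the word stays the same. -/
abbrev Word : Type := List (ℕ × Bool)

/-- All letters of `w` are Artin generators on `n` strands or their inverses. -/
def Valid (n : ℕ) (w : Word) : Prop := ∀ g ∈ w, g.1 + 1 < n

/-- A letter, drawn over `[x, x + 1]` on `n` strands. -/
def drawLetter (n : ℕ) (x : ℝ) (g : ℕ × Bool) : Set Space :=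
  crossing x g.1 g.2 ∪ strandsOn (others n g.1) x (x + 1)

/-- A word, drawn from `x` on. -/
def draw (n : ℕ) : ℝ → Word → Set Space
  | _, [] => ∅
  | x, g :: w => drawLetter n x g ∪ draw n (x + 1) w

/-- The closure of a word drawn from `x` on, with closing arcs between `a` and `b`. -/
def braidClosure (n : ℕ) (a x : ℝ) (w : Word) (b : ℝ) : Set Space :=
  strandsOn (Set.Iio n) a x ∪ draw n x w ∪ strandsOn (Set.Iio n) (x + w.length) b ∪
    arcsOn (Set.Iio n) a b

theorem valid_nil (n : ℕ) : Valid n [] := List.forall_mem_nil _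

theorem valid_cons {n : ℕ} {g : ℕ × Bool} {w : Word} :
    Valid n (g :: w) ↔ g.1 + 1 < n ∧ Valid n w := List.forall_mem_cons

theorem valid_append {n : ℕ} {u v : Word} : Valid n (u ++ v) ↔ Valid n u ∧ Valid n v :=
  List.forall_mem_append

theorem valid_singleton {n : ℕ} {g : ℕ × Bool} : Valid n [g] ↔ g.1 + 1 < n :=
  List.forall_mem_singleton

theorem mem_strandsOn {J : Set ℕ} {x x' : ℝ} (h : x ≤ x') {p : Space} :
    p ∈ strandsOn J x x' ↔ ∃ j ∈ J, x ≤ p.1 ∧ p.1 ≤ x' ∧ p.2 = ((j : ℝ), 0) := by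
  simp only [strandsOn, Set.mem_iUnion₂, mem_segment_parallel h, exists_prop]

theorem strandsOn_trans (J : Set ℕ) {x x' x'' : ℝ} (h : x ≤ x') (h' : x' ≤ x'') :
    strandsOn J x x' ∪ strandsOn J x' x'' = strandsOn J x x'' := by
  simp only [strandsOn, ← Set.iUnion_union_distrib]
  exact Set.iUnion₂_congr fun j _ => segment_union_segment
    ((mem_segment_parallel (h.trans h') _ _).2 ⟨h, h', rfl⟩)

theorem strandsOn_union (J J' : Set ℕ) (x x' : ℝ) :
    strandsOn (J ∪ J') x x' = strandsOn J x x' ∪ strandsOn J' x x' := Set.biUnion_union J J' _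

theorem arcsOn_union (J J' : Set ℕ) (a b : ℝ) :
    arcsOn (J ∪ J') a b = arcsOn J a b ∪ arcsOn J' a b := Set.biUnion_union J J' _

theorem strandsOn_self_subset (J : Set ℕ) (a b : ℝ) : strandsOn J a a ⊆ arcsOn J a b := by
  refine Set.iUnion₂_mono fun j _ => ?_
  rw [segment_same]
  exact Set.singleton_subset_iff.2 (Or.inr (right_mem_segment ℝ _ _))

theorem Iio_eq_others_union {n i : ℕ} (h : i + 1 < n) : Set.Iio n = others n i ∪ {i, i + 1} := by
  ext j
  simp only [others, Set.mem_Iio, Set.mem_union, Set.mem_ofPred_eq, Set.mem_insert_iff,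
    Set.mem_singleton_iff]
  omega

theorem draw_append (n : ℕ) (x : ℝ) (u v : Word) :
    draw n x (u ++ v) = draw n x u ∪ draw n (x + u.length) v := by
  induction u generalizing x with
  | nil => simp [draw]
  | cons g u ih =>
    simp only [List.cons_append, draw, ih, Set.union_assoc, List.length_cons]
    push_cast
    rw [add_assoc, add_comm (1 : ℝ)]

theorem crossing_subset (x : ℝ) (i : ℕ) (e : Bool) : crossing x i e ⊆
    Set.Icc x (x + 1) ×ˢ (Set.Icc (i : ℝ) (i + 1) ×ˢ Set.Icc (-1 : ℝ) 1) := by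
  have hconvex : Convex ℝ
      (Set.Icc x (x + 1) ×ˢ (Set.Icc (i : ℝ) (i + 1) ×ˢ Set.Icc (-1 : ℝ) 1)) :=
    (convex_Icc _ _).prod ((convex_Icc _ _).prod (convex_Icc _ _))
  refine Set.union_subset (Set.union_subset ?_ ?_) ?_ <;> refine hconvex.segment_subset ?_ ?_ <;>
    cases e <;> norm_num [Set.mem_prod]

theorem drawLetter_subset {n : ℕ} {g : ℕ × Bool} (hg : g.1 + 1 < n) (x : ℝ) :
    drawLetter n x g ⊆ Set.Icc x (x + 1) ×ˢ (Set.Iic (n - 1 : ℝ) ×ˢ Set.Icc (-1 : ℝ) 1) := by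
  refine Set.union_subset ((crossing_subset x g.1 g.2).trans
    (Set.prod_mono_right (Set.prod_mono_left fun y hy => ?_))) fun p hp => ?_
  · have hcast : (g.1 : ℝ) + 1 + 1 ≤ n := by exact_mod_cast hg
    exact hy.2.trans (by linarith)
  · obtain ⟨j, hj, h₁, h₂, h₃⟩ := (mem_strandsOn (by linarith)).1 hp
    have hcast : (j : ℝ) + 1 ≤ n := by exact_mod_cast hj.1
    refine ⟨⟨h₁, h₂⟩, ?_⟩
    rw [h₃]
    exact ⟨by simp only [Set.mem_Iic]; linarith, by norm_num⟩

theorem draw_subset {n : ℕ} {w : Word} (hw : Valid n w) (x : ℝ) :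
    draw n x w ⊆
      Set.Icc x (x + w.length) ×ˢ (Set.Iic (n - 1 : ℝ) ×ˢ Set.Icc (-1 : ℝ) 1) := by
  induction w generalizing x with
  | nil => exact Set.empty_subset _
  | cons g w ih =>
    obtain ⟨hg, hw⟩ := valid_cons.1 hw
    have : (0 : ℝ) ≤ w.length := Nat.cast_nonneg _
    have hlength : ((g :: w).length : ℝ) = w.length + 1 := by simp
    rw [hlength]
    refine Set.union_subset ((drawLetter_subset hg x).trans ?_) ((ih hw (x + 1)).trans ?_) <;>
    exact Set.prod_mono_left (Set.Icc_subset_Icc (by linarith) (by linarith))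

theorem arcsOn_subset (J : Set ℕ) (a b : ℝ) :
    arcsOn J a b ⊆ {p | (p.1 = a ∨ p.1 = b ∨ p.2.2 = -2) ∧ ∃ j ∈ J, p.2.1 = j} := by
  intro p hp
  obtain ⟨j, hj, hp⟩ := Set.mem_iUnion₂.1 hp
  have hcombo {s t : ℝ} (c : ℝ) (hst : s + t = 1) : s * c + t * c = c := by
    rw [← add_mul, hst, one_mul]
  rcases hp with (⟨s, t, -, -, hst, rfl⟩ | ⟨s, t, -, -, hst, rfl⟩) | ⟨s, t, -, -, hst, rfl⟩
  · exact ⟨Or.inr (Or.inl (hcombo b hst)), j, hj, hcombo _ hst⟩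
  · exact ⟨Or.inr (Or.inr (hcombo (-2) hst)), j, hj, hcombo _ hst⟩
  · exact ⟨Or.inl (hcombo a hst), j, hj, hcombo _ hst⟩

theorem translation_strandsOn (d : ℝ) (J : Set ℕ) (x x' : ℝ) :
    translation (d, 0, 0) '' strandsOn J x x' = strandsOn J (x + d) (x' + d) := by
  simp only [strandsOn, Set.image_iUnion, translation_image_segment, Prod.mk_add_mk, zero_add,
    add_comm d]

theorem translation_arcsOn (d : ℝ) (J : Set ℕ) (a b : ℝ) :
    translation (d, 0, 0) '' arcsOn J a b = arcsOn J (a + d) (b + d) := by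
  simp only [arcsOn, Set.image_iUnion, Set.image_union, translation_image_segment, Prod.mk_add_mk,
    zero_add, add_comm d]

theorem translation_drawLetter (d : ℝ) (n : ℕ) (x : ℝ) (g : ℕ × Bool) :
    translation (d, 0, 0) '' drawLetter n x g = drawLetter n (x + d) g := by
  simp only [drawLetter, crossing, Set.image_union, translation_strandsOn,
    translation_image_segment, Prod.mk_add_mk, zero_add, add_comm d, add_right_comm x _ d]

theorem translation_draw (d : ℝ) (n : ℕ) (x : ℝ) (w : Word) :
    translation (d, 0, 0) '' draw n x w = draw n (x + d) w := by
  induction w generalizing x with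
  | nil => exact Set.image_empty _
  | cons g w ih => simp only [draw, Set.image_union, translation_drawLetter, ih, add_right_comm x]

theorem translation_braidClosure (d : ℝ) (n : ℕ) (a x : ℝ) (w : Word) (b : ℝ) :
    translation (d, 0, 0) '' braidClosure n a x w b
      = braidClosure n (a + d) (x + d) w (b + d) := by
  simp only [braidClosure, Set.image_union, translation_draw, translation_strandsOn,
    translation_arcsOn, add_right_comm x _ d]

theorem ambientIsotopic_braidClosure_add (d : ℝ) (n : ℕ) (a x : ℝ) (w : Word) (b : ℝ) :
    AmbientIsotopic (braidClosure n a x w b) (braidClosure n (a + d) (x + d) w (b + d)) := by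
  rw [← translation_braidClosure]
  exact ambientIsotopic_translation _ _

theorem reparametrize_strandsOn (φ : ℝ ≃o ℝ) (J : Set ℕ) {x x' : ℝ} (h : x ≤ x') :
    reparametrize φ '' strandsOn J x x' = strandsOn J (φ x) (φ x') := by
  simp only [strandsOn, Set.image_iUnion, reparametrize_image_segment_parallel φ h]

theorem reparametrize_image_segment_vertical (φ : ℝ ≃o ℝ) (x : ℝ) (y y' : ℝ × ℝ) :
    reparametrize φ '' segment ℝ ((x, y) : Space) (x, y')
      = segment ℝ ((φ x, y) : Space) (φ x, y') := by
  rw [← Prod.image_mk_segment_right, ← Prod.image_mk_segment_right, Set.image_image]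
  rfl

theorem reparametrize_arcsOn (φ : ℝ ≃o ℝ) (J : Set ℕ) {a b : ℝ} (h : a ≤ b) :
    reparametrize φ '' arcsOn J a b = arcsOn J (φ a) (φ b) := by
  simp only [arcsOn, Set.image_iUnion, Set.image_union, reparametrize_image_segment_vertical,
    segment_symm ℝ ((b, _, -2) : Space) (a, _, -2), reparametrize_image_segment_parallel φ h,
    segment_symm ℝ ((φ b, _, -2) : Space) (φ a, _, -2)]

theorem reparametrize_braidClosure {n : ℕ} {φ : ℝ ≃o ℝ} {a x b c : ℝ} {w : Word} (hw : Valid n w)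
    (ha : a ≤ x) (hb : x + w.length ≤ b)
    (hφ : ∀ y ∈ Set.Icc x (x + w.length), φ y = y + c) :
    reparametrize φ '' braidClosure n a x w b = braidClosure n (φ a) (x + c) w (φ b) := by
  have hx : x ≤ x + w.length := le_add_of_nonneg_right (Nat.cast_nonneg _)
  simp only [braidClosure, Set.image_union]
  rw [reparametrize_strandsOn φ _ ha, reparametrize_strandsOn φ _ hb,
    reparametrize_arcsOn φ _ (ha.trans (hx.trans hb)),
    reparametrize_image_eq_translation fun q hq => hφ q.1 (draw_subset hw x hq).1,
    translation_draw, hφ x (Set.left_mem_Icc.2 hx), hφ _ (Set.right_mem_Icc.2 hx),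
    add_right_comm x]

theorem ambientIsotopic_braidClosure_right {n : ℕ} {a x b b' : ℝ} {w : Word} (hw : Valid n w)
    (ha : a ≤ x) (hb : x + w.length < b) (hb' : x + w.length < b') :
    AmbientIsotopic (braidClosure n a x w b) (braidClosure n a x w b') := by
  have hx : x ≤ x + w.length := le_add_of_nonneg_right (Nat.cast_nonneg _)
  have h := ambientIsotopic_stretch (p := x + w.length) (sub_pos.2 hb) (sub_pos.2 hb')
    (braidClosure n a x w b)
  rwa [reparametrize_braidClosure (c := 0) hw ha hb.le
    fun y hy => by rw [stretch_of_le _ _ hy.2, add_zero],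
    stretch_of_le _ _ (ha.trans hx), stretch_of_ge _ _ (by linarith), add_zero,
    sub_sub_sub_cancel_right, add_sub_cancel] at h

theorem ambientIsotopic_braidClosure_left {n : ℕ} {a a' x b : ℝ} {w : Word} (hw : Valid n w)
    (ha : a < x) (ha' : a' < x) (hb : x + w.length ≤ b) :
    AmbientIsotopic (braidClosure n a x w b) (braidClosure n a' x w b) := by
  have : x ≤ x + w.length := le_add_of_nonneg_right (Nat.cast_nonneg _)
  have h := ambientIsotopic_stretch (p := a) (sub_pos.2 ha) (sub_pos.2 ha')
    (braidClosure n a x w b)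
  rw [reparametrize_braidClosure (c := a - a') hw ha.le hb
    fun y hy => by rw [stretch_of_ge _ _ (by linarith [hy.1]), sub_sub_sub_cancel_left],
    stretch_of_le _ _ le_rfl, stretch_of_ge _ _ (by linarith)] at h
  convert h.trans (ambientIsotopic_braidClosure_add (a' - a) n _ _ _ _) using 2 <;> ring

theorem braidClosure_nil (n : ℕ) {a x b : ℝ} (h : a ≤ x) (h' : x ≤ b) :
    braidClosure n a x [] b = braidClosure n a a [] b := by
  simp only [braidClosure, draw, List.length_nil, Nat.cast_zero, add_zero, Set.union_empty]
  rw [strandsOn_trans _ h h', strandsOn_trans _ le_rfl (h.trans h')]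

theorem braidClosure_cons (n : ℕ) (a x : ℝ) (g : ℕ × Bool) (w : Word) (b : ℝ) :
    braidClosure n a x (g :: w) b = strandsOn (Set.Iio n) a x ∪ drawLetter n x g ∪
      (draw n (x + 1) w ∪ strandsOn (Set.Iio n) (x + 1 + w.length) b ∪
        arcsOn (Set.Iio n) a b) := by
  simp only [braidClosure, draw, List.length_cons]
  push_cast
  rw [add_assoc x 1, add_comm 1 (w.length : ℝ)]
  ac_rfl

theorem braidClosure_self (n : ℕ) (x : ℝ) (w : Word) (b : ℝ) :
    braidClosure n x x w b =
      draw n x w ∪ strandsOn (Set.Iio n) (x + w.length) b ∪ arcsOn (Set.Iio n) x b := by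
  rw [braidClosure, Set.union_assoc, Set.union_assoc, Set.union_assoc, Set.union_eq_right]
  exact (strandsOn_self_subset _ _ _).trans (Set.subset_union_right.trans Set.subset_union_right)

/-- The letter of a braid word, with a natural number index. -/
def natLetter {n : ℕ} (g : Fin (n - 1) × Bool) : ℕ × Bool := ((g.1 : ℕ), g.2)

theorem valid_map_natLetter {n : ℕ} (w : BraidWord n) : Valid n (w.map natLetter) := by
  intro g hg
  obtain ⟨h, -, rfl⟩ := List.mem_map.1 hg
  have := h.1.2
  simp only [natLetter]
  omega

theorem elementaryBraid_eq {n : ℕ} (x : ℝ) (g : Fin (n - 1) × Bool) :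
    elementaryBraid n x g = drawLetter n x (natLetter g) := by
  have h : strandsOn (others n g.1) x (x + 1) =
      ⋃ j : {j : Fin n // (j : ℕ) ≠ (g.1 : ℕ) ∧ (j : ℕ) ≠ (g.1 : ℕ) + 1},
        segment ℝ ((x, ((j : Fin n) : ℝ), 0) : Space) (x + 1, ((j : Fin n) : ℝ), 0) := by
    ext p
    simp only [strandsOn, others, Set.mem_iUnion, Set.mem_ofPred_eq, exists_prop]
    exact ⟨fun ⟨j, ⟨hj, hji⟩, hp⟩ => ⟨⟨⟨j, hj⟩, hji⟩, hp⟩,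
      fun ⟨j, hp⟩ => ⟨j, ⟨j.1.2, j.2⟩, hp⟩⟩
  rw [elementaryBraid, drawLetter, natLetter, h]

theorem iUnion_elementaryBraid {n : ℕ} (x : ℝ) (w : BraidWord n) :
    ⋃ k : Fin w.length, elementaryBraid n (x + (k : ℕ)) (w.get k) = draw n x (w.map natLetter) := by
  induction w generalizing x with
  | nil => simp [draw]
  | cons g w ih =>
    rw [List.map_cons, draw, ← ih, ← elementaryBraid_eq]
    ext p
    simp only [Set.mem_iUnion, Set.mem_union, List.length_cons, Fin.exists_fin_succ,
      List.get_cons_zero, List.get_cons_succ', Fin.val_zero, Fin.val_succ, Nat.cast_zero,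
      Nat.cast_add, Nat.cast_one, add_zero, add_assoc, add_comm (1 : ℝ)]

/-- The closure of a word drawn over `[0, l]`. -/
@[irreducible] def closureSet (n : ℕ) (w : Word) : Set Space := braidClosure n 0 0 w (w.length + 1)

theorem iUnion_closingArc (n l : ℕ) : ⋃ j : Fin n, closingArc l j =
    strandsOn (Set.Iio n) l (l + 1) ∪ arcsOn (Set.Iio n) 0 (l + 1) := by
  ext p
  simp only [strandsOn, arcsOn, closingArc, Set.mem_union, Set.mem_iUnion, Set.mem_Iio,
    exists_prop, Fin.exists_iff, ← exists_or, ← and_or_left, or_assoc]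

theorem closedBraid_eq_closureSet {n : ℕ} (w : BraidWord n) :
    closedBraid w = closureSet n (w.map natLetter) := by
  have h := iUnion_elementaryBraid 0 w
  simp only [zero_add] at h
  rw [closedBraid, h, iUnion_closingArc, closureSet, braidClosure_self,
    List.length_map, zero_add, Set.union_assoc]

/-- A lattice polygon translated by `(x, i, 0)`. -/
def placed (x : ℝ) (i : ℕ) (L : EdgeList) : Set Space := translation (x, (i : ℝ), 0) '' polygon L

/-- The sign of a crossing. -/
def crossingSign (e : Bool) : ℤ := if e then 1 else -1

/-- The edges of a crossing over `[k, k + 1]` between the positions `j` and `j + 1`. -/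
def crossingEdges (k : ℤ) (j : ℕ) (e : Bool) : EdgeList :=
  [((4 * k, 4 * j, 0), (4 * k + 2, 4 * j + 2, 4 * crossingSign e)),
    ((4 * k + 2, 4 * j + 2, 4 * crossingSign e), (4 * k + 4, 4 * j + 4, 0)),
    ((4 * k, 4 * j + 4, 0), (4 * k + 4, 4 * j, 0))]

/-- The edges of the straight strands over `[k, l]` at the positions in `J`. -/
def strandEdges (J : List ℕ) (k l : ℤ) : EdgeList :=
  J.map fun j : ℕ => ((4 * k, 4 * j, 0), (4 * l, 4 * j, 0))

/-- The edges of the closing arcs between `x = l` and `x = k` at the positions in `J`. -/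
def arcEdges (J : List ℕ) (k l : ℤ) : EdgeList :=
  J.flatMap fun j : ℕ => [((4 * l, 4 * j, 0), (4 * l, 4 * j, -8)),
    ((4 * l, 4 * j, -8), (4 * k, 4 * j, -8)), ((4 * k, 4 * j, -8), (4 * k, 4 * j, 0))]

theorem placed_nil (x : ℝ) (i : ℕ) : placed x i [] = ∅ := by
  rw [placed, polygon_nil, Set.image_empty]

theorem placed_cons (x : ℝ) (i : ℕ) (a b c a' b' c' : ℤ) (L : EdgeList) :
    placed x i (((a, b, c), (a', b', c')) :: L) =
      segment ℝ ((x + a / 4, i + b / 4, c / 4) : Space) (x + a' / 4, i + b' / 4, c' / 4) ∪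
        placed x i L := by
  simp only [placed, polygon_cons, Set.image_union, translation_image_segment,
    LatticePoint.toSpace, Prod.mk_add_mk, zero_add]

theorem placed_append (x : ℝ) (i : ℕ) (L L' : EdgeList) :
    placed x i (L ++ L') = placed x i L ∪ placed x i L' := by
  induction L with
  | nil => rw [List.nil_append, placed_nil, Set.empty_union]
  | cons s L ih => rw [List.cons_append, placed_cons, placed_cons, ih, Set.union_assoc]

theorem placed_crossingEdges (x : ℝ) (i : ℕ) (k : ℤ) (j : ℕ) (e : Bool) :
    placed x i (crossingEdges k j e) = crossing (x + k) (i + j) e := by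
  simp only [crossingEdges, placed_cons, placed_nil, Set.union_empty, crossing, Set.union_assoc]
  push_cast
  cases e <;> norm_num [crossingSign, add_div, mul_div_cancel_left₀, add_assoc]

/-- The positions in `J`, counted from `i`. -/
def shift (i : ℕ) (J : List ℕ) : Set ℕ := {j | j ∈ J.map (i + ·)}

theorem shift_nil (i : ℕ) : shift i [] = ∅ := by simp [shift]

theorem shift_cons (i j : ℕ) (J : List ℕ) : shift i (j :: J) = insert (i + j) (shift i J) := by
  ext
  simp [shift]

theorem strandsOn_insert (i : ℕ) (J : Set ℕ) (x x' : ℝ) : strandsOn (insert i J) x x' =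
    segment ℝ ((x, (i : ℝ), 0) : Space) (x', (i : ℝ), 0) ∪ strandsOn J x x' :=
  Set.biUnion_insert _ _ _

theorem placed_strandEdges (x : ℝ) (i : ℕ) (J : List ℕ) (k l : ℤ) :
    placed x i (strandEdges J k l) = strandsOn (shift i J) (x + k) (x + l) := by
  induction J with
  | nil => simp [strandEdges, placed_nil, strandsOn, shift_nil]
  | cons j J ih =>
    rw [strandEdges] at ih
    rw [strandEdges, List.map_cons, placed_cons, shift_cons, strandsOn_insert, ih]
    norm_num [mul_div_cancel_left₀]

theorem placed_arcEdges (x : ℝ) (i : ℕ) (J : List ℕ) (k l : ℤ) :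
    placed x i (arcEdges J k l) = arcsOn (shift i J) (x + k) (x + l) := by
  induction J with
  | nil => simp [arcEdges, placed_nil, arcsOn, shift_nil]
  | cons j J ih =>
    rw [arcEdges] at ih
    rw [arcEdges, List.flatMap_cons, placed_append, ih,
      shift_cons, arcsOn, arcsOn, Set.biUnion_insert]
    simp only [placed_cons, placed_nil, Set.union_empty, Set.union_assoc]
    norm_num [mul_div_cancel_left₀]

theorem IsotopicIn.union_left {B B' P Q S : Set Space} (h : IsotopicIn B P Q) (hS : Disjoint S B)
    (hB : B ⊆ B') : IsotopicIn B' (S ∪ P) (S ∪ Q) := by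
  intro R hR
  rw [Set.union_right_comm, Set.union_comm, Set.union_right_comm, Set.union_comm (S ∪ R)]
  exact h _ (hS.union_left (hR.mono_right hB))

theorem isotopicIn_placed_of_carries {Z : List (List AffineForm)} {ms : List PolygonMove}
    {L L' : EdgeList} (h : carries Z ms L L') (x : ℝ) (i : ℕ) :
    IsotopicIn (translation (x, (i : ℝ), 0) '' region Z) (placed x i L) (placed x i L') := by
  intro R hR
  set F := translation (x, (i : ℝ), 0)
  have hF : F '' (F.symm '' R) = R := F.toEquiv.image_symm_image R
  have hR' : Disjoint (F.symm '' R) (region Z) := by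
    rwa [← Set.disjoint_image_iff F.injective, hF]
  have hmove := (isotopicIn_of_carries h _ hR').image F
  rwa [Set.image_union, Set.image_union, hF] at hmove

/-- The points in `(x, x') × (y, y') × (-2, ∞)`. -/
def box (x x' y y' : ℝ) : Set Space :=
  {p | x < p.1 ∧ p.1 < x' ∧ y < p.2.1 ∧ p.2.1 < y' ∧ -2 < p.2.2}

/-- The points over `(x, x')` that lie above the closing arcs. -/
def slab (x x' : ℝ) : Set Space := {p | x < p.1 ∧ p.1 < x' ∧ -2 < p.2.2}

/-- The forms that cut out a box with integral sides. -/
def boxZone (x x' y y' : ℤ) : List AffineForm :=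
  [(1, 0, 0, -4 * x), (-1, 0, 0, 4 * x'), (0, 1, 0, -4 * y), (0, -1, 0, 4 * y'), (0, 0, 1, 8)]

theorem region_boxZone (a b c d : ℤ) : region [boxZone a b c d] = box a b c d := by
  ext p
  simp only [region, boxZone, cell, AffineForm.evalAt, box, Set.mem_ofPred_eq, List.mem_cons,
    List.not_mem_nil, or_false, exists_eq_left, forall_eq_or_imp, forall_eq]
  push_cast
  constructor <;> rintro ⟨h₁, h₂, h₃, h₄, h₅⟩ <;>
  exact ⟨by linarith, by linarith, by linarith, by linarith, by linarith⟩

theorem translation_box (x y a b c d : ℝ) :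
    translation (x, y, 0) '' box a b c d = box (x + a) (x + b) (y + c) (y + d) := by
  ext p
  simp [translation, box, lt_neg_add_iff_add_lt, neg_add_lt_iff_lt_add]

theorem isotopicIn_box {a b c d : ℤ} {ms : List PolygonMove} {L L' : EdgeList}
    (h : carries [boxZone a b c d] ms L L') (x : ℝ) (i : ℕ) :
    IsotopicIn (box (x + a) (x + b) (i + c) (i + d)) (placed x i L) (placed x i L') := by
  rw [← translation_box, ← region_boxZone]
  exact isotopicIn_placed_of_carries h x i

theorem disjoint_strandsOn_box {J : Set ℕ} {y y' : ℝ} (hJ : ∀ j ∈ J, (j : ℝ) ≤ y ∨ y' ≤ j)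
    {a b : ℝ} (hab : a ≤ b) (x x' : ℝ) : Disjoint (strandsOn J a b) (box x x' y y') := by
  refine Set.disjoint_left.2 fun p hp ⟨_, _, hy, hy', _⟩ => ?_
  obtain ⟨j, hj, -, -, hpj⟩ := (mem_strandsOn hab).1 hp
  rw [hpj] at hy hy'
  exact (hJ j hj).elim hy.not_ge hy'.not_ge

theorem disjoint_strandsOn_slab (J : Set ℕ) {a b x x' : ℝ} (hab : a ≤ b) (h : b ≤ x ∨ x' ≤ a) :
    Disjoint (strandsOn J a b) (slab x x') := by
  refine Set.disjoint_left.2 fun p hp ⟨hx, hx', _⟩ => ?_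
  obtain ⟨j, -, ha, hb, -⟩ := (mem_strandsOn hab).1 hp
  rcases h with h | h <;> linarith

theorem disjoint_draw_slab {n : ℕ} {w : Word} (hw : Valid n w) {y x x' : ℝ}
    (h : y + w.length ≤ x ∨ x' ≤ y) : Disjoint (draw n y w) (slab x x') := by
  refine Set.disjoint_left.2 fun p hp ⟨hx, hx', _⟩ => ?_
  obtain ⟨ha, hb⟩ := (draw_subset hw y hp).1
  rcases h with h | h <;> linarith

theorem disjoint_arcsOn_slab (J : Set ℕ) {a b x x' : ℝ} (ha : a ≤ x) (hb : x' ≤ b) :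
    Disjoint (arcsOn J a b) (slab x x') := by
  refine Set.disjoint_left.2 fun p hp ⟨hx, hx', hz⟩ => ?_
  rcases (arcsOn_subset J a b hp).1 with h | h | h <;> linarith

theorem box_subset_slab (x x' y y' : ℝ) : box x x' y y' ⊆ slab x x' :=
  fun _ ⟨hx, hx', _, _, hz⟩ => ⟨hx, hx', hz⟩

theorem isotopicIn_slab {a b c d : ℤ} {ms : List PolygonMove} {L L' : EdgeList}
    (h : carries [boxZone a b c d] ms L L') (hab : a ≤ b) {J : Set ℕ} {i : ℕ}
    (hJ : ∀ j ∈ J, (j : ℤ) ≤ i + c ∨ i + d ≤ (j : ℤ)) (x : ℝ) :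
    IsotopicIn (slab (x + a) (x + b)) (strandsOn J (x + a) (x + b) ∪ placed x i L)
      (strandsOn J (x + a) (x + b) ∪ placed x i L') := by
  have hab' : x + a ≤ x + b := add_le_add_right (Int.cast_le.2 hab) x
  have hJ' : ∀ j ∈ J, (j : ℝ) ≤ i + c ∨ i + d ≤ (j : ℝ) := fun j hj => by exact_mod_cast hJ j hj
  exact (isotopicIn_box h x i).union_left (disjoint_strandsOn_box hJ' hab' _ _)
    (box_subset_slab _ _ _ _)

/-- A crossing drawn over `[-1, 1]`, with its top over `0`. -/
def wideCrossingEdges (e : Bool) : EdgeList :=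
  [((-4, 0, 0), (0, 2, 4 * crossingSign e)), ((0, 2, 4 * crossingSign e), (4, 4, 0)),
    ((-4, 4, 0), (4, 0, 0))]

theorem carries_widen (e : Bool) : carries [boxZone (-1) 1 (-1) 2]
    (let s := crossingSign e
    [.vertex (-4, 0, 0) (0, 0, 0) (2, 2, 4 * s) (-1, 1, 2 * s) 0 [(-1, -2, s, 2)],
      .merge (-4, 0, 0) (-1, 1, 2 * s) (2, 2, 4 * s) 1 1,
      .vertex (-4, 0, 0) (2, 2, 4 * s) (4, 4, 0) (0, 2, 4 * s) 0 [(0, 0, s, 0)],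
      .vertex (-4, 4, 0) (0, 4, 0) (4, 0, 0) (0, 2, 0) 0 [(-1, 0, -s, 4), (0, 1, -s, 0)],
      .merge (-4, 4, 0) (0, 2, 0) (4, 0, 0) 1 1])
    (strandEdges [0, 1] (-1) 0 ++ crossingEdges 0 0 e) (wideCrossingEdges e) := by
  decide +revert

theorem placed_wideCrossingEdges (x : ℝ) (i : ℕ) (e : Bool) : placed x i (wideCrossingEdges e) =
    segment ℝ ((x - 1, (i : ℝ), 0) : Space) (x, (i : ℝ) + 1 / 2, if e then 1 else -1) ∪
      segment ℝ ((x, (i : ℝ) + 1 / 2, if e then 1 else -1) : Space) (x + 1, (i : ℝ) + 1, 0) ∪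
      segment ℝ ((x - 1, (i : ℝ) + 1, 0) : Space) (x + 1, (i : ℝ), 0) := by
  simp only [wideCrossingEdges, placed_cons, placed_nil, Set.union_empty, Set.union_assoc]
  cases e <;> norm_num [crossingSign, sub_eq_add_neg]

theorem isotopicIn_widen {n i : ℕ} (hi : i + 1 < n) (x : ℝ) (e : Bool) :
    IsotopicIn (slab (x - 1) (x + 1)) (strandsOn (Set.Iio n) (x - 1) x ∪ drawLetter n x (i, e))
      (strandsOn (others n i) (x - 1) (x + 1) ∪ placed x i (wideCrossingEdges e)) := by
  have h := isotopicIn_slab (carries_widen e) (by norm_num) (J := others n i) (i := i)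
    (fun j hj => by have := hj.2; omega) x
  convert h using 1
  · norm_num [sub_eq_add_neg]
  · rw [placed_append, placed_strandEdges, placed_crossingEdges, drawLetter,
      Iio_eq_others_union hi, strandsOn_union,
      ← strandsOn_trans (others n i) (by norm_num : x + (-1 : ℤ) ≤ x)
      (by norm_num : x ≤ x + (1 : ℤ))]
    simp only [shift_cons, shift_nil]
    norm_num [sub_eq_add_neg]
    ac_rfl
  · norm_num [sub_eq_add_neg]

theorem stretch_wideCrossing (x : ℝ) (n i : ℕ) (e : Bool) :
    reparametrize (stretch (x - 1) two_pos one_pos) ''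
      (strandsOn (others n i) (x - 1) (x + 1) ∪ placed x i (wideCrossingEdges e)) =
        drawLetter n (x - 1) (i, e) := by
  rw [Set.image_union, reparametrize_strandsOn _ _ (by linarith), placed_wideCrossingEdges,
    Set.image_union, Set.image_union, drawLetter, crossing]
  rw [stretch_image_segment_of_mem, stretch_image_segment_of_mem, stretch_image_segment_of_mem,
    stretch_of_le _ _ le_rfl, stretch_of_mem]
  · norm_num
    ring_nf
    exact Set.union_comm _ _
  all_goals constructor <;> norm_num <;> linarith

theorem ambientIsotopic_braidClosure_remove_margin {n : ℕ} {x b : ℝ} {g : ℕ × Bool} {w : Word}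
    (hw : Valid n (g :: w)) (hb : x + 1 + w.length ≤ b) :
    AmbientIsotopic (braidClosure n (x - 1) x (g :: w) b)
      (braidClosure n (x - 1) (x - 1) (g :: w) (b - 1)) := by
  obtain ⟨hg, hw⟩ := valid_cons.1 hw
  have hx : x + 1 ≤ x + 1 + w.length := le_add_of_nonneg_right (Nat.cast_nonneg _)
  set rest := draw n (x + 1) w ∪ strandsOn (Set.Iio n) (x + 1 + w.length) b ∪
    arcsOn (Set.Iio n) (x - 1) b with hrest
  have hdisjoint : Disjoint rest (slab (x - 1) (x + 1)) :=
    ((disjoint_draw_slab hw (Or.inr le_rfl)).union_left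
      (disjoint_strandsOn_slab _ hb (Or.inr hx))).union_left
      (disjoint_arcsOn_slab _ le_rfl (hx.trans hb))
  rw [braidClosure_cons, ← hrest]
  refine (isotopicIn_widen hg x g.2 rest hdisjoint).trans ?_
  convert ambientIsotopic_stretch (p := x - 1) two_pos one_pos _ using 1
  rw [Set.image_union, stretch_wideCrossing, hrest, Set.image_union, Set.image_union,
    stretch_image_of_ge _ _ fun q hq => by linarith [(draw_subset hw _ hq).1.1],
    reparametrize_strandsOn _ _ hb, reparametrize_arcsOn _ _ (by linarith),
    stretch_of_ge _ _ (by linarith), stretch_of_ge _ _ (by linarith), stretch_of_le _ _ le_rfl,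
    translation_draw, braidClosure_self, draw, List.length_cons]
  push_cast
  ring_nf
  ac_rfl

theorem ambientIsotopic_closureSet_of_left_margin {n : ℕ} {w : Word} (hw : Valid n w) {b : ℝ}
    (hb : (w.length : ℝ) < b) :
    AmbientIsotopic (braidClosure n (-1) 0 w b) (closureSet n w) := by
  rw [closureSet]
  cases w with
  | nil =>
    rw [braidClosure_nil n (by norm_num) (by simpa using hb.le)]
    refine (ambientIsotopic_braidClosure_add 1 n _ _ _ _).trans ?_
    norm_num
    exact ambientIsotopic_braidClosure_right hw le_rfl (by norm_num at hb ⊢; linarith) (by simp)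
  | cons g w =>
    rw [List.length_cons] at hb
    push_cast at hb
    have h := ambientIsotopic_braidClosure_remove_margin (x := 0) hw (b := b) (by linarith)
    rw [zero_sub] at h
    refine h.trans ((ambientIsotopic_braidClosure_add 1 n _ _ _ _).trans ?_)
    norm_num
    exact ambientIsotopic_braidClosure_right hw le_rfl (by norm_num; linarith) (by simp)

theorem ambientIsotopic_closureSet {n : ℕ} {w : Word} (hw : Valid n w) {a x b : ℝ}
    (ha : a ≤ x) (hb : x + w.length < b) :
    AmbientIsotopic (braidClosure n a x w b) (closureSet n w) := by
  refine (ambientIsotopic_braidClosure_add (-x) n a x w b).trans ?_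
  rw [add_neg_cancel]
  rcases ha.eq_or_lt with rfl | ha
  · rw [add_neg_cancel, closureSet]
    exact ambientIsotopic_braidClosure_right hw le_rfl (by linarith) (by linarith)
  · exact (ambientIsotopic_braidClosure_left hw (by linarith) neg_one_lt_zero
      (by linarith)).trans (ambientIsotopic_closureSet_of_left_margin hw (by linarith))

/-! ### Braid moves -/

theorem carries_cancel (e : Bool) : carries [boxZone 0 2 (-1) 2]
    (let s := crossingSign e
    [.vertex (2, 2, 4 * s) (4, 4, 0) (8, 0, 0) (6, 2, 4 * s) 0 [(2, 1, s, -10), (-1, 0, s, 8)],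
      .vertex (0, 4, 0) (4, 0, 0) (6, 2, -4 * s) (4, 4, -2 * s) 0
        [(-4, -1, -2 * s, 18), (1, 0, -s, 0)],
      .vertex (4, 4, -2 * s) (6, 2, -4 * s) (8, 4, 0) (6, 4, -s) 0 [(1, 1, -s, -10)],
      .merge (4, 4, -2 * s) (6, 4, -s) (8, 4, 0) 1 1,
      .vertex (0, 4, 0) (4, 4, -2 * s) (8, 4, 0) (4, 4, 0) 0 [(0, 1, 0, -3)],
      .merge (0, 4, 0) (4, 4, 0) (8, 4, 0) 1 1,
      .vertex (0, 0, 0) (2, 2, 4 * s) (6, 2, 4 * s) (3, 1, 2 * s) 0 [(-1, -1, s, 4)],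
      .merge (0, 0, 0) (3, 1, 2 * s) (6, 2, 4 * s) 1 1,
      .vertex (0, 0, 0) (6, 2, 4 * s) (8, 0, 0) (4, 0, 0) 0 [(0, -1, 0, 3)],
      .merge (0, 0, 0) (4, 0, 0) (8, 0, 0) 1 1])
    (crossingEdges 0 0 e ++ crossingEdges 1 0 (!e)) (strandEdges [0, 1] 0 2) := by
  decide +revert

theorem isotopicIn_cancel {n i : ℕ} (hi : i + 1 < n) (x : ℝ) (e : Bool) :
    IsotopicIn (slab x (x + 2)) (draw n x [(i, e), (i, !e)])
      (strandsOn (Set.Iio n) x (x + 2)) := by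
  have h := isotopicIn_slab (carries_cancel e) (by norm_num) (J := others n i) (i := i)
    (fun j hj => by have := hj.2; omega) x
  convert h using 1
  · norm_num
  · rw [placed_append, placed_crossingEdges, placed_crossingEdges,
      ← strandsOn_trans (others n i) (by norm_num : x + (0 : ℤ) ≤ x + 1)
      (by norm_num : x + 1 ≤ x + (2 : ℤ))]
    norm_num [draw, drawLetter, add_assoc]
    ac_rfl
  · rw [placed_strandEdges, Iio_eq_others_union hi, strandsOn_union]
    simp only [shift_cons, shift_nil]
    norm_num

/-- The part of the closure of `u ++ m ++ v` outside `m`, when `m` has `k` letters. -/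
def frame (n : ℕ) (u : Word) (k : ℕ) (v : Word) : Set Space :=
  strandsOn (Set.Iio n) 0 0 ∪ draw n 0 u ∪ draw n (u.length + k) v ∪
    strandsOn (Set.Iio n) (u.length + k + v.length) (u.length + k + v.length + 1) ∪
    arcsOn (Set.Iio n) 0 (u.length + k + v.length + 1)

theorem disjoint_frame_slab {n : ℕ} {u v : Word} (hu : Valid n u) (hv : Valid n v) (k : ℕ) :
    Disjoint (frame n u k v) (slab u.length (u.length + k)) := by
  have hlu : (0 : ℝ) ≤ u.length := Nat.cast_nonneg _
  have : (0 : ℝ) ≤ v.length := Nat.cast_nonneg _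
  refine ((((disjoint_strandsOn_slab _ le_rfl ?_).union_left
    (disjoint_draw_slab hu ?_)).union_left (disjoint_draw_slab hv ?_)).union_left
    (disjoint_strandsOn_slab _ ?_ ?_)).union_left (disjoint_arcsOn_slab _ ?_ ?_)
  · exact Or.inl hlu
  · exact Or.inl (zero_add _).le
  · exact Or.inr le_rfl
  · linarith
  · exact Or.inr (by linarith)
  · exact hlu
  · linarith

theorem closureSet_eq_draw_union_frame (n : ℕ) (u m v : Word) :
    closureSet n (u ++ m ++ v) = draw n u.length m ∪ frame n u m.length v := by
  rw [closureSet, braidClosure, draw_append, draw_append, frame]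
  simp only [List.length_append, zero_add]
  push_cast
  ac_rfl

theorem closureSet_append_cancel {n : ℕ} {w : Word} (hw : Valid n w) {i : ℕ} (hi : i + 1 < n)
    (e : Bool) : AmbientIsotopic (closureSet n (w ++ [(i, e), (i, !e)])) (closureSet n w) := by
  rw [← List.append_nil (w ++ _), closureSet_eq_draw_union_frame]
  refine (isotopicIn_cancel hi _ e _ (disjoint_frame_slab hw (valid_nil n) 2)).trans ?_
  convert ambientIsotopic_closureSet hw le_rfl (x := 0) (b := w.length + 3)
    (by linarith) using 1
  rw [frame, braidClosure, ← strandsOn_trans _ (by linarith : (0 + w.length : ℝ) ≤ w.length + 2)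
    (by linarith : (w.length + 2 : ℝ) ≤ w.length + 3)]
  norm_num [draw, add_assoc]
  ac_rfl

theorem closureSet_cons_cancel {n : ℕ} {w : Word} (hw : Valid n w) {i : ℕ} (hi : i + 1 < n)
    (e : Bool) : AmbientIsotopic (closureSet n ((i, e) :: (i, !e) :: w)) (closureSet n w) := by
  have h := isotopicIn_cancel hi 0 e _ (by simpa using disjoint_frame_slab (valid_nil n) hw 2)
  have heq := closureSet_eq_draw_union_frame n [] [(i, e), (i, !e)] w
  simp only [List.nil_append, List.cons_append, List.length_nil, Nat.cast_zero] at heq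
  rw [heq]
  refine h.trans ?_
  convert ambientIsotopic_closureSet hw zero_le_two (b := 2 + w.length + 1) (by linarith) using 1
  have hstart := strandsOn_trans (Set.Iio n) (le_refl (0 : ℝ)) zero_le_two
  rw [frame, braidClosure, ← hstart]
  norm_num [draw]
  ac_rfl

theorem carries_braid : carries [boxZone 0 3 (-1) 3]
    [.vertex (2, 2, 4) (4, 4, 0) (6, 6, 4) (4, 4, 8) 0 [(-2, 1, 0, 6), (1, 1, 0, -4),
        (-1, -2, 1, 14)],
      .merge (0, 0, 0) (2, 2, 4) (4, 4, 8) 1 1,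
      .merge (4, 4, 8) (6, 6, 4) (8, 8, 0) 1 1,
      .vertex (4, 4, 8) (8, 8, 0) (12, 8, 0) (8, 6, 4) 0 [(1, 2, 1, -20)],
      .merge (4, 4, 8) (8, 6, 4) (12, 8, 0) 1 1,
      .vertex (0, 0, 0) (4, 4, 8) (12, 8, 0) (6, 4, 12) 0 [(0, 0, 1, 0), (-1, 1, 0, 4)],
      .vertex (0, 4, 0) (4, 0, 0) (8, 0, 0) (4, 2, 0) 0 [(-1, -1, 0, 8), (1, 0, -1, 0)],
      .merge (0, 4, 0) (4, 2, 0) (8, 0, 0) 1 1,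
      .vertex (0, 4, 0) (8, 0, 0) (10, 2, 4) (6, 4, 6) 0 [(-1, -2, 1, 10), (-2, 0, -1, 24),
        (1, 1, -1, -3)],
      .vertex (6, 4, 6) (10, 2, 4) (12, 4, 0) (9, 4, 3) 0 [(2, -3, 0, 0), (0, 0, 1, 0)],
      .merge (6, 4, 6) (9, 4, 3) (12, 4, 0) 1 1,
      .vertex (0, 8, 0) (4, 8, 0) (8, 4, 0) (4, 6, 0) 0 [(0, 1, 0, -4), (-1, 0, -1, 8)],
      .merge (0, 8, 0) (4, 6, 0) (8, 4, 0) 1 1,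
      .vertex (0, 8, 0) (8, 4, 0) (12, 0, 0) (6, 4, 0) 0 [(-1, 0, -1, 12), (1, 0, -1, 0)],
      .vertex (0, 8, 0) (6, 4, 0) (12, 0, 0) (4, 4, 0) 0 [(-1, 0, -1, 12), (1, 0, -1, 0)],
      .split (4, 4, 0) (8, 2, 0) (12, 0, 0) 1 1,
      .vertex (4, 4, 0) (8, 2, 0) (12, 0, 0) (8, 0, 0) 0 [(0, -1, 0, 4), (1, 0, -1, -4)],
      .split (0, 4, 0) (3, 4, 3) (6, 4, 6) 1 1,
      .vertex (0, 4, 0) (3, 4, 3) (6, 4, 6) (2, 6, 4) 0 [(-2, -2, 1, 14), (-2, 3, 0, 0)],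
      .vertex (2, 6, 4) (6, 4, 6) (12, 4, 0) (4, 8, 0) 0 [(1, 2, 1, -18), (-2, 0, -1, 24),
        (0, 2, -1, -1)],
      .split (4, 8, 0) (8, 6, 0) (12, 4, 0) 1 1,
      .vertex (4, 8, 0) (8, 6, 0) (12, 4, 0) (8, 8, 0) 0 [(1, 1, 0, -12), (-1, 0, -1, 12)],
      .vertex (0, 0, 0) (6, 4, 12) (12, 8, 0) (8, 4, 8) 0 [(0, 0, 1, 0), (1, -1, 0, 0)],
      .split (0, 0, 0) (4, 2, 4) (8, 4, 8) 1 1,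
      .vertex (0, 0, 0) (4, 2, 4) (8, 4, 8) (4, 0, 0) 0 [(-1, -2, 1, 8)],
      .split (4, 0, 0) (6, 2, 4) (8, 4, 8) 1 1,
      .split (8, 4, 8) (10, 6, 4) (12, 8, 0) 1 1,
      .vertex (6, 2, 4) (8, 4, 8) (10, 6, 4) (8, 4, 0) 0 [(2, -1, 0, -10), (-1, -1, 0, 16),
        (1, 2, 1, -14)]]
    (crossingEdges 0 0 true ++ strandEdges [2] 0 1 ++ (crossingEdges 1 1 true ++
      strandEdges [0] 1 2) ++ (crossingEdges 2 0 true ++ strandEdges [2] 2 3))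
    (crossingEdges 0 1 true ++ strandEdges [0] 0 1 ++ (crossingEdges 1 0 true ++
      strandEdges [2] 1 2) ++ (crossingEdges 2 1 true ++ strandEdges [0] 2 3)) := by
  decide

/-- The positions of `n` strands other than `i`, `i + 1` and `i + 2`. -/
def others₃ (n i : ℕ) : Set ℕ := {j | j < n ∧ j ≠ i ∧ j ≠ i + 1 ∧ j ≠ i + 2}

theorem others_eq_others₃_union {n i : ℕ} (hi : i + 2 < n) :
    others n i = others₃ n i ∪ {i + 2} := by
  ext j
  simp only [others, others₃, Set.mem_ofPred_eq, Set.mem_union, Set.mem_singleton_iff]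
  omega

theorem others_succ_eq_others₃_union {n i : ℕ} (hi : i + 2 < n) :
    others n (i + 1) = others₃ n i ∪ {i} := by
  ext j
  simp only [others, others₃, Set.mem_ofPred_eq, Set.mem_union, Set.mem_singleton_iff]
  omega

theorem strandsOn_three (J : Set ℕ) (x : ℝ) : strandsOn J x (x + 3) =
    strandsOn J x (x + 1) ∪ strandsOn J (x + 1) (x + 2) ∪ strandsOn J (x + 2) (x + 3) := by
  rw [strandsOn_trans J (by linarith) (by linarith), strandsOn_trans J (by linarith) (by linarith)]

theorem isotopicIn_braid {n i : ℕ} (hi : i + 2 < n) (x : ℝ) :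
    IsotopicIn (slab x (x + 3)) (draw n x [(i, true), (i + 1, true), (i, true)])
      (draw n x [(i + 1, true), (i, true), (i + 1, true)]) := by
  have h := isotopicIn_slab carries_braid (by norm_num) (J := others₃ n i) (i := i)
    (fun j hj => by have := hj.2; omega) x
  simp only [placed_append, placed_crossingEdges, placed_strandEdges, shift_cons, shift_nil,
    Int.cast_ofNat, Int.cast_zero, Int.cast_one, add_zero, strandsOn_three] at h
  simp only [draw, drawLetter, others_eq_others₃_union hi, others_succ_eq_others₃_union hi,
    strandsOn_union, add_assoc, one_add_one_eq_two, (by norm_num : (2 + 1 : ℝ) = 3)] at h ⊢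
  convert h using 1 <;> simp only [insert_empty_eq, Set.union_empty] <;> ac_rfl

theorem closureSet_braid {n : ℕ} {u v : Word} (hu : Valid n u) (hv : Valid n v) {i : ℕ}
    (hi : i + 2 < n) :
    AmbientIsotopic (closureSet n (u ++ [(i, true), (i + 1, true), (i, true)] ++ v))
      (closureSet n (u ++ [(i + 1, true), (i, true), (i + 1, true)] ++ v)) := by
  rw [closureSet_eq_draw_union_frame, closureSet_eq_draw_union_frame]
  exact isotopicIn_braid hi _ _ (disjoint_frame_slab hu hv 3)

/-- The edges of a crossing between the last two strands, with the closing arcs at these strands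
and the start of the last strand. -/
def kinkEdges (e : Bool) : EdgeList :=
  crossingEdges 0 0 e ++ strandEdges [0, 1] 1 2 ++ strandEdges [1] (-2) 0 ++ arcEdges [0, 1] (-2) 2

/-- The edges that replace `kinkEdges` when the crossing is removed. -/
def straightEdges : EdgeList := strandEdges [0] 0 2 ++ arcEdges [0] (-2) 2

theorem carries_kink (e : Bool) : carries [[(0, 1, 0, 0)], [(1, 0, 0, 0), (0, 1, 0, 4)]]
    (let s := crossingSign e
    [.vertex (4, 4, 0) (8, 4, 0) (8, 4, -8) (6, 4, -4) 0 [(1, 0, 0, -4), (0, 0, 1, 8)],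
      .merge (4, 4, 0) (6, 4, -4) (8, 4, -8) 1 1,
      .vertex (-8, 4, -8) (-8, 4, 0) (0, 4, 0) (-4, 4, -4) 0 [(-1, 0, 0, 0), (0, 0, 1, 8)],
      .merge (-8, 4, -8) (-4, 4, -4) (0, 4, 0) 1 1,
      .vertex (4, 4, 0) (8, 4, -8) (-8, 4, -8) (-2, 4, -4) 0 [(0, 2, -1, -8), (1, 0, -1, 0)],
      .merge (4, 4, 0) (-2, 4, -4) (-8, 4, -8) 1 1,
      .vertex (4, 4, 0) (-8, 4, -8) (0, 4, 0) (2, 6, -2) 0 [(0, 2, -1, -8)],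
      .vertex (4, 4, 0) (2, 6, -2) (0, 4, 0) (2, 6, 0) 0 [(0, 1, 0, -4)],
      .vertex (2, 6, 0) (0, 4, 0) (4, 0, 0) (3, 3, 0) 0 [(-1, -1, -s, 8), (0, 1, -s, 0)],
      .merge (2, 6, 0) (3, 3, 0) (4, 0, 0) 1 1,
      .vertex (4, 4, 0) (2, 6, 0) (4, 0, 0) (4, 2, 0) 0 [(-2, -1, -2 * s, 12), (0, 1, -s, 0)],
      .merge (4, 4, 0) (4, 2, 0) (4, 0, 0) 1 1,
      .vertex (2, 2, 4 * s) (4, 4, 0) (4, 0, 0) (3, 1, 2 * s) 0 [(1, 0, 0, -2)],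
      .merge (2, 2, 4 * s) (3, 1, 2 * s) (4, 0, 0) 1 1,
      .vertex (0, 0, 0) (2, 2, 4 * s) (4, 0, 0) (2, 0, 0) 1 [(-1, 4, 2, 4)],
      .merge (0, 0, 0) (2, 0, 0) (4, 0, 0) 1 1,
      .merge (0, 0, 0) (4, 0, 0) (8, 0, 0) 1 1])
    (kinkEdges e) straightEdges := by
  decide +revert

/-- The edges of a crossing over `[1, 2]`, with the closing arcs at its strands. -/
def crossingAfter : EdgeList :=
  crossingEdges 1 0 true ++ strandEdges [0, 1] 2 3 ++ strandEdges [0, 1] (-2) 0 ++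
    arcEdges [0, 1] (-2) 3

/-- The edges of a crossing over `[-1, 0]`, with the closing arcs at its strands. -/
def crossingBefore : EdgeList :=
  strandEdges [0, 1] 1 3 ++ strandEdges [0, 1] (-2) (-1) ++ crossingEdges (-1) 0 true ++
    arcEdges [0, 1] (-2) 3

/- The loop of the strand that passes over is widened until it encircles the other loop. This one
is moved, inside the wide loop, from position `0` to position `1`, and then the wide loop is
tightened at position `0`. -/
theorem carries_conj : carries
    [[(0, 1, 0, 4), (0, -1, 0, 8), (1, 0, 0, -4)], [(0, 1, 0, 4), (0, -1, 0, 8), (-1, 0, 0, 0)],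
      [(0, 1, 0, 4), (0, -1, 0, 8), (0, 0, -1, -4)]]
    [.split (12, 4, 0) (12, 4, -4) (12, 4, -8) 1 1,
      .split (-8, 4, -8) (-8, 4, -4) (-8, 4, 0) 1 1,
      .vertex (8, 4, 0) (12, 4, 0) (12, 4, -4) (16, 2, 4) 0 [(1, 1, 1, -12)],
      .vertex (16, 2, 4) (12, 4, -4) (12, 4, -8) (16, 2, -4) 0 [(2, 2, -1, -32), (0, 0, 1, 8)],
      .vertex (16, 2, -4) (12, 4, -8) (-8, 4, -8) (16, 2, -12) 2 [(1, 5, 0, -12)],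
      .vertex (16, 2, -12) (-8, 4, -8) (-8, 4, -4) (-12, 2, -12) 2 [(-1, 4, -4, -40)],
      .vertex (-12, 2, -12) (-8, 4, -4) (-8, 4, 0) (-12, 2, -4) 1 [(-1, 2, -1, -16), (0, 0, 1, 12)],
      .vertex (-12, 2, -4) (-8, 4, 0) (0, 4, 0) (-12, 2, 4) 1 [(0, 2, 1, 0)],
      .merge (16, 2, 4) (16, 2, -4) (16, 2, -12) 1 1,
      .merge (-12, 2, -12) (-12, 2, -4) (-12, 2, 4) 1 1,
      .vertex (6, 2, 4) (8, 4, 0) (16, 2, 4) (12, 2, 4) 0 [(1, 2, 1, -14), (-1, 0, 0, 16)],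
      .merge (6, 2, 4) (12, 2, 4) (16, 2, 4) 2 3,
      .vertex (4, 0, 0) (6, 2, 4) (16, 2, 4) (10, 1, 2) 0 [(-1, -1, 3, 6)],
      .merge (4, 0, 0) (10, 1, 2) (16, 2, 4) 1 1,
      .split (12, 0, 0) (12, 0, -4) (12, 0, -8) 1 1,
      .split (-8, 0, -8) (-8, 0, -4) (-8, 0, 0) 1 1,
      .vertex (4, 4, 0) (8, 0, 0) (12, 0, 0) (8, 2, 0) 0 [(-1, 0, 3, 12), (-1, 0, 0, 12),
        (1, 0, -3, -4)],
      .merge (4, 4, 0) (8, 2, 0) (12, 0, 0) 1 1,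
      .vertex (4, 4, 0) (12, 0, 0) (12, 0, -4) (12, 2, 0) 0 [(0, 0, 1, 4), (-1, 0, 0, 13),
        (1, 0, -3, -4)],
      .vertex (12, 2, 0) (12, 0, -4) (12, 0, -8) (12, 2, -4) 0 [(0, 0, -1, 0), (0, 0, 1, 8),
        (-1, 0, 0, 13)],
      .vertex (12, 2, -4) (12, 0, -8) (-8, 0, -8) (12, 2, -8) 2 [(1, 0, 0, 8), (-1, 0, 0, 13),
        (0, 0, 1, 9)],
      .vertex (12, 2, -8) (-8, 0, -8) (-8, 0, -4) (-8, 2, -8) 2 [(-1, 0, 0, 12), (0, 0, 1, 9),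
        (1, 0, 0, 9)],
      .vertex (-8, 2, -8) (-8, 0, -4) (-8, 0, 0) (-8, 2, -4) 1 [(0, 0, -1, 0), (0, 0, 1, 8),
        (1, 0, 0, 9)],
      .vertex (-8, 2, -4) (-8, 0, 0) (0, 0, 0) (-8, 2, 0) 1 [(0, 0, 1, 4), (1, -5, 0, 19)],
      .merge (12, 2, 0) (12, 2, -4) (12, 2, -8) 1 1,
      .merge (-8, 2, -8) (-8, 2, -4) (-8, 2, 0) 1 1,
      .split (12, 2, 0) (12, 2, -4) (12, 2, -8) 1 1,
      .split (-8, 2, -8) (-8, 2, -4) (-8, 2, 0) 1 1,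
      .vertex (4, 4, 0) (12, 2, 0) (12, 2, -4) (12, 4, 0) 0 [(0, 0, 1, 4), (-1, 5, 0, 3)],
      .vertex (12, 4, 0) (12, 2, -4) (12, 2, -8) (12, 4, -4) 0 [(0, 0, -1, 0), (0, 0, 1, 8),
        (-1, 0, 0, 13)],
      .vertex (12, 4, -4) (12, 2, -8) (-8, 2, -8) (12, 4, -8) 2 [(1, 0, 0, 8), (-1, 0, 0, 13),
        (0, 0, 1, 9)],
      .vertex (12, 4, -8) (-8, 2, -8) (-8, 2, -4) (-8, 4, -8) 2 [(-1, 0, 0, 12), (0, 0, 1, 9),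
        (1, 0, 0, 9)],
      .vertex (-8, 4, -8) (-8, 2, -4) (-8, 2, 0) (-8, 4, -4) 1 [(0, 0, -1, 0), (0, 0, 1, 8),
        (1, 0, 0, 9)],
      .vertex (-8, 4, -4) (-8, 2, 0) (0, 0, 0) (-8, 4, 0) 1 [(0, 0, 1, 4), (1, 0, 0, 9),
        (-1, 0, -3, 0)],
      .split (-8, 4, 0) (-4, 2, 0) (0, 0, 0) 1 1,
      .vertex (-8, 4, 0) (-4, 2, 0) (0, 0, 0) (-4, 4, 0) 1 [(1, 0, 3, 8), (1, 0, 0, 8),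
        (-1, 0, -3, 0)],
      .merge (12, 4, 0) (12, 4, -4) (12, 4, -8) 1 1,
      .merge (-8, 4, -8) (-8, 4, -4) (-8, 4, 0) 1 1,
      .split (-12, 2, 4) (-6, 3, 2) (0, 4, 0) 1 1,
      .vertex (-12, 2, 4) (-6, 3, 2) (0, 4, 0) (-2, 2, 4) 1 [(1, 1, 3, -2)],
      .split (-12, 2, 4) (-8, 2, 4) (-2, 2, 4) 3 2,
      .vertex (-12, 2, 4) (-8, 2, 4) (-2, 2, 4) (-4, 0, 0) 1 [(-1, -2, 1, -2), (1, 0, 0, 12)],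
      .split (16, 2, 4) (16, 2, -4) (16, 2, -12) 1 1,
      .split (-12, 2, -12) (-12, 2, -4) (-12, 2, 4) 1 1,
      .vertex (4, 0, 0) (16, 2, 4) (16, 2, -4) (12, 0, 0) 0 [(0, -2, 1, 8)],
      .vertex (12, 0, 0) (16, 2, -4) (16, 2, -12) (12, 0, -4) 0 [(1, -2, -1, -12), (0, 0, 1, 12)],
      .vertex (12, 0, -4) (16, 2, -12) (-12, 2, -12) (12, 0, -8) 2 [(1, -4, -4, -28)],
      .vertex (12, 0, -8) (-12, 2, -12) (-12, 2, -4) (-8, 0, -8) 2 [(-1, -5, 0, 12)],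
      .vertex (-8, 0, -8) (-12, 2, -4) (-12, 2, 4) (-8, 0, -4) 1 [(-2, -2, -1, -16), (0, 0, 1, 8)],
      .vertex (-8, 0, -4) (-12, 2, 4) (-4, 0, 0) (-8, 0, 0) 1 [(-1, -1, 1, -4)],
      .merge (12, 0, 0) (12, 0, -4) (12, 0, -8) 1 1,
      .merge (-8, 0, -8) (-8, 0, -4) (-8, 0, 0) 1 1]
    crossingAfter crossingBefore := by
  decide

theorem others_self (m : ℕ) : others (m + 2) m = Set.Iio m := by
  ext j
  simp only [others, Set.mem_ofPred_eq, Set.mem_Iio]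
  omega

theorem Iio_succ_eq_union (n : ℕ) : Set.Iio (n + 1) = Set.Iio n ∪ {n} := by
  ext j
  simp only [Set.mem_Iio, Set.mem_union, Set.mem_singleton_iff]
  omega

theorem strandsOn_union_draw_succ {n : ℕ} {w : Word} (hw : Valid n w) {a x : ℝ} (ha : a ≤ x) :
    strandsOn {n} a x ∪ draw (n + 1) x w = strandsOn {n} a (x + w.length) ∪ draw n x w := by
  induction w generalizing x with
  | nil => simp [draw]
  | cons g w ih =>
    obtain ⟨hg, hw⟩ := valid_cons.1 hw
    have hothers : others (n + 1) g.1 = others n g.1 ∪ {n} := by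
      ext j
      simp only [others, Set.mem_ofPred_eq, Set.mem_union, Set.mem_singleton_iff]
      omega
    have hlength : x + ((g :: w).length : ℝ) = x + 1 + w.length := by
      rw [List.length_cons]
      push_cast
      ring
    calc strandsOn {n} a x ∪ draw (n + 1) x (g :: w)
        = drawLetter n x g ∪
            (strandsOn {n} a x ∪ strandsOn {n} x (x + 1) ∪ draw (n + 1) (x + 1) w) := by
          rw [draw, drawLetter, drawLetter, hothers, strandsOn_union]
          ac_rfl
      _ = drawLetter n x g ∪ (strandsOn {n} a (x + 1 + w.length) ∪ draw n (x + 1) w) := by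
          rw [strandsOn_trans {n} ha (by linarith), ih hw (by linarith)]
      _ = strandsOn {n} a (x + (g :: w).length) ∪ draw n x (g :: w) := by
          rw [hlength, draw]
          ac_rfl

theorem ambientIsotopic_kink {m : ℕ} {A : Set Space} (hA : ∀ p ∈ A, p.1 ≤ 0 ∧ p.2.1 ≤ m)
    (e : Bool) :
    AmbientIsotopic
      (placed 0 m (kinkEdges e) ∪ (A ∪ strandsOn (Set.Iio m) 0 2 ∪ arcsOn (Set.Iio m) (-2) 2))
      (placed 0 m straightEdges ∪ (A ∪ strandsOn (Set.Iio m) 0 2 ∪ arcsOn (Set.Iio m) (-2) 2)) := by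
  refine isotopicIn_placed_of_carries (carries_kink e) 0 m _ (Set.disjoint_left.2 ?_)
  rintro p hp ⟨q, hq, rfl⟩
  have hq' : 0 < q.2.1 ∨ 0 < q.1 ∧ -1 < q.2.1 := by
    simp only [region, Set.mem_ofPred_eq, List.mem_cons, List.not_mem_nil, or_false,
      exists_eq_or_imp, exists_eq_left, cell, forall_eq_or_imp, forall_eq,
      AffineForm.evalAt] at hq
    push_cast at hq
    exact hq.imp (fun h => by linarith) fun h => ⟨by linarith [h.1], by linarith [h.2]⟩
  have hlow {j : ℕ} (hj : j ∈ Set.Iio m) (h : (m : ℝ) + q.2.1 = j) : False := by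
    have : (j : ℝ) + 1 ≤ m := by exact_mod_cast hj
    rcases hq' with h' | ⟨-, h'⟩ <;> linarith
  rcases hp with (hp | hp) | hp
  · obtain ⟨h, h'⟩ := hA _ hp
    simp only [translation, Homeomorph.coe_addLeft, Prod.fst_add, Prod.snd_add, zero_add] at h h'
    rcases hq' with hq' | ⟨hq', -⟩ <;> linarith
  · obtain ⟨j, hj, -, -, h⟩ := (mem_strandsOn zero_le_two).1 hp
    exact hlow hj (congrArg Prod.fst h)
  · obtain ⟨j, hj, h⟩ := (arcsOn_subset _ _ _ hp).2
    exact hlow hj h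

theorem placed_kinkEdges (m : ℕ) (e : Bool) : placed 0 m (kinkEdges e) =
    crossing 0 m e ∪ strandsOn {m, m + 1} 1 2 ∪ strandsOn {m + 1} (-2) 0 ∪
      arcsOn {m, m + 1} (-2) 2 := by
  simp [kinkEdges, placed_append, placed_crossingEdges, placed_strandEdges, placed_arcEdges,
    shift_cons, shift_nil, Set.union_assoc]

theorem placed_straightEdges (m : ℕ) :
    placed 0 m straightEdges = strandsOn {m} 0 2 ∪ arcsOn {m} (-2) 2 := by
  simp [straightEdges, placed_append, placed_strandEdges, placed_arcEdges, shift_cons, shift_nil]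

section Destabilize

variable {m : ℕ} {w : Word} (hw : Valid (m + 1) w) {φ : ℝ ≃o ℝ} (hstart : φ (-2) = -2)
  (hend : ∀ y : ℝ, w.length ≤ y → φ y = y + (-w.length))

include hw in
theorem braidClosure_stabilized (e : Bool) {a b : ℝ} (ha : a ≤ 0) :
    braidClosure (m + 2) a 0 (w ++ [(m, e)]) b =
      strandsOn (Set.Iio (m + 1)) a 0 ∪ draw (m + 1) 0 w ∪ (strandsOn {m + 1} a w.length ∪
        drawLetter (m + 2) w.length (m, e) ∪ strandsOn (Set.Iio (m + 2)) (w.length + 1) b ∪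
        arcsOn (Set.Iio (m + 2)) a b) := by
  have h := strandsOn_union_draw_succ hw ha
  rw [zero_add] at h
  calc braidClosure (m + 2) a 0 (w ++ [(m, e)]) b
      = strandsOn (Set.Iio (m + 1)) a 0 ∪ (strandsOn {m + 1} a 0 ∪ draw (m + 2) 0 w) ∪
          (drawLetter (m + 2) w.length (m, e) ∪
            strandsOn (Set.Iio (m + 2)) (w.length + 1) b ∪ arcsOn (Set.Iio (m + 2)) a b) := by
        rw [braidClosure, draw_append, Iio_succ_eq_union (m + 1), strandsOn_union,
          List.length_append, List.length_singleton, Nat.cast_add, Nat.cast_one, draw, draw,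
          zero_add, zero_add, Set.union_empty]
        ac_rfl
    _ = _ := by
        rw [h]
        ac_rfl

include hstart hend

include hw in
theorem reparametrize_braidClosure_stabilized (e : Bool) :
    reparametrize φ '' braidClosure (m + 2) (-2) 0 (w ++ [(m, e)]) (w.length + 2) =
      placed 0 m (kinkEdges e) ∪
        (reparametrize φ '' (strandsOn (Set.Iio (m + 1)) (-2) 0 ∪ draw (m + 1) 0 w) ∪
          strandsOn (Set.Iio m) 0 2 ∪ arcsOn (Set.Iio m) (-2) 2) := by
  have : (0 : ℝ) ≤ w.length := Nat.cast_nonneg _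
  have hletter : reparametrize φ '' drawLetter (m + 2) w.length (m, e) =
      crossing 0 m e ∪ strandsOn (Set.Iio m) 0 1 := by
    rw [reparametrize_image_eq_translation fun q hq =>
        hend q.1 (drawLetter_subset (g := (m, e)) (Nat.lt_succ_self _) _ hq).1.1,
      translation_drawLetter, add_neg_cancel, drawLetter, others_self, zero_add]
  have hIio : Set.Iio (m + 2) = Set.Iio m ∪ {m, m + 1} := by
    rw [Iio_eq_others_union (Nat.lt_succ_self (m + 1)), others_self]
  have himage {x : ℝ} (hx : 0 ≤ x) : φ (w.length + x) = x := by
    rw [hend _ (by linarith)]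
    ring
  rw [braidClosure_stabilized hw e (by norm_num), Set.image_union,
    Set.image_union _ _ (arcsOn _ _ _), Set.image_union _ _ (strandsOn _ _ _),
    Set.image_union _ (strandsOn {m + 1} _ _), hletter,
    reparametrize_strandsOn _ _ (by linarith), reparametrize_strandsOn _ _ (by linarith),
    reparametrize_arcsOn _ _ (by linarith), hstart, hend _ le_rfl, himage zero_le_one,
    himage zero_le_two, add_neg_cancel, placed_kinkEdges, hIio, strandsOn_union, arcsOn_union,
    ← strandsOn_trans _ zero_le_one one_le_two]
  ac_rfl

theorem reparametrize_braidClosure_destabilized :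
    reparametrize φ '' braidClosure (m + 1) (-2) 0 w (w.length + 2) =
      placed 0 m straightEdges ∪
        (reparametrize φ '' (strandsOn (Set.Iio (m + 1)) (-2) 0 ∪ draw (m + 1) 0 w) ∪
          strandsOn (Set.Iio m) 0 2 ∪ arcsOn (Set.Iio m) (-2) 2) := by
  have : (0 : ℝ) ≤ w.length := Nat.cast_nonneg _
  have himage : φ (w.length + 2) = 2 := by
    rw [hend _ (by linarith)]
    ring
  rw [braidClosure, Set.image_union, Set.image_union _ _ (strandsOn _ (0 + _) _),
    reparametrize_strandsOn _ _ (by linarith), reparametrize_arcsOn _ _ (by linarith), zero_add,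
    hstart, himage, hend _ le_rfl, add_neg_cancel, placed_straightEdges, Iio_succ_eq_union m,
    strandsOn_union _ _ 0, arcsOn_union]
  ac_rfl

end Destabilize

theorem closureSet_destabilize {m : ℕ} {w : Word} (hw : Valid (m + 1) w) (e : Bool) :
    AmbientIsotopic (closureSet (m + 2) (w ++ [(m, e)])) (closureSet (m + 1) w) := by
  have hlength : (0 : ℝ) < w.length + 1 := by positivity
  have hw' : Valid (m + 2) (w ++ [(m, e)]) := valid_append.2
    ⟨fun g hg => (hw g hg).trans (Nat.lt_succ_self _), valid_singleton.2 (Nat.lt_succ_self _)⟩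
  set φ := stretch (-1) hlength zero_lt_one
  have hstart : φ (-2) = -2 := stretch_of_le _ _ (by norm_num)
  have hend (y : ℝ) (hy : w.length ≤ y) : φ y = y + (-w.length) := by
    rw [stretch_of_ge _ _ (by linarith)]
    ring
  have hA : ∀ p ∈ reparametrize φ '' (strandsOn (Set.Iio (m + 1)) (-2) 0 ∪ draw (m + 1) 0 w),
      p.1 ≤ 0 ∧ p.2.1 ≤ m := by
    rintro _ ⟨p, hp, rfl⟩
    have hle : p.1 ≤ w.length ∧ p.2.1 ≤ m := by
      rcases hp with hp | hp
      · obtain ⟨j, hj, -, hp0, hpj⟩ := (mem_strandsOn (by norm_num)).1 hp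
        rw [hpj]
        exact ⟨by linarith, Nat.cast_le.2 (Nat.lt_succ_iff.1 hj)⟩
      · obtain ⟨⟨-, h⟩, h', -⟩ := draw_subset hw 0 hp
        push_cast [Set.mem_Iic] at h'
        exact ⟨by linarith, by linarith⟩
    refine ⟨(φ.monotone hle.1).trans_eq ?_, hle.2⟩
    rw [hend _ le_rfl, add_neg_cancel]
  have hkink : AmbientIsotopic (braidClosure (m + 2) (-2) 0 (w ++ [(m, e)]) (w.length + 2))
      (braidClosure (m + 1) (-2) 0 w (w.length + 2)) := by
    refine .of_image (reparametrize φ) ?_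
    rw [reparametrize_braidClosure_stabilized hw hstart hend,
      reparametrize_braidClosure_destabilized hstart hend]
    exact ambientIsotopic_kink hA e
  exact (ambientIsotopic_closureSet hw' (by norm_num) (by simp)).symm.trans
    (hkink.trans (ambientIsotopic_closureSet hw (by norm_num) (by linarith)))

theorem ambientIsotopic_conj {i : ℕ} {J : Set ℕ} (hJ : ∀ j ∈ J, j + 1 ≤ i ∨ i + 2 ≤ j)
    {A : Set Space} (hA : ∀ p ∈ A, 0 ≤ p.1 ∧ p.1 ≤ 1 ∧ -1 ≤ p.2.2) :
    AmbientIsotopic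
      (placed 0 i crossingAfter ∪
        (A ∪ strandsOn J (-2) 0 ∪ strandsOn J 1 3 ∪ arcsOn J (-2) 3))
      (placed 0 i crossingBefore ∪
        (A ∪ strandsOn J (-2) 0 ∪ strandsOn J 1 3 ∪ arcsOn J (-2) 3)) := by
  refine isotopicIn_placed_of_carries carries_conj 0 i _ (Set.disjoint_left.2 ?_)
  rintro p hp ⟨q, hq, rfl⟩
  have hq' : (-1 < q.2.1 ∧ q.2.1 < 2) ∧ (1 < q.1 ∨ q.1 < 0 ∨ q.2.2 < -1) := by
    simp only [region, Set.mem_ofPred_eq, List.mem_cons, List.not_mem_nil, or_false,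
      exists_eq_or_imp, exists_eq_left, cell, forall_eq_or_imp, forall_eq,
      AffineForm.evalAt] at hq
    push_cast at hq
    rcases hq with ⟨h, h', h''⟩ | ⟨h, h', h''⟩ | ⟨h, h', h''⟩
    · exact ⟨⟨by linarith, by linarith⟩, Or.inl (by linarith)⟩
    · exact ⟨⟨by linarith, by linarith⟩, Or.inr (Or.inl (by linarith))⟩
    · exact ⟨⟨by linarith, by linarith⟩, Or.inr (Or.inr (by linarith))⟩
  have hfar {j : ℕ} (hj : j ∈ J) (h : (i : ℝ) + q.2.1 = j) : False := by
    rcases hJ j hj with hj | hj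
    · have : (j : ℝ) + 1 ≤ i := by exact_mod_cast hj
      linarith
    · have : (i : ℝ) + 2 ≤ j := by exact_mod_cast hj
      linarith
  rcases hp with ((hp | hp) | hp) | hp
  · obtain ⟨h, h', h''⟩ := hA _ hp
    simp only [translation, Homeomorph.coe_addLeft, Prod.fst_add, Prod.snd_add, zero_add]
      at h h' h''
    rcases hq'.2 with hq' | hq' | hq' <;> linarith
  · obtain ⟨j, hj, -, -, h⟩ := (mem_strandsOn (by norm_num)).1 hp
    exact hfar hj (congrArg Prod.fst h)
  · obtain ⟨j, hj, -, -, h⟩ := (mem_strandsOn (by norm_num)).1 hp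
    exact hfar hj (congrArg Prod.fst h)
  · obtain ⟨j, hj, h⟩ := (arcsOn_subset _ _ _ hp).2
    exact hfar hj h

theorem placed_crossingAfter (i : ℕ) : placed 0 i crossingAfter =
    crossing 1 i true ∪ strandsOn {i, i + 1} 2 3 ∪ strandsOn {i, i + 1} (-2) 0 ∪
      arcsOn {i, i + 1} (-2) 3 := by
  simp [crossingAfter, placed_append, placed_crossingEdges, placed_strandEdges, placed_arcEdges,
    shift_cons, shift_nil, Set.union_assoc]

theorem placed_crossingBefore (i : ℕ) : placed 0 i crossingBefore =
    strandsOn {i, i + 1} 1 3 ∪ strandsOn {i, i + 1} (-2) (-1) ∪ crossing (-1) i true ∪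
      arcsOn {i, i + 1} (-2) 3 := by
  simp [crossingBefore, placed_append, placed_crossingEdges, placed_strandEdges, placed_arcEdges,
    shift_cons, shift_nil, Set.union_assoc]

section Conjugate

variable {n i : ℕ} (hi : i + 1 < n) {w : Word} {φ : ℝ ≃o ℝ} (hstart : ∀ y ≤ 0, φ y = y)
  (hend : ∀ y : ℝ, w.length ≤ y → φ y = y + (1 - w.length))

include hi hstart hend

theorem reparametrize_braidClosure_append_letter :
    reparametrize φ '' braidClosure n (-2) 0 (w ++ [(i, true)]) (w.length + 2) =
      placed 0 i crossingAfter ∪ (reparametrize φ '' draw n 0 w ∪ strandsOn (others n i) (-2) 0 ∪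
        strandsOn (others n i) 1 3 ∪ arcsOn (others n i) (-2) 3) := by
  have : (0 : ℝ) ≤ w.length := Nat.cast_nonneg _
  have hletter : reparametrize φ '' drawLetter n w.length (i, true) =
      crossing 1 i true ∪ strandsOn (others n i) 1 2 := by
    rw [reparametrize_image_eq_translation fun q hq =>
        hend q.1 (drawLetter_subset (g := (i, true)) hi _ hq).1.1,
      translation_drawLetter, add_sub_cancel, drawLetter, one_add_one_eq_two]
  have himage {x : ℝ} (hx : 0 ≤ x) : φ (w.length + x) = x + 1 := by
    rw [hend _ (by linarith)]
    ring
  rw [braidClosure, draw_append, draw, draw, Set.union_empty, zero_add, zero_add,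
    List.length_append, List.length_singleton, Nat.cast_add, Nat.cast_one]
  simp only [Set.image_union]
  rw [hletter, reparametrize_strandsOn _ _ (by norm_num), reparametrize_strandsOn _ _ (by linarith),
    reparametrize_arcsOn _ _ (by linarith), hstart _ le_rfl, hstart _ (by norm_num),
    himage zero_le_one, himage zero_le_two, placed_crossingAfter, Iio_eq_others_union hi,
    ← strandsOn_trans (others n i) one_le_two (by norm_num : (2 : ℝ) ≤ 3)]
  norm_num only [strandsOn_union, arcsOn_union]
  ac_rfl

theorem reparametrize_braidClosure_cons_letter :
    reparametrize φ '' braidClosure n (-2) (-1) ((i, true) :: w) (w.length + 2) =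
      placed 0 i crossingBefore ∪ (reparametrize φ '' draw n 0 w ∪ strandsOn (others n i) (-2) 0 ∪
        strandsOn (others n i) 1 3 ∪ arcsOn (others n i) (-2) 3) := by
  have : (0 : ℝ) ≤ w.length := Nat.cast_nonneg _
  have hletter : reparametrize φ '' drawLetter n (-1) (i, true) =
      crossing (-1) i true ∪ strandsOn (others n i) (-1) 0 := by
    rw [reparametrize_image_eq_self fun q hq =>
        hstart q.1 (by linarith [(drawLetter_subset (g := (i, true)) hi _ hq).1.2]), drawLetter,
      neg_add_cancel]
  have himage : φ (w.length + 2) = 3 := by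
    rw [hend _ (by linarith)]
    ring
  rw [braidClosure_cons, neg_add_cancel, zero_add]
  simp only [Set.image_union]
  rw [hletter, reparametrize_strandsOn _ _ (by norm_num), reparametrize_strandsOn _ _ (by linarith),
    reparametrize_arcsOn _ _ (by linarith), hstart _ (by norm_num), hstart _ (by norm_num),
    hend _ le_rfl, himage, placed_crossingBefore, Iio_eq_others_union hi, add_sub_cancel,
    ← strandsOn_trans (others n i) (by norm_num : (-2 : ℝ) ≤ -1) (by norm_num : (-1 : ℝ) ≤ 0)]
  simp only [strandsOn_union, arcsOn_union]
  ac_rfl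

end Conjugate

theorem closureSet_rotate_positive {n : ℕ} {w : Word} (hw : Valid n w) {i : ℕ} (hi : i + 1 < n) :
    AmbientIsotopic (closureSet n (w ++ [(i, true)])) (closureSet n ((i, true) :: w)) := by
  rcases eq_or_ne w [] with rfl | hne
  · exact .refl _
  have hlength : (0 : ℝ) < w.length := Nat.cast_pos.2 (List.length_pos_iff.2 hne)
  set φ := stretch 0 hlength zero_lt_one
  have hstart (y : ℝ) (hy : y ≤ 0) : φ y = y := stretch_of_le _ _ hy
  have hend (y : ℝ) (hy : w.length ≤ y) : φ y = y + (1 - w.length) := by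
    rw [stretch_of_ge _ _ (by linarith)]
  have hA : ∀ p ∈ reparametrize φ '' draw n 0 w, 0 ≤ p.1 ∧ p.1 ≤ 1 ∧ -1 ≤ p.2.2 := by
    rintro _ ⟨p, hp, rfl⟩
    obtain ⟨⟨h, h'⟩, -, h'', -⟩ := draw_subset hw 0 hp
    have hmono := φ.monotone h
    have hmono' := φ.monotone h'
    rw [hstart 0 le_rfl] at hmono
    rw [zero_add, hend _ le_rfl, add_sub_cancel] at hmono'
    exact ⟨hmono, hmono', h''⟩
  have hconj : AmbientIsotopic (braidClosure n (-2) 0 (w ++ [(i, true)]) (w.length + 2))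
      (braidClosure n (-2) (-1) ((i, true) :: w) (w.length + 2)) := by
    refine .of_image (reparametrize φ) ?_
    rw [reparametrize_braidClosure_append_letter hi hstart hend,
      reparametrize_braidClosure_cons_letter hi hstart hend]
    exact ambientIsotopic_conj (fun j hj => by have := hj.2; omega) hA
  exact (ambientIsotopic_closureSet (valid_append.2 ⟨hw, valid_singleton.2 hi⟩) (by norm_num)
      (by simp)).symm.trans (hconj.trans (ambientIsotopic_closureSet (valid_cons.2 ⟨hi, hw⟩)
        (by norm_num) (by push_cast [List.length_cons]; linarith)))

theorem closureSet_rotate_letter {n : ℕ} {w : Word} (hw : Valid n w) {g : ℕ × Bool}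
    (hg : g.1 + 1 < n) : AmbientIsotopic (closureSet n (w ++ [g])) (closureSet n (g :: w)) := by
  obtain ⟨i, _ | _⟩ := g
  · have hw₁ : Valid n ((i, false) :: w) := valid_cons.2 ⟨hg, hw⟩
    have hw₂ : Valid n (w ++ [(i, false)]) := valid_append.2 ⟨hw, valid_singleton.2 hg⟩
    have hinsert := (closureSet_cons_cancel hw₂ hg true).symm
    have hrotate := closureSet_rotate_positive (valid_append.2 ⟨hw₁, valid_singleton.2 hg⟩) hg
    have hcancel := closureSet_append_cancel hw₁ hg false
    rw [List.append_assoc] at hrotate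
    exact hinsert.trans (hrotate.symm.trans hcancel)
  · exact closureSet_rotate_positive hw hg

theorem closureSet_rotate {n : ℕ} {u v : Word} (hu : Valid n u) (hv : Valid n v) :
    AmbientIsotopic (closureSet n (u ++ v)) (closureSet n (v ++ u)) := by
  induction u generalizing v with
  | nil => rw [List.nil_append, List.append_nil]; exact .refl _
  | cons g u ih =>
    obtain ⟨hg, hu⟩ := valid_cons.1 hu
    have hletter := closureSet_rotate_letter (valid_append.2 ⟨hu, hv⟩) hg
    have htail := ih hu (valid_append.2 ⟨hv, valid_singleton.2 hg⟩)
    rw [List.append_assoc] at hletter htail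
    exact hletter.symm.trans htail

theorem closureSet_cancel {n : ℕ} {u v : Word} (hu : Valid n u) (hv : Valid n v) {i : ℕ}
    (hi : i + 1 < n) (e : Bool) :
    AmbientIsotopic (closureSet n (u ++ (i, e) :: (i, !e) :: v)) (closureSet n (u ++ v)) :=
  (closureSet_rotate hu (valid_cons.2 ⟨hi, valid_cons.2 ⟨hi, hv⟩⟩)).trans
    ((closureSet_cons_cancel (valid_append.2 ⟨hv, hu⟩) hi e).trans (closureSet_rotate hv hu))

/-! ### The half turn -/

/-- Rotation about the vertical axis by the angle `θ`. -/
noncomputable def rotation (θ : ℝ) : Space ≃ₜ Space where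
  toFun p := (Real.cos θ * p.1 - Real.sin θ * p.2.1, Real.sin θ * p.1 + Real.cos θ * p.2.1, p.2.2)
  invFun p := (Real.cos θ * p.1 + Real.sin θ * p.2.1, -Real.sin θ * p.1 + Real.cos θ * p.2.1, p.2.2)
  left_inv p := by
    ext <;> dsimp only
    · linear_combination p.1 * Real.sin_sq_add_cos_sq θ
    · linear_combination p.2.1 * Real.sin_sq_add_cos_sq θ
  right_inv p := by
    ext <;> dsimp only
    · linear_combination p.1 * Real.sin_sq_add_cos_sq θ
    · linear_combination p.2.1 * Real.sin_sq_add_cos_sq θ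
  continuous_toFun := by fun_prop
  continuous_invFun := by fun_prop

theorem ambientIsotopic_rotation (θ : ℝ) (K : Set Space) :
    AmbientIsotopic K (rotation θ '' K) := by
  refine ⟨fun t => rotation (t * θ), ?_, fun p => by simp [rotation], by simp⟩
  change Continuous fun p : unitInterval × Space =>
    (Real.cos (p.1 * θ) * p.2.1 - Real.sin (p.1 * θ) * p.2.2.1,
      Real.sin (p.1 * θ) * p.2.1 + Real.cos (p.1 * θ) * p.2.2.1, p.2.2.2)
  fun_prop

/-- The half turn `(x, y, z) ↦ (-x, c - y, z)`. -/
noncomputable def halfTurn (c : ℝ) : Space ≃ₜ Space :=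
  (rotation Real.pi).trans (translation (0, c, 0))

theorem halfTurn_apply (c : ℝ) (p : Space) : halfTurn c p = (-p.1, c - p.2.1, p.2.2) := by
  simp [halfTurn, rotation, sub_eq_add_neg]

theorem ambientIsotopic_halfTurn (c : ℝ) (K : Set Space) : AmbientIsotopic K (halfTurn c '' K) := by
  have h : halfTurn c '' K = translation (0, c, 0) '' (rotation Real.pi '' K) :=
    Set.image_comp (translation (0, c, 0)) (rotation Real.pi) K
  rw [h]
  exact (ambientIsotopic_rotation _ _).trans (ambientIsotopic_translation _ _)

theorem halfTurn_image_segment (c x y z x' y' z' : ℝ) :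
    halfTurn c '' segment ℝ ((x, y, z) : Space) (x', y', z') =
      segment ℝ ((-x', c - y', z') : Space) (-x, c - y, z) := by
  let f : Space →ₗ[ℝ] Space := LinearMap.prodMap (-.id) (LinearMap.prodMap (-.id) .id)
  have h : ⇑(halfTurn c) = ⇑(f.toAffineMap + AffineMap.const ℝ Space ((0, c, 0) : Space)) := by
    ext p <;> simp [f, halfTurn_apply, sub_eq_neg_add]
  rw [segment_symm ℝ ((-x', c - y', z') : Space), h, image_segment, ← h]
  simp only [halfTurn_apply]

/-- The word of a braid after a half turn about the axis perpendicular to the plane of its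
diagram. -/
def flipWord (n : ℕ) (w : Word) : Word := (w.map fun g => (n - 2 - g.1, g.2)).reverse

theorem Valid.flipWord {n : ℕ} {w : Word} (hw : Valid n w) : Valid n (flipWord n w) := by
  intro g hg
  obtain ⟨k, hk, rfl⟩ := List.mem_map.1 (List.mem_reverse.1 hg)
  have := hw k hk
  dsimp only
  omega

theorem length_flipWord (n : ℕ) (w : Word) : (flipWord n w).length = w.length := by
  rw [flipWord, List.length_reverse, List.length_map]

section HalfTurn

variable {n : ℕ}

theorem cast_sub_one_sub {j : ℕ} (hj : j < n) : ((n - 1 - j : ℕ) : ℝ) = n - 1 - j := by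
  rw [Nat.cast_sub (by omega), Nat.cast_sub (by omega), Nat.cast_one]

theorem image_sub_Iio (n : ℕ) : (n - 1 - ·) '' Set.Iio n = Set.Iio n := by
  ext j
  simp only [Set.mem_image, Set.mem_Iio]
  exact ⟨fun ⟨k, hk, h⟩ => by omega, fun hj => ⟨n - 1 - j, by omega, by omega⟩⟩

theorem image_sub_others {i : ℕ} (hi : i + 1 < n) :
    (n - 1 - ·) '' others n i = others n (n - 2 - i) := by
  ext j
  simp only [others, Set.mem_image, Set.mem_ofPred_eq]
  exact ⟨fun ⟨k, hk, h⟩ => by omega, fun hj => ⟨n - 1 - j, by omega, by omega⟩⟩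

theorem halfTurn_strandsOn {J : Set ℕ} (hJ : J ⊆ Set.Iio n) (x x' : ℝ) :
    halfTurn (n - 1) '' strandsOn J x x' = strandsOn ((n - 1 - ·) '' J) (-x') (-x) := by
  rw [strandsOn, strandsOn, Set.image_iUnion₂, Set.biUnion_image]
  refine Set.iUnion₂_congr fun j hj => ?_
  rw [halfTurn_image_segment, cast_sub_one_sub (hJ hj)]

theorem halfTurn_arcsOn {J : Set ℕ} (hJ : J ⊆ Set.Iio n) (a b : ℝ) :
    halfTurn (n - 1) '' arcsOn J a b = arcsOn ((n - 1 - ·) '' J) (-b) (-a) := by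
  rw [arcsOn, arcsOn, Set.image_iUnion₂, Set.biUnion_image]
  refine Set.iUnion₂_congr fun j hj => ?_
  simp only [Set.image_union, halfTurn_image_segment, cast_sub_one_sub (hJ hj)]
  ac_rfl

theorem halfTurn_drawLetter {g : ℕ × Bool} (hg : g.1 + 1 < n) (x : ℝ) :
    halfTurn (n - 1) '' drawLetter n x g = drawLetter n (-(x + 1)) (n - 2 - g.1, g.2) := by
  have hcast : ((n - 2 - g.1 : ℕ) : ℝ) = n - 2 - g.1 := by
    rw [Nat.cast_sub (by omega), Nat.cast_sub (by omega), Nat.cast_two]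
  rw [drawLetter, drawLetter, Set.image_union, halfTurn_strandsOn fun j hj => hj.1,
    image_sub_others hg, crossing, crossing]
  simp only [Set.image_union, halfTurn_image_segment, hcast]
  ring_nf
  ac_rfl

theorem halfTurn_draw {w : Word} (hw : Valid n w) (x : ℝ) :
    halfTurn (n - 1) '' draw n x w = draw n (-(x + w.length)) (flipWord n w) := by
  induction w generalizing x with
  | nil => exact Set.image_empty _
  | cons g w ih =>
    obtain ⟨hg, hw⟩ := valid_cons.1 hw
    have hflip : flipWord n (g :: w) = flipWord n w ++ [(n - 2 - g.1, g.2)] := by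
      rw [flipWord, flipWord, List.map_cons, List.reverse_cons]
    rw [draw, Set.image_union, ih hw, halfTurn_drawLetter hg, Set.union_comm, hflip, draw_append,
      draw, draw, Set.union_empty, length_flipWord, List.length_cons]
    push_cast
    congr 2 <;> ring

theorem halfTurn_braidClosure {w : Word} (hw : Valid n w) (a x b : ℝ) :
    halfTurn (n - 1) '' braidClosure n a x w b =
      braidClosure n (-b) (-(x + w.length)) (flipWord n w) (-a) := by
  simp only [braidClosure, Set.image_union, halfTurn_strandsOn subset_rfl, halfTurn_draw hw,
    halfTurn_arcsOn subset_rfl, image_sub_Iio, length_flipWord,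
    show -(x + w.length) + w.length = -x by ring]
  ac_rfl

end HalfTurn

theorem closureSet_flip {n : ℕ} {w : Word} (hw : Valid n w) :
    AmbientIsotopic (closureSet n w) (closureSet n (flipWord n w)) := by
  have hturn := ambientIsotopic_halfTurn (n - 1) (braidClosure n (-1) 0 w (w.length + 1))
  rw [halfTurn_braidClosure hw] at hturn
  exact (ambientIsotopic_closureSet hw (by norm_num) (by linarith)).symm.trans
    (hturn.trans (ambientIsotopic_closureSet hw.flipWord (by linarith)
      (by rw [length_flipWord]; norm_num)))

/-! ### The unknot -/

section Radial

variable {E : Type*} [NormedAddCommGroup E] [NormedSpace ℝ E] {r : E → ℝ}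

theorem continuous_smul_self {C : ℝ} (hr : ContinuousOn r {0}ᶜ) (hC : ∀ x ≠ 0, |r x| ≤ C) :
    Continuous fun x => r x • x := by
  refine continuous_iff_continuousAt.2 fun x => ?_
  rcases eq_or_ne x 0 with rfl | hx
  · rw [ContinuousAt, smul_zero]
    refine squeeze_zero_norm (a := fun x => C * ‖x‖) (fun x => ?_)
      ((continuous_const.mul continuous_norm).tendsto' 0 0 (by simp))
    rcases eq_or_ne x 0 with rfl | hx
    · simp
    · rw [norm_smul]
      exact mul_le_mul_of_nonneg_right (hC x hx) (norm_nonneg x)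
  · exact (hr.continuousAt (isOpen_compl_singleton.mem_nhds hx)).smul continuousAt_id

/-- The homeomorphism that scales every ray by the factor `r`. -/
noncomputable def radialHomeomorph {a b : ℝ} (hr : ContinuousOn r {0}ᶜ)
    (hscale : ∀ c : ℝ, 0 < c → ∀ x, r (c • x) = r x) (ha : 0 < a)
    (hmem : ∀ x ≠ 0, r x ∈ Set.Icc a b) : E ≃ₜ E where
  toFun x := r x • x
  invFun x := (r x)⁻¹ • x
  left_inv x := by
    rcases eq_or_ne x 0 with rfl | hx
    · simp
    · have hpos : 0 < r x := ha.trans_le (hmem x hx).1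
      simp only [hscale _ hpos, inv_smul_smul₀ hpos.ne']
  right_inv x := by
    rcases eq_or_ne x 0 with rfl | hx
    · simp
    · have hpos : 0 < r x := ha.trans_le (hmem x hx).1
      simp only [hscale _ (inv_pos.2 hpos), smul_inv_smul₀ hpos.ne']
  continuous_toFun := continuous_smul_self hr fun x hx =>
    (abs_of_pos (ha.trans_le (hmem x hx).1)).trans_le (hmem x hx).2
  continuous_invFun := by
    have hpos (x : E) (hx : x ≠ 0) : 0 < r x := ha.trans_le (hmem x hx).1
    refine continuous_smul_self (C := a⁻¹) (hr.inv₀ fun x hx => (hpos x hx).ne') fun x hx => ?_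
    rw [abs_of_pos (inv_pos.2 (hpos x hx))]
    exact inv_anti₀ ha (hmem x hx).1

end Radial

theorem ambientIsotopic_radial {r : Space → ℝ} {a b : ℝ} (hr : ContinuousOn r {0}ᶜ)
    (hscale : ∀ c : ℝ, 0 < c → ∀ p, r (c • p) = r p) (ha : 0 < a)
    (hmem : ∀ p ≠ 0, r p ∈ Set.Icc a b) (K : Set Space) :
    AmbientIsotopic K ((fun p => r p • p) '' K) := by
  have hline (t : unitInterval) (p : Space) (hp : p ≠ 0) :
      AffineMap.lineMap 1 (r p) (t : ℝ) ∈ Set.Icc (min 1 a) (max 1 b) :=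
    (convex_Icc _ _).lineMap_mem ⟨min_le_left _ _, le_max_left _ _⟩
      ⟨(min_le_right _ _).trans (hmem p hp).1, (hmem p hp).2.trans (le_max_right _ _)⟩ t.2
  refine ⟨fun t => radialHomeomorph (r := fun p => AffineMap.lineMap 1 (r p) (t : ℝ))
    (continuousOn_const.lineMap hr continuousOn_const) (fun c hc p => by rw [hscale c hc])
    (lt_min one_pos ha) (hline t), ?_, fun p => ?_, ?_⟩
  · have hcont : Continuous fun p => r p • p := continuous_smul_self (C := b) hr fun p hp =>
      (abs_of_pos (ha.trans_le (hmem p hp).1)).trans_le (hmem p hp).2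
    have h : Continuous fun q : unitInterval × Space =>
        AffineMap.lineMap q.2 (r q.2 • q.2) (q.1 : ℝ) :=
      continuous_snd.lineMap (hcont.comp continuous_snd)
        (continuous_subtype_val.comp continuous_fst)
    refine h.congr fun q => ?_
    simp [radialHomeomorph, AffineMap.lineMap_apply, add_smul, sub_smul, smul_sub, mul_smul]
  · simp [radialHomeomorph]
  · simp [radialHomeomorph]

/-- The Euclidean norm of a point; the norm of `Space` itself is the maximum norm. -/
noncomputable def euclideanNorm (p : Space) : ℝ := √(p.1 ^ 2 + p.2.1 ^ 2 + p.2.2 ^ 2)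

theorem euclideanNorm_smul {c : ℝ} (hc : 0 ≤ c) (p : Space) :
    euclideanNorm (c • p) = c * euclideanNorm p := by
  simp only [euclideanNorm, Prod.smul_fst, Prod.smul_snd, smul_eq_mul, mul_pow, ← mul_add]
  rw [Real.sqrt_mul (sq_nonneg c), Real.sqrt_sq hc]

theorem norm_le_euclideanNorm (p : Space) : ‖p‖ ≤ euclideanNorm p := by
  simp only [Prod.norm_def, Real.norm_eq_abs]
  refine max_le ?_ (max_le ?_ ?_) <;> refine Real.abs_le_sqrt ?_ <;>
    linarith [sq_nonneg p.1, sq_nonneg p.2.1, sq_nonneg p.2.2]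

theorem euclideanNorm_le (p : Space) : euclideanNorm p ≤ 2 * ‖p‖ := by
  refine (Real.sqrt_le_left (by positivity)).2 ?_
  have hx : |p.1| ≤ ‖p‖ := norm_fst_le p
  have hy : |p.2.1| ≤ ‖p‖ := (norm_fst_le p.2).trans (norm_snd_le p)
  have hz : |p.2.2| ≤ ‖p‖ := (norm_snd_le p.2).trans (norm_snd_le p)
  linarith [sq_le_sq.2 (hx.trans (le_abs_self _)), sq_le_sq.2 (hy.trans (le_abs_self _)),
    sq_le_sq.2 (hz.trans (le_abs_self _)), sq_nonneg ‖p‖]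

/-- The unit circle of the maximum norm in the plane `y = 0`. -/
def squareCircle : Set Space := {p | ‖p‖ = 1 ∧ p.2.1 = 0}

theorem radial_image_squareCircle :
    (fun p : Space => (‖p‖ / euclideanNorm p) • p) '' squareCircle = roundCircle := by
  have hround {p : Space} : p ∈ roundCircle ↔ euclideanNorm p = 1 ∧ p.2.1 = 0 := by
    rw [roundCircle, Set.mem_ofPred_eq, euclideanNorm, Real.sqrt_eq_one]
    exact and_congr_left fun h => by rw [h, zero_pow two_ne_zero, add_zero]
  ext q
  rw [hround]
  constructor
  · rintro ⟨p, ⟨hp, hy⟩, rfl⟩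
    have hpos : 0 < euclideanNorm p := by linarith [norm_le_euclideanNorm p]
    refine ⟨?_, by simp [hy]⟩
    dsimp only
    rw [hp, euclideanNorm_smul (by positivity), one_div_mul_cancel hpos.ne']
  · rintro ⟨hq, hy⟩
    have hpos : 0 < ‖q‖ := by linarith [euclideanNorm_le q]
    refine ⟨‖q‖⁻¹ • q, ⟨by rw [norm_smul, norm_inv, norm_norm, inv_mul_cancel₀ hpos.ne'],
      by simp [hy]⟩, ?_⟩
    dsimp only
    rw [euclideanNorm_smul (by positivity), hq, norm_smul, norm_inv, norm_norm,
      inv_mul_cancel₀ hpos.ne', mul_one, one_div, inv_inv, smul_inv_smul₀ hpos.ne']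

theorem ambientIsotopic_squareCircle : AmbientIsotopic squareCircle roundCircle := by
  rw [← radial_image_squareCircle]
  have hpos {p : Space} (hp : p ≠ 0) : 0 < euclideanNorm p :=
    (norm_pos_iff.2 hp).trans_le (norm_le_euclideanNorm p)
  refine ambientIsotopic_radial (a := 1 / 2) (b := 1) ?_ (fun c hc p => ?_) one_half_pos
    (fun p hp => ⟨?_, ?_⟩) _
  · have hcont : Continuous euclideanNorm := by
      unfold euclideanNorm
      fun_prop
    exact continuous_norm.continuousOn.div hcont.continuousOn fun p hp => (hpos hp).ne'
  · rw [norm_smul, Real.norm_of_nonneg hc.le, euclideanNorm_smul hc.le, mul_div_mul_left _ _ hc.ne']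
  · rw [le_div_iff₀ (hpos hp)]
    linarith [euclideanNorm_le p]
  · exact (div_le_one (hpos hp)).2 (norm_le_euclideanNorm p)

theorem mem_segment_vertical {x y z z' : ℝ} (h : z ≤ z') (p : Space) :
    p ∈ segment ℝ ((x, y, z) : Space) (x, y, z') ↔
      p.1 = x ∧ p.2.1 = y ∧ z ≤ p.2.2 ∧ p.2.2 ≤ z' := by
  rw [← Prod.image_mk_segment_right, ← Prod.image_mk_segment_right, segment_eq_Icc h]
  obtain ⟨a, b, c⟩ := p
  simp only [Set.image_image, Set.mem_image, Set.mem_Icc, Prod.mk.injEq]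
  constructor
  · rintro ⟨c, hc, rfl, rfl, rfl⟩
    exact ⟨rfl, rfl, hc⟩
  · rintro ⟨rfl, rfl, hc⟩
    exact ⟨c, hc, rfl, rfl, rfl⟩

theorem mem_squareCircle {x y z : ℝ} : (x, y, z) ∈ squareCircle ↔
    y = 0 ∧ ((x = 1 ∨ x = -1) ∧ -1 ≤ z ∧ z ≤ 1 ∨ (z = 1 ∨ z = -1) ∧ -1 ≤ x ∧ x ≤ 1) := by
  rw [squareCircle, Set.mem_ofPred_eq, and_comm]
  refine and_congr_right fun hy => ?_
  replace hy : y = 0 := hy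
  rw [Prod.norm_mk, Prod.norm_mk, hy, norm_zero, max_eq_right (norm_nonneg z), Real.norm_eq_abs,
    Real.norm_eq_abs, max_eq_iff, abs_eq zero_le_one, abs_eq zero_le_one]
  refine or_congr (and_congr_right fun hx => ?_) (and_congr_right fun hz => ?_)
  · rw [← abs_le, (abs_eq zero_le_one).2 hx]
  · rw [← abs_le, (abs_eq zero_le_one).2 hz]

theorem translation_braidClosure_one :
    translation (0, 0, 1) '' braidClosure 1 (-1) 0 [] 1 = squareCircle := by
  have hIio : Set.Iio 1 = ({0} : Set ℕ) := by
    ext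
    simp
  rw [braidClosure_nil 1 (by norm_num) zero_le_one, braidClosure_self, hIio]
  simp only [draw, strandsOn, arcsOn, Set.biUnion_singleton, Set.image_union,
    translation_image_segment, Prod.mk_add_mk, Set.empty_union, List.length_nil]
  norm_num
  ext ⟨x, y, z⟩
  rw [segment_symm ℝ ((1, 0, 1) : Space) (1, 0, -1),
    segment_symm ℝ ((1, 0, -1) : Space) (-1, 0, -1), mem_squareCircle]
  simp only [Set.mem_union]
  rw [mem_segment_parallel (by norm_num) (0, 1), mem_segment_parallel (by norm_num) (0, -1),
    mem_segment_vertical (by norm_num), mem_segment_vertical (by norm_num)]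
  simp only [Prod.mk.injEq]
  tauto

theorem closureSet_one : AmbientIsotopic (closureSet 1 []) roundCircle := by
  have h := ambientIsotopic_translation (0, 0, 1) (braidClosure 1 (-1) 0 [] 1)
  rw [translation_braidClosure_one] at h
  exact (ambientIsotopic_closureSet (valid_nil 1) (by norm_num) (by norm_num)).symm.trans
    (h.trans ambientIsotopic_squareCircle)

/-! ### Connected closures -/

/-- The permutation of a word: the strand that starts in position `j` ends in position
`perm w j`. -/
def perm : Word → Equiv.Perm ℕ
  | [] => 1
  | g :: w => perm w * Equiv.swap g.1 (g.1 + 1)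

theorem perm_cons_apply (g : ℕ × Bool) (w : Word) (j : ℕ) :
    perm (g :: w) j = perm w (Equiv.swap g.1 (g.1 + 1) j) := rfl

theorem swap_succ_lt_iff {n i : ℕ} (hi : i + 1 < n) (j : ℕ) :
    Equiv.swap i (i + 1) j < n ↔ j < n := by
  rw [Equiv.swap_apply_def]
  split_ifs <;> omega

theorem perm_mem_Iio_iff {n : ℕ} {w : Word} (hw : Valid n w) (j : ℕ) :
    perm w j ∈ Set.Iio n ↔ j ∈ Set.Iio n := by
  induction w generalizing j with
  | nil => rfl
  | cons g w ih =>
    obtain ⟨hg, hw⟩ := valid_cons.1 hw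
    rw [perm_cons_apply, ih hw, Set.mem_Iio, swap_succ_lt_iff hg, Set.mem_Iio]

/-- The part of a letter drawn over `[x, x + 1]` that starts in position `j`. -/
def letterStrand (x : ℝ) (g : ℕ × Bool) (j : ℕ) : Set Space :=
  if j = g.1 then
    segment ℝ ((x, (j : ℝ), 0) : Space) (x + 1 / 2, (j : ℝ) + 1 / 2, if g.2 then 1 else -1) ∪
      segment ℝ ((x + 1 / 2, (j : ℝ) + 1 / 2, if g.2 then 1 else -1) : Space)
        (x + 1, (j : ℝ) + 1, 0)
  else segment ℝ ((x, (j : ℝ), 0) : Space) (x + 1, (Equiv.swap g.1 (g.1 + 1) j : ℝ), 0)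

/-- The strand of a word drawn from `x` on that starts in position `j`. -/
def strand : ℝ → Word → ℕ → Set Space
  | _, [], _ => ∅
  | x, g :: w, j => letterStrand x g j ∪ strand (x + 1) w (Equiv.swap g.1 (g.1 + 1) j)

theorem letterStrand_self (x : ℝ) (g : ℕ × Bool) : letterStrand x g g.1 =
    segment ℝ ((x, (g.1 : ℝ), 0) : Space)
        (x + 1 / 2, (g.1 : ℝ) + 1 / 2, if g.2 then 1 else -1) ∪
      segment ℝ ((x + 1 / 2, (g.1 : ℝ) + 1 / 2, if g.2 then 1 else -1) : Space)
        (x + 1, (g.1 : ℝ) + 1, 0) := if_pos rfl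

theorem letterStrand_of_ne (x : ℝ) {g : ℕ × Bool} {j : ℕ} (h : j ≠ g.1) : letterStrand x g j =
    segment ℝ ((x, (j : ℝ), 0) : Space) (x + 1, (Equiv.swap g.1 (g.1 + 1) j : ℝ), 0) := if_neg h

theorem letterStrand_subset (x : ℝ) (g : ℕ × Bool) (j : ℕ) :
    letterStrand x g j ⊆ Set.Icc x (x + 1) ×ˢ (Set.univ ×ˢ Set.Icc (-1 : ℝ) 1) := by
  rcases eq_or_ne j g.1 with rfl | h
  · rw [letterStrand_self]
    exact Set.subset_union_left.trans ((crossing_subset x g.1 g.2).trans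
      (Set.prod_mono_right (Set.prod_mono_left fun _ _ => trivial)))
  · rw [letterStrand_of_ne x h]
    refine ((convex_Icc _ _).prod (convex_univ.prod (convex_Icc _ _))).segment_subset ?_ ?_ <;>
      norm_num [Set.mem_prod]

theorem snd_eq_of_mem_letterStrand {x : ℝ} {g : ℕ × Bool} {j : ℕ} {p : Space}
    (hp : p ∈ letterStrand x g j) :
    p.2.1 = j + (p.1 - x) * ((Equiv.swap g.1 (g.1 + 1) j : ℝ) - j) := by
  rcases eq_or_ne j g.1 with rfl | h
  · rw [letterStrand_self] at hp
    rw [Equiv.swap_apply_left]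
    rcases hp with ⟨s, t, -, -, hst, rfl⟩ | ⟨s, t, -, -, hst, rfl⟩ <;>
      obtain rfl : s = 1 - t := by linarith
    all_goals
      simp only [Prod.smul_mk, Prod.mk_add_mk, smul_eq_mul]
      push_cast
      ring
  · rw [letterStrand_of_ne x h] at hp
    obtain ⟨s, t, -, -, hst, rfl⟩ := hp
    obtain rfl : s = 1 - t := by linarith
    simp only [Prod.smul_mk, Prod.mk_add_mk, smul_eq_mul]
    ring

theorem height_ne_zero_of_mem_letterStrand {x : ℝ} {g : ℕ × Bool} {p : Space}
    (hp : p ∈ letterStrand x g g.1) (h : p.1 = x + 1 / 2) : p.2.2 ≠ 0 := by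
  have hsign : (if g.2 then 1 else -1 : ℝ) ≠ 0 := by split_ifs <;> norm_num
  rw [letterStrand_self] at hp
  rcases hp with ⟨s, t, -, -, hst, rfl⟩ | ⟨s, t, -, -, hst, rfl⟩ <;>
    obtain rfl : s = 1 - t := by linarith
  all_goals simp only [Prod.smul_mk, Prod.mk_add_mk, smul_eq_mul] at h ⊢
  · obtain rfl : t = 1 := by linarith
    simpa using hsign
  · obtain rfl : t = 0 := by linarith
    simpa using hsign

theorem height_eq_zero_of_mem_letterStrand {x : ℝ} {g : ℕ × Bool} {j : ℕ} (hj : j ≠ g.1)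
    {p : Space} (hp : p ∈ letterStrand x g j) : p.2.2 = 0 := by
  rw [letterStrand_of_ne x hj] at hp
  obtain ⟨s, t, -, -, -, rfl⟩ := hp
  simp

theorem swap_succ_lt_swap_succ {i j k : ℕ} (hjk : j < k) (h : ¬ (j = i ∧ k = i + 1)) :
    Equiv.swap i (i + 1) j < Equiv.swap i (i + 1) k := by
  rw [Equiv.swap_apply_def, Equiv.swap_apply_def]
  split_ifs <;> omega

theorem disjoint_letterStrand (x : ℝ) (g : ℕ × Bool) {j k : ℕ} (hjk : j ≠ k) :
    Disjoint (letterStrand x g j) (letterStrand x g k) := by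
  wlog h : j < k generalizing j k
  · exact (this hjk.symm (by omega)).symm
  refine Set.disjoint_left.2 fun p hj hk => ?_
  have heq := (snd_eq_of_mem_letterStrand hj).symm.trans (snd_eq_of_mem_letterStrand hk)
  by_cases hcross : j = g.1 ∧ k = g.1 + 1
  · obtain ⟨rfl, rfl⟩ := hcross
    rw [Equiv.swap_apply_left, Equiv.swap_apply_right] at heq
    push_cast at heq
    exact height_ne_zero_of_mem_letterStrand hj (by linarith)
      (height_eq_zero_of_mem_letterStrand (Nat.succ_ne_self _) hk)
  · obtain ⟨hx, hx'⟩ := (letterStrand_subset x g j hj).1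
    have hstart : (j : ℝ) < k := by exact_mod_cast h
    have hend : (Equiv.swap g.1 (g.1 + 1) j : ℝ) < Equiv.swap g.1 (g.1 + 1) k := by
      exact_mod_cast swap_succ_lt_swap_succ h hcross
    rcases hx.eq_or_lt with hx | hx
    · rw [hx, sub_self, zero_mul, zero_mul] at heq
      linarith
    · nlinarith [mul_pos (sub_pos.2 hx) (sub_pos.2 hend),
        mul_nonneg (sub_nonneg.2 hx') (sub_pos.2 hstart).le]

theorem strand_subset (x : ℝ) (w : Word) (j : ℕ) :
    strand x w j ⊆ Set.Icc x (x + w.length) ×ˢ (Set.univ ×ˢ Set.Icc (-1 : ℝ) 1) := by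
  induction w generalizing x j with
  | nil => exact Set.empty_subset _
  | cons g w ih =>
    rw [List.length_cons, Nat.cast_add, Nat.cast_one]
    have : (0 : ℝ) ≤ w.length := Nat.cast_nonneg _
    exact Set.union_subset
      ((letterStrand_subset x g j).trans
        (Set.prod_mono_left (Set.Icc_subset_Icc_right (by linarith))))
      ((ih _ _).trans (Set.prod_mono_left (Set.Icc_subset_Icc (by linarith) (by linarith))))

theorem snd_eq_of_mem_strand_left {x : ℝ} {w : Word} {j : ℕ} {p : Space} (hp : p ∈ strand x w j)
    (h : p.1 = x) : p.2.1 = j := by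
  cases w with
  | nil => exact hp.elim
  | cons g w =>
    rcases hp with hp | hp
    · rw [snd_eq_of_mem_letterStrand hp, h]
      ring
    · linarith [(strand_subset _ _ _ hp).1.1]

theorem snd_eq_of_mem_strand_right {x : ℝ} {w : Word} {j : ℕ} {p : Space} (hp : p ∈ strand x w j)
    (h : p.1 = x + w.length) : p.2.1 = perm w j := by
  induction w generalizing x j with
  | nil => exact hp.elim
  | cons g w ih =>
    rw [List.length_cons, Nat.cast_add, Nat.cast_one] at h
    rcases hp with hp | hp
    · have hx := (letterStrand_subset x g j hp).1.2
      have hnonneg : (0 : ℝ) ≤ w.length := Nat.cast_nonneg _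
      have hlength : (w.length : ℝ) = 0 := by linarith
      obtain rfl : w = [] := List.length_eq_zero_iff.1 (by exact_mod_cast hlength)
      rw [snd_eq_of_mem_letterStrand hp, h, hlength, perm_cons_apply]
      simp [perm]
    · exact ih hp (by linarith)

theorem disjoint_strand (x : ℝ) (w : Word) {j k : ℕ} (hjk : j ≠ k) :
    Disjoint (strand x w j) (strand x w k) := by
  induction w generalizing x j k with
  | nil => exact Set.disjoint_empty _
  | cons g w ih =>
    have hlater {j k : ℕ} (hjk : j ≠ k) : Disjoint (letterStrand x g j)
        (strand (x + 1) w (Equiv.swap g.1 (g.1 + 1) k)) := by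
      refine Set.disjoint_left.2 fun p hp hp' => hjk ?_
      have hx : p.1 = x + 1 :=
        le_antisymm (letterStrand_subset _ _ _ hp).1.2 (strand_subset _ _ _ hp').1.1
      have heq := (snd_eq_of_mem_letterStrand hp).symm.trans (snd_eq_of_mem_strand_left hp' hx)
      rw [hx, add_sub_cancel_left, one_mul, add_sub_cancel] at heq
      exact (Equiv.swap g.1 (g.1 + 1)).injective (Nat.cast_injective heq)
    simp only [strand, Set.disjoint_union_left, Set.disjoint_union_right]
    exact ⟨⟨disjoint_letterStrand x g hjk, (hlater hjk.symm).symm⟩, hlater hjk,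
      ih (x + 1) ((Equiv.swap g.1 (g.1 + 1)).injective.ne hjk)⟩

theorem isClosed_segment (p q : Space) : IsClosed (segment ℝ p q) := by
  rw [← convexHull_pair]
  exact (Set.toFinite {p, q}).isClosed_convexHull ℝ

theorem isClosed_strand (x : ℝ) (w : Word) (j : ℕ) : IsClosed (strand x w j) := by
  induction w generalizing x j with
  | nil => exact isClosed_empty
  | cons g w ih =>
    refine IsClosed.union ?_ (ih _ _)
    rcases eq_or_ne j g.1 with rfl | h
    · rw [letterStrand_self]
      exact (isClosed_segment _ _).union (isClosed_segment _ _)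
    · rw [letterStrand_of_ne x h]
      exact isClosed_segment _ _

theorem drawLetter_eq_iUnion {n : ℕ} (x : ℝ) {g : ℕ × Bool} (hg : g.1 + 1 < n) :
    drawLetter n x g = ⋃ j ∈ Set.Iio n, letterStrand x g j := by
  have hother : ⋃ j ∈ others n g.1, letterStrand x g j = strandsOn (others n g.1) x (x + 1) :=
    Set.iUnion₂_congr fun j hj => by
      rw [letterStrand_of_ne x hj.2.1, Equiv.swap_apply_of_ne_of_ne hj.2.1 hj.2.2]
  rw [Iio_eq_others_union hg, Set.biUnion_union, hother, Set.biUnion_pair, letterStrand_self,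
    letterStrand_of_ne x (Nat.succ_ne_self _), Equiv.swap_apply_right, drawLetter, crossing,
    Set.union_comm, Nat.cast_succ]

theorem draw_eq_iUnion {n : ℕ} (x : ℝ) {w : Word} (hw : Valid n w) :
    draw n x w = ⋃ j ∈ Set.Iio n, strand x w j := by
  induction w generalizing x with
  | nil => simp [draw, strand]
  | cons g w ih =>
    obtain ⟨hg, hw⟩ := valid_cons.1 hw
    have hreindex : ⋃ j ∈ Set.Iio n, strand (x + 1) w j =
        ⋃ j ∈ Set.Iio n, strand (x + 1) w (Equiv.swap g.1 (g.1 + 1) j) := by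
      simp only [Set.mem_Iio]
      rw [← (Equiv.swap g.1 (g.1 + 1)).surjective.iUnion_comp]
      simp only [swap_succ_lt_iff hg]
    rw [draw, ih _ hw, drawLetter_eq_iUnion x hg, hreindex]
    simp only [strand, Set.iUnion_union_distrib]

/-- The part of the closure of `w` that belongs to the strands starting in the positions in `J`;
it consists of components if `perm w` preserves `J`. -/
def closurePart (w : Word) (J : Set ℕ) : Set Space :=
  (⋃ j ∈ J, strand 0 w j) ∪ strandsOn J w.length (w.length + 1) ∪ arcsOn J 0 (w.length + 1)

theorem closureSet_eq_closurePart {n : ℕ} {w : Word} (hw : Valid n w) :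
    closureSet n w = closurePart w (Set.Iio n) := by
  rw [closureSet, braidClosure_self, closurePart, draw_eq_iUnion 0 hw, zero_add]

theorem closurePart_union (w : Word) (J J' : Set ℕ) :
    closurePart w (J ∪ J') = closurePart w J ∪ closurePart w J' := by
  simp only [closurePart, strandsOn_union, arcsOn_union, Set.biUnion_union]
  ac_rfl

theorem isClosed_closurePart (w : Word) {J : Set ℕ} (hJ : J.Finite) :
    IsClosed (closurePart w J) :=
  ((hJ.isClosed_biUnion fun _ _ => isClosed_strand _ _ _).union
    (hJ.isClosed_biUnion fun _ _ => isClosed_segment _ _)).union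
    (hJ.isClosed_biUnion fun _ _ => ((isClosed_segment _ _).union (isClosed_segment _ _)).union
      (isClosed_segment _ _))

theorem closurePart_nonempty (w : Word) {J : Set ℕ} (hJ : J.Nonempty) :
    (closurePart w J).Nonempty := by
  obtain ⟨j, hj⟩ := hJ
  exact ⟨(0, j, 0), Or.inr (Set.mem_biUnion hj (Or.inr (right_mem_segment ℝ _ _)))⟩

theorem mem_closurePart_cases {w : Word} {J : Set ℕ} (hJ : Set.MapsTo (perm w) J J) {p : Space}
    (hp : p ∈ closurePart w J) :
    (∃ j ∈ J, p.2.1 = j) ∧ (p.1 ≤ 0 ∨ w.length ≤ p.1 ∨ p.2.2 = -2) ∨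
      0 < p.1 ∧ p.1 < w.length ∧ -1 ≤ p.2.2 ∧ ∃ j ∈ J, p ∈ strand 0 w j := by
  have : (0 : ℝ) ≤ w.length := Nat.cast_nonneg _
  rcases hp with (hp | hp) | hp
  · obtain ⟨j, hj, hp⟩ := Set.mem_iUnion₂.1 hp
    obtain ⟨⟨hx, hx'⟩, -, hz, -⟩ := strand_subset 0 w j hp
    rw [zero_add] at hx'
    rcases hx.eq_or_lt with hx | hx
    · exact Or.inl ⟨⟨j, hj, snd_eq_of_mem_strand_left hp hx.symm⟩, Or.inl hx.ge⟩
    rcases hx'.eq_or_lt with hx' | hx'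
    · exact Or.inl ⟨⟨_, hJ hj, snd_eq_of_mem_strand_right hp (by rw [hx', zero_add])⟩,
        Or.inr (Or.inl hx'.ge)⟩
    · exact Or.inr ⟨hx, hx', hz, j, hj, hp⟩
  · obtain ⟨j, hj, hx, -, h⟩ := (mem_strandsOn (by linarith)).1 hp
    exact Or.inl ⟨⟨j, hj, by rw [h]⟩, Or.inr (Or.inl hx)⟩
  · obtain ⟨hx | hx | hz, hy⟩ := arcsOn_subset J _ _ hp
    exacts [Or.inl ⟨hy, Or.inl hx.le⟩, Or.inl ⟨hy, Or.inr (Or.inl (by linarith))⟩,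
      Or.inl ⟨hy, Or.inr (Or.inr hz)⟩]

theorem disjoint_closurePart {w : Word} {J J' : Set ℕ} (hJ : Set.MapsTo (perm w) J J)
    (hJ' : Set.MapsTo (perm w) J' J') (h : Disjoint J J') :
    Disjoint (closurePart w J) (closurePart w J') := by
  refine Set.disjoint_left.2 fun p hp hp' => ?_
  rcases mem_closurePart_cases hJ hp with ⟨⟨j, hj, hy⟩, hout⟩ | ⟨hx, hx', hz, j, hj, hpj⟩ <;>
    rcases mem_closurePart_cases hJ' hp' with ⟨⟨k, hk, hy'⟩, hout'⟩ | ⟨hx, hx', hz, k, hk, hpk⟩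
  · exact h.ne_of_mem hj hk (Nat.cast_injective (hy.symm.trans hy'))
  · rcases hout with h' | h' | h' <;> linarith
  · rcases hout' with h' | h' | h' <;> linarith
  · exact Set.disjoint_left.1 (disjoint_strand 0 w (h.ne_of_mem hj hk)) hpj hpk

theorem isCycleOn_perm {n : ℕ} {w : Word} (hw : Valid n w)
    (hconn : IsPreconnected (closureSet n w)) : (perm w).IsCycleOn (Set.Iio n) := by
  refine ⟨⟨fun j => (perm_mem_Iio_iff hw j).2, (perm w).injective.injOn, fun j hj =>
    ⟨(perm w).symm j, (perm_mem_Iio_iff hw _).1 (by rwa [Equiv.apply_symm_apply]),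
      Equiv.apply_symm_apply _ _⟩⟩, fun j hj k hk => ?_⟩
  by_contra hjk
  set A := {i ∈ Set.Iio n | (perm w).SameCycle j i}
  set B := {i ∈ Set.Iio n | ¬ (perm w).SameCycle j i}
  have hAB : Set.Iio n = A ∪ B := by
    ext i
    simp only [A, B, Set.mem_union, Set.mem_ofPred_eq]
    tauto
  have hdisjoint : Disjoint (closurePart w A) (closurePart w B) :=
    disjoint_closurePart
      (fun i hi => ⟨(perm_mem_Iio_iff hw i).2 hi.1, Equiv.Perm.sameCycle_apply_right.2 hi.2⟩)
      (fun i hi =>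
        ⟨(perm_mem_Iio_iff hw i).2 hi.1, fun h => hi.2 (Equiv.Perm.sameCycle_apply_right.1 h)⟩)
      (Set.disjoint_left.2 fun i hi hi' => hi'.2 hi.2)
  have hfinite : (Set.Iio n).Finite := Set.finite_Iio n
  rw [closureSet_eq_closurePart hw, hAB, closurePart_union] at hconn
  obtain ⟨p, hp⟩ := closurePart_nonempty w (J := A) ⟨j, hj, Equiv.Perm.SameCycle.refl _ _⟩
  obtain ⟨q, hq⟩ := closurePart_nonempty w (J := B) ⟨k, hk, hjk⟩
  obtain ⟨r, -, hr, hr'⟩ := isPreconnected_closed_iff.1 hconn _ _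
    (isClosed_closurePart w (hfinite.subset (Set.sep_subset _ _)))
    (isClosed_closurePart w (hfinite.subset (Set.sep_subset _ _))) subset_rfl
    ⟨p, Or.inl hp, hp⟩ ⟨q, Or.inr hq, hq⟩
  exact Set.disjoint_left.1 hdisjoint hr hr'

theorem closureSet_zero {w : Word} (hw : Valid 0 w) : closureSet 0 w = ∅ := by
  rw [closureSet_eq_closurePart hw, closurePart, strandsOn, arcsOn]
  simp

theorem IsKnot.isConnected {K : Set Space} (hK : IsKnot K) : IsConnected K := by
  obtain ⟨f, hf, rfl⟩ := hK
  exact isConnected_range hf.continuous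

theorem AmbientIsotopic.isConnected {K K' : Set Space} (h : AmbientIsotopic K K')
    (hK : IsConnected K) : IsConnected K' := by
  obtain ⟨H, -, -, rfl⟩ := h
  exact hK.image _ (H 1).continuous.continuousOn

/-- The generators that occur in a word, with repetitions. -/
def generators (w : Word) : List ℕ := w.map Prod.fst

theorem perm_le_iff {i : ℕ} {w : Word} (hi : i ∉ generators w) (j : ℕ) :
    perm w j ≤ i ↔ j ≤ i := by
  induction w generalizing j with
  | nil => rfl
  | cons g w ih =>
    obtain ⟨hg, hw⟩ := not_or.1 (mt List.mem_cons.2 hi)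
    rw [perm_cons_apply, ih hw, Equiv.swap_apply_def]
    split_ifs <;> omega

theorem mem_generators_of_isCycleOn {n i : ℕ} {w : Word} (h : (perm w).IsCycleOn (Set.Iio n))
    (hi : i + 1 < n) : i ∈ generators w := by
  by_contra hi'
  rw [← Finset.coe_Iio] at h
  obtain ⟨k, -, hk⟩ := h.exists_pow_eq (Finset.mem_Iio.2 (Nat.lt_of_succ_lt hi))
    (Finset.mem_Iio.2 hi)
  have hmaps : Set.MapsTo (perm w) (Set.Iic i) (Set.Iic i) := fun j => (perm_le_iff hi' j).2
  have hle : (perm w ^ k) i ≤ i := by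
    rw [Equiv.Perm.coe_pow]
    exact hmaps.iterate k Set.self_mem_Iic
  omega

theorem sign_subtypePerm {n : ℕ} {w : Word} (hw : Valid n w) :
    Equiv.Perm.sign ((perm w).subtypePerm (perm_mem_Iio_iff hw)) =
      (-1) ^ w.length := by
  induction w with
  | nil => exact Equiv.Perm.sign_one
  | cons g w ih =>
    obtain ⟨hg, hw'⟩ := valid_cons.1 hw
    have hmul : (perm (g :: w)).subtypePerm (perm_mem_Iio_iff hw) =
        (perm w).subtypePerm (perm_mem_Iio_iff hw') *
          Equiv.swap ⟨g.1, Set.mem_Iio.2 (Nat.lt_of_succ_lt hg)⟩ ⟨g.1 + 1, Set.mem_Iio.2 hg⟩ := by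
      ext ⟨j, hj⟩
      refine congrArg (perm w) ?_
      simp only [Equiv.swap_apply_def, Subtype.mk.injEq]
      split_ifs <;> rfl
    rw [hmul, map_mul, ih hw',
      Equiv.Perm.sign_swap (Subtype.coe_ne_coe.1 (Nat.succ_ne_self _).symm), List.length_cons,
      pow_succ]

theorem eq_nil_of_valid_one {w : Word} (hw : Valid 1 w) : w = [] :=
  List.eq_nil_iff_forall_not_mem.2 fun g hg => absurd (hw g hg) (by omega)

theorem odd_length_add {n : ℕ} (hn : 1 ≤ n) {w : Word} (hw : Valid n w)
    (h : (perm w).IsCycleOn (Set.Iio n)) : Odd (w.length + n) := by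
  rcases hn.eq_or_lt with rfl | hn
  · rw [eq_nil_of_valid_one hw]
    exact odd_one
  have hnontrivial : (Set.Iio n).Nontrivial :=
    ⟨0, Set.mem_Iio.2 (by omega), 1, hn, zero_ne_one⟩
  have hsupport : ((perm w).subtypePerm (perm_mem_Iio_iff hw)).support = Finset.univ :=
    Finset.eq_univ_of_forall fun j => Equiv.Perm.mem_support.2 fun heq =>
      h.apply_ne hnontrivial j.2 (congrArg Subtype.val heq)
  have hsign := (h.isCycle_subtypePerm hnontrivial).sign
  rw [hsupport, Finset.card_univ, Fintype.card_Iio, Nat.card_Iio] at hsign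
  have hpow : (-1 : ℤˣ) ^ (w.length + n) = -1 := by
    rw [pow_add, ← sign_subtypePerm hw, hsign, neg_mul, ← mul_pow]
    simp
  by_contra heven
  rw [(Nat.not_odd_iff_even.1 heven).neg_one_pow] at hpow
  exact absurd hpow (by decide)

theorem exists_rotation {n i : ℕ} {w : Word} (hw : Valid n w) (hi : i ∈ generators w) :
    ∃ (u : Word) (e : Bool), (u ++ [(i, e)]).Perm w ∧
      AmbientIsotopic (closureSet n w) (closureSet n (u ++ [(i, e)])) := by
  obtain ⟨⟨i, e⟩, hg, rfl⟩ := List.mem_map.1 hi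
  obtain ⟨a, b, rfl⟩ := List.append_of_mem hg
  refine ⟨b ++ a, e, ?_⟩
  rw [List.append_cons] at hw
  obtain ⟨ha, hb⟩ := valid_append.1 hw
  rw [List.append_cons a, List.append_assoc b]
  exact ⟨List.perm_append_comm, closureSet_rotate ha hb⟩

theorem valid_of_notMem {m : ℕ} {w : Word} (hw : Valid (m + 2) w) (h : m ∉ generators w) :
    Valid (m + 1) w := by
  intro g hg
  have hne : g.1 ≠ m := fun e => h (e ▸ List.mem_map_of_mem hg)
  have := hw g hg
  omega

/-! ### Words on few strands -/

/-- Exchanging the words `p` and `q` inside a word on `n` strands does not change its closure. -/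
def Interchangeable (n : ℕ) (p q : Word) : Prop :=
  ∀ u v, Valid n u → Valid n v →
    AmbientIsotopic (closureSet n (u ++ p ++ v)) (closureSet n (u ++ q ++ v))

namespace Interchangeable

variable {n : ℕ} {p q r : Word}

theorem refl (p : Word) : Interchangeable n p p := fun _ _ _ _ => .refl _

theorem symm (h : Interchangeable n p q) : Interchangeable n q p :=
  fun u v hu hv => (h u v hu hv).symm

theorem trans (h : Interchangeable n p q) (h' : Interchangeable n q r) : Interchangeable n p r :=
  fun u v hu hv => (h u v hu hv).trans (h' u v hu hv)

theorem append_left (h : Interchangeable n p q) {a : Word} (ha : Valid n a) :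
    Interchangeable n (a ++ p) (a ++ q) := fun u v hu hv => by
  simpa only [List.append_assoc] using h (u ++ a) v (valid_append.2 ⟨hu, ha⟩) hv

theorem append_right (h : Interchangeable n p q) {b : Word} (hb : Valid n b) :
    Interchangeable n (p ++ b) (q ++ b) := fun u v hu hv => by
  simpa only [List.append_assoc] using h u (b ++ v) hu (valid_append.2 ⟨hb, hv⟩)

theorem ambientIsotopic (h : Interchangeable n p q) :
    AmbientIsotopic (closureSet n p) (closureSet n q) := by
  simpa only [List.nil_append, List.append_nil] using h [] [] (valid_nil n) (valid_nil n)

end Interchangeable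

/-- The inverse of a word in the braid group. -/
def inverse (w : Word) : Word := (w.map fun g => (g.1, !g.2)).reverse

theorem inverse_inverse (w : Word) : inverse (inverse w) = w := by
  simp [inverse, Function.comp_def]

theorem Valid.inverse {n : ℕ} {w : Word} (hw : Valid n w) : Valid n (inverse w) := by
  intro g hg
  obtain ⟨k, hk, rfl⟩ := List.mem_map.1 (List.mem_reverse.1 hg)
  exact hw k hk

theorem interchangeable_append_inverse {n : ℕ} {w : Word} (hw : Valid n w) :
    Interchangeable n (w ++ inverse w) [] := by
  induction w with
  | nil => exact .refl _
  | cons g w ih =>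
    obtain ⟨hg, hw⟩ := valid_cons.1 hw
    have hmiddle := ((ih hw).append_left (valid_singleton.2 hg)).append_right
      (b := [(g.1, !g.2)]) (valid_singleton.2 hg)
    have hcancel : Interchangeable n [g, (g.1, !g.2)] [] := fun u v hu hv => by
      simpa using closureSet_cancel hu hv hg g.2
    simpa [inverse] using hmiddle.trans hcancel

theorem interchangeable_inverse_append {n : ℕ} {w : Word} (hw : Valid n w) :
    Interchangeable n (inverse w ++ w) [] := by
  simpa only [inverse_inverse] using interchangeable_append_inverse hw.inverse

theorem Interchangeable.transpose {n : ℕ} {a b p q : Word} (ha : Valid n a) (hb : Valid n b)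
    (hp : Valid n p) (hq : Valid n q) (h : Interchangeable n (a ++ p) (q ++ b)) :
    Interchangeable n (inverse q ++ a) (b ++ inverse p) := by
  have hcreate := (interchangeable_append_inverse hp).append_left (valid_append.2 ⟨hq.inverse, ha⟩)
  have hexchange := (h.append_left hq.inverse).append_right hp.inverse
  have hcancel := (interchangeable_inverse_append hq).append_right
    (valid_append.2 ⟨hb, hp.inverse⟩)
  simp only [List.append_assoc, List.append_nil, List.nil_append] at hcreate hexchange hcancel
  exact hcreate.symm.trans (hexchange.trans hcancel)

theorem interchangeable_braid {n i : ℕ} (hi : i + 2 < n) (e : Bool) :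
    Interchangeable n [(i, e), (i + 1, e), (i, e)] [(i + 1, e), (i, e), (i + 1, e)] := by
  have hpos : Interchangeable n [(i, true), (i + 1, true), (i, true)]
      [(i + 1, true), (i, true), (i + 1, true)] := fun u v hu hv => closureSet_braid hu hv hi
  cases e with
  | true => exact hpos
  | false =>
    have hi' : i + 1 < n := Nat.lt_of_succ_lt hi
    exact (Interchangeable.transpose (a := []) (b := [])
      (p := [(i, true), (i + 1, true), (i, true)]) (q := [(i + 1, true), (i, true), (i + 1, true)])
      (valid_nil n) (valid_nil n) (valid_cons.2 ⟨hi', valid_cons.2 ⟨hi, valid_singleton.2 hi'⟩⟩)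
      (valid_cons.2 ⟨hi, valid_cons.2 ⟨hi', valid_singleton.2 hi⟩⟩) hpos).symm

theorem interchangeable_mixed {n i : ℕ} (hi : i + 2 < n) (e : Bool) :
    Interchangeable n [(i, e), (i + 1, e), (i, !e)] [(i + 1, !e), (i, e), (i + 1, e)] :=
  have hi' : i + 1 < n := Nat.lt_of_succ_lt hi
  (Interchangeable.transpose (a := [(i, e), (i + 1, e)]) (b := [(i, e), (i + 1, e)])
    (valid_cons.2 ⟨hi', valid_singleton.2 hi⟩) (valid_cons.2 ⟨hi', valid_singleton.2 hi⟩)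
    (valid_singleton.2 hi') (valid_singleton.2 hi) (interchangeable_braid hi e)).symm

/-- `S` is trivial, a trefoil, or the figure-eight knot: these turn out to be the knots that are
closures of a braid with at most one crossing more than strands. -/
def IsSmall (S : Set Space) : Prop := IsTrivial S ∨ IsTrefoil S ∨ IsFigureEight S

theorem IsSmall.of_ambientIsotopic {S T : Set Space} (h : AmbientIsotopic S T) (hT : IsSmall T) :
    IsSmall S := by
  rcases hT with hT | ⟨e, hT⟩ | hT
  exacts [Or.inl (h.trans hT), Or.inr (Or.inl ⟨e, h.trans hT⟩), Or.inr (Or.inr (h.trans hT))]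

theorem isTrivial_two_strands (a : Bool) : IsTrivial (closureSet 2 [(0, a)]) :=
  (closureSet_destabilize (m := 0) (valid_nil 1) a).trans closureSet_one

theorem isSmall_two_strands (a b c : Bool) : IsSmall (closureSet 2 [(0, a), (0, b), (0, c)]) := by
  have hletter (e : Bool) : Valid 2 [(0, e)] := valid_singleton.2 one_lt_two
  rcases Bool.eq_or_eq_not b a with rfl | rfl
  · rcases Bool.eq_or_eq_not c b with rfl | rfl
    · refine Or.inr (Or.inl ⟨c, ?_⟩)
      rw [closedBraid_eq_closureSet]
      exact .refl _
    · exact .of_ambientIsotopic (closureSet_cancel (hletter b) (valid_nil 2) one_lt_two b)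
        (Or.inl (isTrivial_two_strands b))
  · exact .of_ambientIsotopic (closureSet_cancel (valid_nil 2) (hletter c) one_lt_two a)
      (Or.inl (isTrivial_two_strands c))

theorem isTrivial_three_strands (a b : Bool) : IsTrivial (closureSet 3 [(0, a), (1, b)]) :=
  (closureSet_destabilize (m := 1) (w := [(0, a)]) (valid_singleton.2 one_lt_two) b).trans
    (isTrivial_two_strands a)

theorem isTrivial_three_strands' (a b : Bool) : IsTrivial (closureSet 3 [(1, a), (0, b)]) :=
  (closureSet_rotate (u := [(1, a)]) (valid_singleton.2 (by norm_num))
    (valid_singleton.2 (by norm_num))).trans (isTrivial_three_strands b a)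

section ThreeStrands

variable {a b c d : Bool}

theorem valid_three {w : Word} (h : ∀ g ∈ w, g.1 < 2) : Valid 3 w :=
  fun g hg => Nat.succ_lt_succ (h g hg)

theorem isSmall_three_strands_rotate
    (h : IsSmall (closureSet 3 [(0, c), (1, d), (0, a), (1, b)])) :
    IsSmall (closureSet 3 [(0, a), (1, b), (0, c), (1, d)]) :=
  h.of_ambientIsotopic (closureSet_rotate (u := [(0, a), (1, b)]) (v := [(0, c), (1, d)])
    (valid_three (by simp)) (valid_three (by simp)))

theorem isSmall_three_strands_flip
    (h : IsSmall (closureSet 3 [(0, d), (1, c), (0, b), (1, a)])) :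
    IsSmall (closureSet 3 [(0, a), (1, b), (0, c), (1, d)]) :=
  h.of_ambientIsotopic (closureSet_flip (valid_three (by simp)))

theorem isSmall_three_strands_four (e : Bool) :
    IsSmall (closureSet 3 [(0, e), (1, e), (0, e), (1, e)]) := by
  have hbraid := ((interchangeable_braid (n := 3) (i := 0) (by norm_num) e).symm.append_left
    (a := [(0, e)]) (valid_three (by simp))).ambientIsotopic
  have hrotate := closureSet_rotate (n := 3) (u := [(0, e), (0, e), (1, e)]) (v := [(0, e)])
    (valid_three (by simp)) (valid_three (by simp))
  have hdestabilize := closureSet_destabilize (m := 1) (w := [(0, e), (0, e), (0, e)])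
    (by simp [valid_cons, valid_nil]) e
  exact (isSmall_two_strands e e e).of_ambientIsotopic
    (hbraid.trans (hrotate.trans hdestabilize))

theorem isSmall_three_strands_three (e : Bool) :
    IsSmall (closureSet 3 [(0, e), (1, e), (0, e), (1, !e)]) := by
  have hbraid := ((interchangeable_braid (n := 3) (i := 0) (by norm_num) e).append_right
    (b := [(1, !e)]) (valid_three (by simp))).ambientIsotopic
  have hcancel := closureSet_cancel (n := 3) (u := [(1, e), (0, e)]) (v := []) (i := 1)
    (valid_three (by simp)) (valid_nil 3) (by norm_num) e
  exact Or.inl (hbraid.trans (hcancel.trans (isTrivial_three_strands' e e)))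

theorem isSmall_three_strands_adjacent (e : Bool) :
    IsSmall (closureSet 3 [(0, e), (1, e), (0, !e), (1, !e)]) := by
  have hmixed := ((interchangeable_mixed (n := 3) (i := 0) (by norm_num) e).append_right
    (b := [(1, !e)]) (valid_three (by simp))).ambientIsotopic
  have hcancel := closureSet_cancel (n := 3) (u := [(1, !e), (0, e)]) (v := []) (i := 1)
    (valid_three (by simp)) (valid_nil 3) (by norm_num) e
  exact Or.inl (hmixed.trans (hcancel.trans (isTrivial_three_strands' (!e) e)))

theorem isSmall_three_strands_outer (e : Bool) :
    IsSmall (closureSet 3 [(0, e), (1, !e), (0, !e), (1, e)]) := by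
  have hmixed := ((Interchangeable.transpose (a := [(1, !e), (0, !e)]) (b := [(1, !e), (0, !e)])
    (p := [(1, !e)]) (q := [(0, !e)]) (valid_three (by simp)) (valid_three (by simp))
    (valid_three (by simp)) (valid_three (by simp))
    (interchangeable_braid (by norm_num) (!e)).symm).symm.append_left
      (a := [(0, e)]) (valid_three (by simp))).ambientIsotopic
  simp only [inverse, List.map_cons, List.map_nil, List.reverse_singleton, Bool.not_not] at hmixed
  have hrotate := closureSet_rotate (n := 3) (u := [(0, e), (0, e), (1, !e)]) (v := [(0, !e)])
    (valid_three (by simp)) (valid_three (by simp))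
  have hcancel := closureSet_cancel (n := 3) (u := []) (v := [(0, e), (1, !e)]) (i := 0)
    (valid_nil 3) (valid_three (by simp)) (by norm_num) (!e)
  rw [Bool.not_not] at hcancel
  exact Or.inl (hmixed.trans (hrotate.trans (hcancel.trans (isTrivial_three_strands e !e))))

theorem isSmall_three_strands_alternating (e : Bool) :
    IsSmall (closureSet 3 [(0, e), (1, !e), (0, e), (1, !e)]) := by
  have hfigureEight : IsSmall (closureSet 3 [(0, true), (1, false), (0, true), (1, false)]) := by
    refine Or.inr (Or.inr ?_)
    rw [IsFigureEight, closedBraid_eq_closureSet]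
    exact .refl _
  cases e with
  | true => exact hfigureEight
  | false => exact isSmall_three_strands_flip hfigureEight

theorem isSmall_three_strands (a b c d : Bool) :
    IsSmall (closureSet 3 [(0, a), (1, b), (0, c), (1, d)]) := by
  have four := isSmall_three_strands_four
  have three := isSmall_three_strands_three
  have adjacent := isSmall_three_strands_adjacent
  have outer := isSmall_three_strands_outer
  have alternating := isSmall_three_strands_alternating
  cases a <;> cases b <;> cases c <;> cases d
  exacts [four false, three false,
    isSmall_three_strands_rotate (isSmall_three_strands_flip (three false)), adjacent false,
    isSmall_three_strands_rotate (three false), alternating false, outer false,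
    isSmall_three_strands_flip (three true), isSmall_three_strands_flip (three false), outer true,
    alternating true, isSmall_three_strands_rotate (three true), adjacent true,
    isSmall_three_strands_rotate (isSmall_three_strands_flip (three true)), three true, four true]

end ThreeStrands

theorem sum_count_generators {m : ℕ} {w : Word} (hw : Valid (m + 1) w) :
    ∑ i ∈ Finset.range m, (generators w).count i = w.length := by
  have hrange : ∀ i ∈ (generators w : Multiset ℕ), i ∈ Finset.range m := by
    intro i hi
    obtain ⟨g, hg, rfl⟩ := List.mem_map.1 (Multiset.mem_coe.1 hi)
    exact Finset.mem_range.2 (Nat.lt_of_succ_lt_succ (hw g hg))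
  simpa [generators] using Multiset.sum_count_eq_card hrange

theorem one_le_count {n : ℕ} {w : Word} (h : (perm w).IsCycleOn (Set.Iio n)) {i : ℕ}
    (hi : i + 1 < n) : 1 ≤ (generators w).count i :=
  List.count_pos_iff.2 (mem_generators_of_isCycleOn h hi)

theorem le_sum_range {m : ℕ} {f : ℕ → ℕ} (h : ∀ i < m, 1 ≤ f i) :
    m ≤ ∑ i ∈ Finset.range m, f i := by
  simpa using (Finset.range m).card_nsmul_le_sum f 1 fun i hi => h i (Finset.mem_range.1 hi)

theorem eq_one_of_sum_range_eq {m : ℕ} {f : ℕ → ℕ} (h : ∀ i < m + 1, 1 ≤ f i)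
    (hsum : ∑ i ∈ Finset.range (m + 1), f i = m + 1) : f m = 1 := by
  have hlast := h m m.lt_succ_self
  have hinit := le_sum_range fun i (hi : i < m) => h i (Nat.lt_succ_of_lt hi)
  rw [Finset.sum_range_succ] at hsum
  omega

theorem eq_two_and_eq_one_of_sum_range_eq {m : ℕ} {f : ℕ → ℕ} (h : ∀ i < m + 3, 1 ≤ f i)
    (hsum : ∑ i ∈ Finset.range (m + 3), f i = m + 5) (hfirst : f 0 ≠ 1) (hlast : f (m + 2) ≠ 1) :
    f 0 = 2 ∧ f 1 = 1 := by
  have hmiddle := le_sum_range (f := fun i => f (i + 2)) fun i (hi : i < m) => h (i + 2) (by omega)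
  have hzero := h 0 (by omega)
  have hone := h 1 (by omega)
  have htop := h (m + 2) (by omega)
  rw [Finset.sum_range_succ, Finset.sum_range_succ', Finset.sum_range_succ'] at hsum
  simp only [zero_add, add_assoc, Nat.reduceAdd] at hsum
  omega

theorem le_length {m : ℕ} {w : Word} (hw : Valid (m + 1) w)
    (h : (perm w).IsCycleOn (Set.Iio (m + 1))) : m ≤ w.length :=
  (le_sum_range fun _ hi => one_le_count h (Nat.succ_lt_succ hi)).trans_eq
    (sum_count_generators hw)

theorem perm_append (u v : Word) (j : ℕ) : perm (u ++ v) j = perm v (perm u j) := by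
  induction u generalizing j with
  | nil => rfl
  | cons g u ih => rw [List.cons_append, perm_cons_apply, perm_cons_apply, ih]

theorem perm_eq_mod_two {w : Word} (h : 1 ∉ generators w) {j : ℕ} (hj : j < 2) :
    perm w j = (j + (generators w).count 0) % 2 := by
  induction w generalizing j with
  | nil => exact (Nat.mod_eq_of_lt hj).symm
  | cons g w ih =>
    obtain ⟨hg, hw⟩ := not_or.1 (mt List.mem_cons.2 h)
    rw [perm_cons_apply]
    rcases Nat.eq_zero_or_pos g.1 with h0 | hpos
    · have hcount : (generators (g :: w)).count 0 = (generators w).count 0 + 1 := by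
        simp [generators, h0]
      rw [hcount, h0]
      rcases (by omega : j = 0 ∨ j = 1) with rfl | rfl
      · rw [Equiv.swap_apply_left, ih hw (by omega)]
        omega
      · rw [Equiv.swap_apply_right, ih hw (by omega)]
        omega
    · have hcount : (generators (g :: w)).count 0 = (generators w).count 0 :=
        List.count_cons_of_ne hpos.ne'
      rw [Equiv.swap_apply_of_ne_of_ne (by omega) (by omega), ih hw hj, hcount]

theorem perm_zero_ne {n : ℕ} (hn : 2 ≤ n) {w : Word} (h : (perm w).IsCycleOn (Set.Iio n)) :
    perm w 0 ≠ 0 :=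
  h.apply_ne ⟨0, Set.mem_Iio.2 (by omega), 1, hn, zero_ne_one⟩ (Set.mem_Iio.2 (by omega))

theorem not_isConnected_of_count {n : ℕ} (hn : 2 ≤ n) {w : Word} (hw : Valid n w)
    (h0 : (generators w).count 0 = 2) (h1 : (generators w).count 1 = 1) :
    ¬ IsConnected (closureSet n w) := by
  intro hconn
  obtain ⟨u, e, hperm, hiso⟩ := exists_rotation hw (i := 1) (List.count_pos_iff.1 (by omega))
  have hvalid : Valid n (u ++ [(1, e)]) := fun g hg => hw g (hperm.mem_iff.1 hg)
  have hcycle := isCycleOn_perm hvalid (hiso.isConnected hconn).isPreconnected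
  have hcount := fun i => (hperm.map Prod.fst).count_eq i
  rw [generators, ← hcount] at h0 h1
  have h0' : (generators u).count 0 = 2 := by simpa [generators] using h0
  have h1' : (generators u).count 1 = 0 := by simpa [generators] using h1
  refine perm_zero_ne hn hcycle ?_
  rw [perm_append, perm_eq_mod_two (List.count_eq_zero.1 h1') two_pos, h0', perm_cons_apply]
  exact Equiv.swap_apply_of_ne_of_ne (a := 1) (b := 2) (x := 0) (by norm_num) (by norm_num)

theorem exists_destabilization {m : ℕ} {w : Word} (hw : Valid (m + 2) w)
    (h : (generators w).count m = 1) : ∃ u, Valid (m + 1) u ∧ u.length + 1 = w.length ∧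
      AmbientIsotopic (closureSet (m + 2) w) (closureSet (m + 1) u) := by
  obtain ⟨u, e, hperm, hiso⟩ := exists_rotation hw (i := m) (List.count_pos_iff.1 (by omega))
  have hu : Valid (m + 2) u := fun g hg => hw g (hperm.mem_iff.1 (List.mem_append_left _ hg))
  rw [generators, ← (hperm.map Prod.fst).count_eq m] at h
  have hzero : (generators u).count m = 0 := by simpa [generators] using h
  have hu' := valid_of_notMem hu (List.count_eq_zero.1 hzero)
  exact ⟨u, hu', by simpa using hperm.length_eq, hiso.trans (closureSet_destabilize hu' e)⟩

theorem count_flipWord {m : ℕ} {w : Word} (hw : Valid (m + 2) w) :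
    (generators (flipWord (m + 2) w)).count m = (generators w).count 0 := by
  have hflip : generators (flipWord (m + 2) w) = ((generators w).map (m - ·)).reverse := by
    simp [generators, flipWord, Function.comp_def]
  rw [hflip, List.count_reverse]
  have hle : ∀ i ∈ generators w, i ≤ m := by
    intro i hi
    obtain ⟨g, hg, rfl⟩ := List.mem_map.1 hi
    exact Nat.le_of_succ_le_succ (Nat.le_of_succ_le_succ (hw g hg))
  rw [List.count, List.countP_map, List.count]
  refine List.countP_congr fun i hi => ?_
  have := hle i hi
  simp only [Function.comp_apply, beq_iff_eq]
  omega

theorem isTrivial_of_length {m : ℕ} {w : Word} (hw : Valid (m + 1) w)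
    (hconn : IsConnected (closureSet (m + 1) w)) (hlength : w.length = m) :
    IsTrivial (closureSet (m + 1) w) := by
  induction m generalizing w with
  | zero =>
    rw [List.length_eq_zero_iff.1 hlength]
    exact closureSet_one
  | succ m ih =>
    have hcycle := isCycleOn_perm hw hconn.isPreconnected
    have hcount : (generators w).count m = 1 :=
      eq_one_of_sum_range_eq (f := fun i => (generators w).count i)
        (fun i hi => one_le_count hcycle (Nat.succ_lt_succ hi))
        ((sum_count_generators hw).trans hlength)
    obtain ⟨u, hu, hlen, hiso⟩ := exists_destabilization hw hcount
    exact hiso.trans (ih hu (hiso.isConnected hconn) (by omega))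

theorem exists_eq_of_length_three {w : Word} (hw : Valid 2 w) (hl : w.length = 3) :
    ∃ a b c, w = [(0, a), (0, b), (0, c)] := by
  have hletter (g : ℕ × Bool) (hg : g ∈ w) : g = (0, g.2) :=
    Prod.ext (by have := hw g hg; simp only; omega) rfl
  obtain ⟨g, h, k, rfl⟩ := List.length_eq_three.1 hl
  exact ⟨g.2, h.2, k.2, by
    rw [← hletter g (by simp), ← hletter h (by simp), ← hletter k (by simp)]⟩

theorem isSmall_of_length_four {w : Word} (hw : Valid 3 w) (hl : w.length = 4)
    (hcycle : (perm w).IsCycleOn (Set.Iio 3)) (hcount : (generators w).count 0 = 2) :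
    IsSmall (closureSet 3 w) := by
  obtain ⟨⟨i, a⟩, ⟨j, b⟩, ⟨k, c⟩, ⟨l, d⟩, rfl⟩ := List.length_eq_four.1 hl
  have hgen (g : ℕ × Bool) (hg : g ∈ [(i, a), (j, b), (k, c), (l, d)]) : g.1 = 0 ∨ g.1 = 1 := by
    have := hw g hg
    omega
  have hmoved := perm_zero_ne (by norm_num) hcycle
  simp only [perm_cons_apply] at hmoved
  simp only [generators, List.map_cons, List.map_nil] at hcount
  obtain rfl | rfl := hgen (i, a) (by simp) <;> obtain rfl | rfl := hgen (j, b) (by simp) <;>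
    obtain rfl | rfl := hgen (k, c) (by simp) <;> obtain rfl | rfl := hgen (l, d) (by simp) <;>
    first
    | exact absurd hcount (by decide)
    | exact absurd (by decide) hmoved
    | exact isSmall_three_strands a b c d
    | exact (isSmall_three_strands d a b c).of_ambientIsotopic
        (closureSet_rotate (u := [(1, a), (0, b), (1, c)]) (v := [(0, d)]) (valid_three (by simp))
          (valid_three (by simp)))

theorem isSmall_of_length {m : ℕ} {w : Word} (hw : Valid (m + 1) w)
    (hconn : IsConnected (closureSet (m + 1) w)) (hlength : w.length = m + 2) :
    IsSmall (closureSet (m + 1) w) := by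
  induction m generalizing w with
  | zero => simp [eq_nil_of_valid_one hw] at hlength
  | succ m ih =>
    have of_count_eq_one {v : Word} (hv : Valid (m + 2) v) (hlen : v.length = w.length)
        (hconn : IsConnected (closureSet (m + 2) v)) (hcount : (generators v).count m = 1) :
        IsSmall (closureSet (m + 2) v) := by
      obtain ⟨u, hu, hlen', hiso⟩ := exists_destabilization hv hcount
      exact (ih hu (hiso.isConnected hconn) (by omega)).of_ambientIsotopic hiso
    by_cases hlast : (generators w).count m = 1
    · exact of_count_eq_one hw rfl hconn hlast
    by_cases hfirst : (generators w).count 0 = 1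
    · have hflip := closureSet_flip hw
      exact (of_count_eq_one hw.flipWord (length_flipWord _ w) (hflip.isConnected hconn)
        ((count_flipWord hw).trans hfirst)).of_ambientIsotopic hflip
    have hcycle := isCycleOn_perm hw hconn.isPreconnected
    have hpos : ∀ i < m + 1, 1 ≤ (generators w).count i := fun i hi =>
      one_le_count hcycle (Nat.succ_lt_succ hi)
    have hsum := (sum_count_generators hw).trans hlength
    match m with
    | 0 =>
      obtain ⟨a, b, c, rfl⟩ := exists_eq_of_length_three hw hlength
      exact isSmall_two_strands a b c
    | 1 =>
      simp only [Finset.sum_range_succ, Finset.sum_range_zero] at hsum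
      have h0 := hpos 0 two_pos
      have h1 := hpos 1 one_lt_two
      exact isSmall_of_length_four hw hlength hcycle (by omega)
    | m + 2 =>
      obtain ⟨h0, h1⟩ := eq_two_and_eq_one_of_sum_range_eq hpos hsum hfirst hlast
      exact absurd hconn (not_isConnected_of_count (by omega) hw h0 h1)

/-! ### The reduced length -/

theorem exists_braidWord {n : ℕ} {w : Word} (hw : Valid n w) :
    ∃ w' : BraidWord n, w'.map natLetter = w := by
  induction w with
  | nil => exact ⟨[], rfl⟩
  | cons g w ih =>
    obtain ⟨hg, hw⟩ := valid_cons.1 hw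
    obtain ⟨w', rfl⟩ := ih hw
    exact ⟨(⟨g.1, Nat.lt_sub_of_add_lt hg⟩, g.2) :: w', rfl⟩

theorem exists_represents_iff {n l : ℕ} {K : Set Space} :
    (∃ w : BraidWord n, w.length = l ∧ Represents w K) ↔
      ∃ w, Valid n w ∧ w.length = l ∧ AmbientIsotopic (closureSet n w) K := by
  constructor
  · rintro ⟨w, rfl, hw⟩
    rw [Represents, closedBraid_eq_closureSet] at hw
    exact ⟨_, valid_map_natLetter w, List.length_map _, hw⟩
  · rintro ⟨w, hvalid, rfl, hw⟩
    obtain ⟨w', rfl⟩ := exists_braidWord hvalid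
    exact ⟨w', (List.length_map _).symm, by rwa [Represents, closedBraid_eq_closureSet]⟩

theorem pos_of_isConnected {n : ℕ} {w : Word} (hw : Valid n w)
    (hconn : IsConnected (closureSet n w)) : 0 < n := by
  refine Nat.pos_of_ne_zero ?_
  rintro rfl
  exact hconn.nonempty.ne_empty (closureSet_zero hw)

theorem length_of_isKnot {n : ℕ} {K : Set Space} (hK : IsKnot K) (hnontrivial : ¬ IsTrivial K)
    {w : Word} (hw : Valid n w) (h : AmbientIsotopic (closureSet n w) K) :
    w.length = n + 1 ∧ (IsTrefoil K ∨ IsFigureEight K) ∨ n + 3 ≤ w.length := by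
  have hconn := h.symm.isConnected hK.isConnected
  obtain ⟨m, rfl⟩ := Nat.exists_eq_add_one.2 (pos_of_isConnected hw hconn)
  have hcycle := isCycleOn_perm hw hconn.isPreconnected
  have hle := le_length hw hcycle
  have hne : w.length ≠ m := fun hlength =>
    hnontrivial (h.symm.trans (isTrivial_of_length hw hconn hlength))
  obtain ⟨k, hk⟩ := odd_length_add (by omega) hw hcycle
  by_cases hlength : w.length = m + 2
  · exact Or.inl ⟨hlength,
      ((isSmall_of_length hw hconn hlength).of_ambientIsotopic h.symm).resolve_left hnontrivial⟩
  · right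
    omega

theorem exists_stabilization {m k : ℕ} (hmk : m ≤ k) {w : Word} (hw : Valid (m + 1) w) :
    ∃ w', Valid (k + 1) w' ∧ AmbientIsotopic (closureSet (k + 1) w') (closureSet (m + 1) w) := by
  induction k, hmk using Nat.le_induction with
  | base => exact ⟨w, hw, .refl _⟩
  | succ k _ ih =>
    obtain ⟨w', hw', hiso⟩ := ih
    have hvalid : Valid (k + 2) (w' ++ [(k, true)]) :=
      valid_append.2 ⟨fun g hg => (hw' g hg).trans (Nat.lt_succ_self _),
        valid_singleton.2 (Nat.lt_succ_self _)⟩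
    exact ⟨_, hvalid, (closureSet_destabilize hw' true).trans hiso⟩

theorem exists_represents_of_braidIndex_le {n : ℕ} {K : Set Space} (h : braidIndex K ≤ n) :
    ∃ m ≤ n, ∃ w : BraidWord m, Represents w K := by
  by_contra! hfew
  have hle : ((n + 1 : ℕ) : ℕ∞) ≤ braidIndex K := le_iInf₂ fun m ⟨w, hw⟩ =>
    Nat.cast_le.2 (Nat.succ_le_of_lt (lt_of_not_ge fun hm => hfew m hm w hw))
  exact absurd (Nat.cast_le.1 (hle.trans h)) (Nat.not_succ_le_self n)

theorem exists_word_of_braidIndex_le {n : ℕ} {K : Set Space} (hK : IsKnot K)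
    (h : braidIndex K ≤ n) : ∃ w, Valid n w ∧ AmbientIsotopic (closureSet n w) K := by
  obtain ⟨m, hmn, w, hw⟩ := exists_represents_of_braidIndex_le h
  obtain ⟨v, hv, -, hiso⟩ := exists_represents_iff.1 ⟨w, rfl, hw⟩
  have hpos := pos_of_isConnected hv (hiso.symm.isConnected hK.isConnected)
  obtain ⟨m, rfl⟩ := Nat.exists_eq_add_one.2 hpos
  obtain ⟨n, rfl⟩ := Nat.exists_eq_add_one.2 (hpos.trans_le hmn)
  obtain ⟨v', hv', hiso'⟩ := exists_stabilization (Nat.le_of_succ_le_succ hmn) hv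
  exact ⟨v', hv', hiso'.trans hiso⟩

theorem exists_word_length_eq_minLength {n : ℕ} {K : Set Space} (hK : IsKnot K)
    (h : braidIndex K ≤ n) :
    ∃ w, Valid n w ∧ w.length = minLength n K ∧ AmbientIsotopic (closureSet n w) K := by
  obtain ⟨w, hw, hiso⟩ := exists_word_of_braidIndex_le hK h
  have hne : {l : ℕ | ∃ w : BraidWord n, w.length = l ∧ Represents w K}.Nonempty :=
    ⟨w.length, exists_represents_iff.2 ⟨w, hw, rfl, hiso⟩⟩
  exact exists_represents_iff.1 (Nat.sInf_mem hne)

theorem braidIndex_le {n : ℕ} {K : Set Space} {w : BraidWord n} (h : Represents w K) :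
    braidIndex K ≤ n := iInf₂_le n ⟨w, h⟩

theorem reducedLength_eq_one_or_three_le {n : ℕ} {K : Set Space} (hK : IsKnot K)
    (hnontrivial : ¬ IsTrivial K) (hn : braidIndex K ≤ n) :
    reducedLength n K = 1 ∧ (IsTrefoil K ∨ IsFigureEight K) ∨ 3 ≤ reducedLength n K := by
  obtain ⟨w, hw, hlength, hiso⟩ := exists_word_length_eq_minLength hK hn
  rw [reducedLength, ← hlength]
  refine (length_of_isKnot hK hnontrivial hw hiso).imp (And.imp_left fun h => ?_) fun h => ?_
  all_goals omega

theorem reducedLength_eq_one {n : ℕ} {K : Set Space} (hK : IsKnot K)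
    (hnontrivial : ¬ IsTrivial K) {w : BraidWord n} (hw : Represents w K)
    (hlength : w.length = n + 1) : reducedLength n K = 1 := by
  have hle : minLength n K ≤ n + 1 := Nat.sInf_le ⟨w, hlength, hw⟩
  refine ((reducedLength_eq_one_or_three_le hK hnontrivial (braidIndex_le hw)).resolve_right
    fun h => ?_).1
  rw [reducedLength] at h
  omega

theorem exists_represents_length_eq {K : Set Space} (h : IsTrefoil K ∨ IsFigureEight K) :
    ∃ n, ∃ w : BraidWord n, w.length = n + 1 ∧ Represents w K := by
  rcases h with ⟨e, h⟩ | h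
  exacts [⟨2, trefoilWord e, rfl, h.symm⟩, ⟨3, figureEightWord, rfl, h.symm⟩]

end KnotBraid

theorem theorem1p5 (K : Set KnotBraid.Space) (hK : KnotBraid.IsKnot K)
    (hnontrivial : ¬ KnotBraid.IsTrivial K) :
    ((∃ n : ℕ, KnotBraid.braidIndex K ≤ (n : ℕ∞) ∧ KnotBraid.reducedLength n K = 1) ↔
        (KnotBraid.IsTrefoil K ∨ KnotBraid.IsFigureEight K)) ∧
      (¬ (KnotBraid.IsTrefoil K ∨ KnotBraid.IsFigureEight K) →
        ∀ n : ℕ, KnotBraid.braidIndex K ≤ (n : ℕ∞) → 3 ≤ KnotBraid.reducedLength n K) := by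
  have hdichotomy := fun n => KnotBraid.reducedLength_eq_one_or_three_le (n := n) hK hnontrivial
  refine ⟨⟨?_, fun h => ?_⟩, fun hne n hn =>
    (hdichotomy n hn).resolve_left fun h => hne h.2⟩
  · rintro ⟨n, hn, hone⟩
    exact ((hdichotomy n hn).resolve_right fun hthree => by omega).2
  · obtain ⟨n, w, hlength, hw⟩ := KnotBraid.exists_represents_length_eq h
    exact ⟨n, KnotBraid.braidIndex_le hw,
      KnotBraid.reducedLength_eq_one hK hnontrivial hw hlength⟩
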